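/- **Conventions.** Smooth means $C^\infty$. A *reduced orbifold chart* of dimension $n$ on a space $X$ is a triple $(\tilde X,G,\pi)$ where $\tilde X\subseteq\mathbb R^n$ is a non-empty connected open set, $G$ is a finite group of diffeomorphisms of $\tilde X$ (acting effectively), and $\pi:\tilde X\to X$ is a continuous open map whose fibres are the $G$-orbits (so $\pi$ induces a homeomorphism from $\tilde X/G$ to the open set $\pi(\tilde X)$). A *change of charts* from $(\tilde X_1,G_1,\pi_1)$ to $(\tilde X_2,G_2,\pi_2)$ is a diffeomorphism $\lambda:\operatorname{dom}\lambda\to\operatorname{cod}\lambda$ with $\pi_2\circ\lambda=\pi_1$ on $\operatorname{dom}\lambda$, where $\operatorname{dom}\lambda$ is a connected component of $\pi_1^{-1}(Y)$ for a non-empty open $Y\subseteq\pi_1(\tilde X_1)$ and $\operatorname{cod}\lambda\subseteq\tilde X_2$ is open. A *reduced orbifold atlas* $\mathcal X$ of dimension $n$ on a paracompact, second countable, Hausdorff space $X$ is a family of reduced orbifold charts $(\tilde X_i,G_i,\pi_i)_{i\in I}$ of dimension $n$ whose images cover $X$ and such that, whenever $\pi_i(x)=\pi_j(y)$, there is a change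 of charts $\lambda$ from the $i$-th to the $j$-th chart with $x\in\operatorname{dom}\lambda$. Let $\mathrm{Ch}(\mathcal X,i,j)$ be the set of changes of charts from the $i$-th to the $j$-th chart and $\mathrm{Ch}(\mathcal X)$ their disjoint union; a germ of $\lambda\in \mathrm{Ch}(\mathcal X,i,j)$ remembers $i$ and $j$. **The 2-category $\mathbf{RedAtl}$.** Its objects are the reduced orbifold atlases. *Morphisms* $\mathcal X\to\mathcal Y=(\tilde Y_j,H_j,\chi_j)_{j\in J}$ are tuples $(f,\bar f,\{\tilde f_i\}_{i\in I},[P,\nu])$: $f:X\to Y$ is continuous; $\bar f:I\to J$ satisfies $f(\pi_i(\tilde X_i))\subseteq\chi_{\bar f(i)}(\tilde Y_{\bar f(i)})$; $\tilde f_i:\tilde X_i\to\tilde Y_{\bar f(i)}$ is smooth with $\chi_{\bar f(i)}\circ\tilde f_i=f\circ\pi_i$; $P\subseteq\mathrm{Ch}(\mathcal X)$ contains, for each $\lambda\in \mathrm{Ch}(\mathcal X)$ and $x\in\operatorname{dom}\lambda$, a member having the same germ at $x$ as $\lambda$; and $\nu$ sends $\lambda\in P(i,i')$ to some $\nu(\lambda)\in\mathrm{Ch}(\mathcal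 Y,\bar f(i),\bar f(i'))$ with $\tilde f_i(\operatorname{dom}\lambda)\subseteq\operatorname{dom}\nu(\lambda)$, $\tilde f_{i'}(\operatorname{cod}\lambda)\subseteq\operatorname{cod}\nu(\lambda)$, $\tilde f_{i'}\circ\lambda=\nu(\lambda)\circ\tilde f_i$ on $\operatorname{dom}\lambda$, and such that the assignment $\operatorname{germ}_x\lambda\mapsto\operatorname{germ}_{\tilde f_i(x)}\nu(\lambda)$ is well defined and preserves compositions and identities. Two pairs $(P,\nu)$, $(P',\nu')$ are equivalent if they induce the same assignment on germs. Composition composes $f$, $\bar f$, $\tilde f$ and these assignments on germs; more precisely, $[P_{g\circ f},\nu_{g\circ f}]$ is represented by restrictions of members $\lambda$ of $P_f$ to domains on which $\nu_f(\lambda)$ agrees near the image with a member $\omega$ of $P_g$, sent to $\nu_g(\omega)$. The identity of $\mathcal X$ is $(\mathrm{id},\mathrm{id},\{\mathrm{id}\},[\mathrm{Ch}(\mathcal X),\mathrm{id}])$. *2-morphisms* $(f,\bar f^1,\{\tilde f^1_i\},[P_1,\nu_1])\Rightarrow(f,\bar f^2,\{\tilde f^2_i\},[P_2,\nu_2])$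 exist only between morphisms over the same $f$. They are classes $[\delta]$ of families $\delta=\{(\tilde X_i^a,\delta_i^a)\}_{i\in I,a\in A(i)}$ where, for each $i$, $\{\tilde X_i^a\}_a$ is an open cover of $\tilde X_i$; $\delta_i^a\in\mathrm{Ch}(\mathcal Y,\bar f^1(i),\bar f^2(i))$ with $\tilde f_i^1(\tilde X_i^a)\subseteq\operatorname{dom}\delta_i^a$, $\tilde f^2_i(\tilde X_i^a)\subseteq\operatorname{cod}\delta^a_i$ and $\tilde f_i^2=\delta_i^a\circ\tilde f_i^1$ on $\tilde X_i^a$; $\delta_i^a$ and $\delta_i^{a'}$ have the same germ at $\tilde f_i^1(x)$ for $x\in\tilde X_i^a\cap\tilde X_i^{a'}$; and for $\lambda\in\mathrm{Ch}(\mathcal X,i,i')$ and $x\in\operatorname{dom}\lambda\cap\tilde X_i^a$ with $\lambda(x)\in\tilde X_{i'}^{a'}$ there are representatives $(P_m,\nu_m)$ of the given classes and $\lambda^m\in P_m(i,i')$ ($m=1,2$) with $\operatorname{germ}_x\lambda^m=\operatorname{germ}_x\lambda$ and $$\operatorname{germ}_{\tilde f_i^2(x)}\nu_2(\lambda^2)\cdot\operatorname{germ}_{\tilde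 f_i^1(x)}\delta_i^a=\operatorname{germ}_{\tilde f^1_{i'}(\lambda(x))}\delta_{i'}^{a'}\cdot\operatorname{germ}_{\tilde f_i^1(x)}\nu_1(\lambda^1).$$ Two families are equivalent if $\operatorname{germ}_{\tilde f_i^1(x)}\delta_i^a=\operatorname{germ}_{\tilde f_i^1(x)}\bar\delta_i^{b}$ whenever $x\in\tilde X_i^a\cap\tilde X_i^{b}$. The vertical composition $[\sigma]\odot[\delta]$ is the class of the (restricted) composites $\sigma_i^b\circ\delta_i^a$ over subsets of $\tilde X_i^a\cap\tilde X_i^b$. The horizontal composition $[\xi]*[\delta]$, for $[\xi]:\mathbf g^1\Rightarrow \mathbf g^2:\mathcal Y\to\mathcal Z$, is the class of the (restricted) composites $\xi^c_{\bar f^2(i)}\circ\nu_{g^1}(\tilde\delta_i^a)$, where $\tilde\delta_i^a\in P_{g^1}$ has the same germs as $\delta_i^a$ along the image of the open set considered. The identity of $(f,\bar f,\{\tilde f_i\},[P,\nu])$ is the class of $\{(\tilde X_i,\mathrm{id}_{\tilde Y_{\bar f(i)}})\}_i$. **The 2-category $\mathbf{PEEGpd}$.** Its objects are the Lie groupoids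 $(X_0,X_1,s,t,m,i,e)$ (with $X_0,X_1$ Hausdorff paracompact smooth manifolds) that are *étale* ($s,t$ are local diffeomorphisms), *proper* ($(s,t):X_1\to X_0\times X_0$ is proper) and *effective* (for each $x_0\in X_0$ the map $x_1\mapsto\operatorname{germ}_{x_1}t\cdot(\operatorname{germ}_{x_1}s)^{-1}$ is injective on the arrows from $x_0$ to $x_0$); $m(a,b)$ is the product "first $a$, then $b$". Morphisms are pairs $(\psi_0,\psi_1)$ of smooth maps commuting with the structure maps. A 2-morphism $(\psi^1_0,\psi^1_1)\Rightarrow(\psi^2_0,\psi^2_1)$ is a smooth $\alpha:X_0\to Y_1$ with $s\circ\alpha=\psi^1_0$, $t\circ\alpha=\psi_0^2$ and $m(\alpha(s(a)),\psi^2_1(a))=m(\psi_1^1(a),\alpha(t(a)))$ for all $a\in X_1$. Compositions are $(\beta\odot\alpha)(x)=m(\alpha(x),\beta(x))$ and, for $\beta:\phi^1\Rightarrow\phi^2$, $(\beta*\alpha)(x)=m(\phi^1_1(\alpha(x)),\beta(\psi^2_0(x)))$. **Theorem.** For a reduced orbifold atlas $\mathcal X$ let $F^{\mathrm{red}}_0(\mathcal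 X)$ have objects $X_0=\coprod_i\tilde X_i$ and arrows $X_1=\{\operatorname{germ}_x\lambda:\lambda\in\mathrm{Ch}(\mathcal X),\ x\in\operatorname{dom}\lambda\}$ with the germ topology and smooth structure (charts $\operatorname{germ}_x\lambda\mapsto x\in\operatorname{dom}\lambda$), with $s(\operatorname{germ}_x\lambda)=x$, $t(\operatorname{germ}_x\lambda)=\lambda(x)$, and with multiplication, inverse and identities given by composition, inversion and identities of germs. For a morphism $\mathbf f=(f,\bar f,\{\tilde f_i\},[P,\nu])$ let $F_1^{\mathrm{red}}(\mathbf f)=(\psi_0,\psi_1)$ with $\psi_0|_{\tilde X_i}=\tilde f_i$ and $\psi_1(\operatorname{germ}_x\lambda)=\operatorname{germ}_{\tilde f_i(x)}\nu(\lambda)$ for $\lambda\in P(i,i')$, $x\in\operatorname{dom}\lambda$. For a 2-morphism $[\delta]$ from $(f,\bar f^1,\{\tilde f^1_i\},[P_1,\nu_1])$ let $F_2^{\mathrm{red}}([\delta])(x)=\operatorname{germ}_{\tilde f^1_i(x)}\delta_i^a$ for $x\in\tilde X_i^a$. Then $F_0^{\mathrm{red}}(\mathcal X)$ is a proper, effective,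 étale groupoid, $F_1^{\mathrm{red}}(\mathbf f)$ is a morphism of Lie groupoids, $F_2^{\mathrm{red}}([\delta])$ is a natural transformation $F_1^{\mathrm{red}}(\mathbf f^1)\Rightarrow F_1^{\mathrm{red}}(\mathbf f^2)$ for $[\delta]:\mathbf f^1\Rightarrow\mathbf f^2$, and $(F_0^{\mathrm{red}},F_1^{\mathrm{red}},F_2^{\mathrm{red}})$ is a strict 2-functor $\mathbf{RedAtl}\to\mathbf{PEEGpd}$: it preserves identities and compositions of morphisms, identities of 2-morphisms, and vertical and horizontal compositions of 2-morphisms. -/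

import Mathlib

open CategoryTheory TopologicalSpace Set Filter Topology
open scoped Manifold ContDiff

universe u

set_option linter.unusedVariables false

noncomputable section

namespace RedOrb

/-- The space `ℝⁿ`. -/
abbrev Euc (n : ℕ) := EuclideanSpace ℝ (Fin n)

section Charts

variable {X : Type u} [TopologicalSpace X] {n : ℕ}

variable (X n) in
/-- A reduced orbifold chart `(X̃, G, π)` of dimension `n` for the open non-empty subset
`X' = π(X̃)` of `X`. The group `G` is a finite group of diffeomorphisms of `X̃` (a subgroup of the
permutations of `X̃`, so it acts effectively). The map `π` is continuous and open, and its fibres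
are the orbits of `G`; this says that `π` induces a homeomorphism from `X̃ / G` to `X'`. -/
structure OrbChart where
  space : Opens (Euc n)
  isConnected_space : IsConnected (space : Set (Euc n))
  G : Subgroup (Equiv.Perm space)
  finite_G : Finite G
  smooth_G : ∀ g ∈ G, ContMDiff 𝓘(ℝ, Euc n) 𝓘(ℝ, Euc n) ∞ (g : space → space)
  proj : space → X
  continuous_proj : Continuous proj
  isOpenMap_proj : IsOpenMap proj
  proj_eq_proj_iff : ∀ x y : space, proj x = proj y ↔ ∃ g ∈ G, g x = y

/-- The preimage `π⁻¹(Y)`, as a subset of `ℝⁿ`. -/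
def OrbChart.preim (c : OrbChart X n) (Y : Set X) : Set (Euc n) :=
  Subtype.val '' (c.proj ⁻¹' Y)

/-- A change of charts from `c` to `d`: a diffeomorphism `dom → cod`, compatible with the
projections, where `dom` is a connected component of `π⁻¹(Y)` for an open non-empty subset `Y`
of the image of `c`, and where `cod` is an open subset of the domain of `d`. -/
structure ChangeOfCharts (c d : OrbChart X n) where
  dom : Opens (Euc n)
  cod : Opens (Euc n)
  dom_le : dom ≤ c.space
  cod_le : cod ≤ d.space
  isComponent : ∃ Y : Set X, IsOpen Y ∧ Y.Nonempty ∧ Y ⊆ range c.proj ∧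
    ∃ x ∈ c.preim Y, (dom : Set (Euc n)) = connectedComponentIn (c.preim Y) x
  diffeo : Diffeomorph 𝓘(ℝ, Euc n) 𝓘(ℝ, Euc n) dom cod ∞
  comm : ∀ x : dom, d.proj ⟨diffeo x, cod_le (diffeo x).2⟩ = c.proj ⟨x, dom_le x.2⟩

namespace ChangeOfCharts

variable {c d : OrbChart X n}

open Classical in
/-- A change of charts is written as a function on `ℝⁿ`; only its values on `dom` (and its germs
at points of `dom`) are ever used. -/
def ext (l : ChangeOfCharts c d) (x : Euc n) : Euc n :=
  if h : x ∈ l.dom then (l.diffeo ⟨x, h⟩ : Euc n) else x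

instance : CoeFun (ChangeOfCharts c d) (fun _ => Euc n → Euc n) := ⟨ext⟩

theorem ext_of_mem (l : ChangeOfCharts c d) {x : Euc n} (h : x ∈ l.dom) :
    l x = (l.diffeo ⟨x, h⟩ : Euc n) := dif_pos h

theorem mem_cod (l : ChangeOfCharts c d) {x : Euc n} (h : x ∈ l.dom) : l x ∈ l.cod := by
  rw [l.ext_of_mem h]; exact (l.diffeo ⟨x, h⟩).2

/-- The value of a change of charts at a point of its domain, as a point of the chart `d`. -/
abbrev apply (l : ChangeOfCharts c d) (x : c.space) (h : (x : Euc n) ∈ l.dom) : d.space :=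
  ⟨l x, l.cod_le (l.mem_cod h)⟩

theorem proj_apply (l : ChangeOfCharts c d) (x : c.space) (h : (x : Euc n) ∈ l.dom) :
    d.proj (l.apply x h) = c.proj x := by
  rw [← l.comm ⟨x, h⟩]
  congr 1
  exact Subtype.ext (l.ext_of_mem h)

open Classical in
/-- A change of charts as a partial homeomorphism of `ℝⁿ`. -/
def toPH (l : ChangeOfCharts c d) : OpenPartialHomeomorph (Euc n) (Euc n) where
  toFun := l
  invFun y := if h : y ∈ l.cod then (l.diffeo.symm ⟨y, h⟩ : Euc n) else y
  source := l.dom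
  target := l.cod
  map_source' x h := l.mem_cod h
  map_target' y h := by
    have h' : y ∈ l.cod := h
    simp only [h', dif_pos]
    exact (l.diffeo.symm ⟨y, h'⟩).2
  left_inv' x h := by
    have h' : x ∈ l.dom := h
    simp [l.ext_of_mem h']
  right_inv' y h := by
    have h' : y ∈ l.cod := h
    simp only [h', dif_pos]
    rw [l.ext_of_mem (l.diffeo.symm ⟨y, h'⟩).2]
    simp
  open_source := l.dom.2
  open_target := l.cod.2
  continuousOn_toFun := by
    rw [continuousOn_iff_continuous_domRestrict]
    have : Continuous (fun x : l.dom => (l.diffeo x : Euc n)) :=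
      continuous_subtype_val.comp l.diffeo.continuous
    exact this.congr fun x => (l.ext_of_mem x.2).symm
  continuousOn_invFun := by
    rw [continuousOn_iff_continuous_domRestrict]
    have : Continuous (fun x : l.cod => (l.diffeo.symm x : Euc n)) :=
      continuous_subtype_val.comp l.diffeo.symm.continuous
    exact this.congr fun x => by simp

theorem contDiffOn (l : ChangeOfCharts c d) : ContDiffOn ℝ ∞ l l.dom := by
  intro x hx
  have h : ContMDiff 𝓘(ℝ, Euc n) 𝓘(ℝ, Euc n) ∞ (fun x : l.dom => l x) := by
    have : (fun x : l.dom => l x) = Subtype.val ∘ l.diffeo := by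
      funext x; exact l.ext_of_mem x.2
    rw [this]
    exact contMDiff_subtype_val.comp l.diffeo.contMDiff
  have := contMDiffAt_subtype_iff.1 (h ⟨x, hx⟩)
  exact (contMDiffAt_iff_contDiffAt.1 this).contDiffWithinAt

theorem contDiffOn_symm (l : ChangeOfCharts c d) : ContDiffOn ℝ ∞ l.toPH.symm l.cod := by
  intro x hx
  have h : ContMDiff 𝓘(ℝ, Euc n) 𝓘(ℝ, Euc n) ∞ (fun x : l.cod => l.toPH.symm x) := by
    have : (fun x : l.cod => l.toPH.symm x) = Subtype.val ∘ l.diffeo.symm := by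
      funext x; exact dif_pos x.2
    rw [this]
    exact contMDiff_subtype_val.comp l.diffeo.symm.contMDiff
  have := contMDiffAt_subtype_iff.1 (h ⟨x, hx⟩)
  exact (contMDiffAt_iff_contDiffAt.1 this).contDiffWithinAt

theorem contMDiff_codRestrict {m : ℕ} {U : Opens (Euc m)} {V : Opens (Euc n)} {f : U → V}
    (h : ContMDiff 𝓘(ℝ, Euc m) 𝓘(ℝ, Euc n) ∞ (fun x => (f x : Euc n))) :
    ContMDiff 𝓘(ℝ, Euc m) 𝓘(ℝ, Euc n) ∞ f := by
  intro x
  rw [contMDiffAt_iff_target]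
  exact ⟨(continuous_induced_rng.2 h.continuous).continuousAt, h x⟩

/-- Every connected component of `π⁻¹(Y)` lies in a prescribed neighbourhood of its point `x`,
if `Y` is small enough. -/
theorem exists_small_component (c : OrbChart X n) (x : c.space) (U : Set (Euc n))
    (hU : U ∈ 𝓝 (x : Euc n)) : ∃ Y : Set X, IsOpen Y ∧ Y ⊆ range c.proj ∧ c.proj x ∈ Y ∧
      connectedComponentIn (c.preim Y) x ⊆ U := by
  classical
  have := c.finite_G
  -- the other points of the orbit
  let S : Set c.space := {y | y ≠ x ∧ c.proj y = c.proj x}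
  have hS : S.Finite := by
    refine (Set.finite_range (fun g : c.G => (g : Equiv.Perm c.space) x)).subset ?_
    rintro y ⟨-, hy⟩
    obtain ⟨g, hg, rfl⟩ := (c.proj_eq_proj_iff x y).1 hy.symm
    exact ⟨⟨g, hg⟩, rfl⟩
  obtain ⟨A, B, hA, hB, hxA, hSB, hAB⟩ : SeparatedNhds {x} S :=
    SeparatedNhds.of_finite (Set.finite_singleton x) hS
      (Set.disjoint_singleton_left.2 fun h => h.1 rfl)
  let A' : Set c.space := A ∩ interior (Subtype.val ⁻¹' U)
  have hA' : IsOpen A' := hA.inter isOpen_interior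
  have hxA' : x ∈ A' := ⟨hxA rfl, mem_interior_iff_mem_nhds.2
    (continuous_subtype_val.continuousAt.preimage_mem_nhds hU)⟩
  have hcont : ∀ g ∈ c.G, Continuous (g : c.space → c.space) :=
    fun g hg => (c.smooth_G g hg).continuous
  let W : Set c.space := ⋂ g : c.G, (g : Equiv.Perm c.space) ⁻¹' (A' ∪ B)
  have hW : IsOpen W := isOpen_iInter_of_finite fun g => (hA'.union hB).preimage (hcont g g.2)
  have hxW : x ∈ W := by
    refine Set.mem_iInter.2 fun g => ?_
    by_cases h : (g : Equiv.Perm c.space) x = x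
    · exact Or.inl (by rw [h]; exact hxA')
    · exact Or.inr (hSB ⟨h, ((c.proj_eq_proj_iff _ _).2 ⟨g, g.2, rfl⟩).symm⟩)
  have hpre : c.proj ⁻¹' (c.proj '' W) ⊆ A' ∪ B := by
    rintro y ⟨w, hw, hwy⟩
    obtain ⟨g, hg, rfl⟩ := (c.proj_eq_proj_iff w y).1 hwy
    exact Set.mem_iInter.1 hw ⟨g, hg⟩
  have hemb : IsOpenMap (Subtype.val : c.space → Euc n) := c.space.2.isOpenMap_subtype_val
  refine ⟨c.proj '' W, c.isOpenMap_proj W hW, Set.image_subset_range _ _, ⟨x, hxW, rfl⟩, ?_⟩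
  have hsub : connectedComponentIn (c.preim (c.proj '' W)) x ⊆ Subtype.val '' A' := by
    refine IsPreconnected.subset_left_of_subset_union (hemb _ hA') (hemb _ hB) ?_ ?_ ?_
      isPreconnected_connectedComponentIn
    · exact (Set.disjoint_image_iff Subtype.val_injective).2 (hAB.mono_left inter_subset_left)
    · refine (connectedComponentIn_subset _ _).trans ?_
      rw [← Set.image_union]
      exact Set.image_mono hpre
    · exact ⟨x, mem_connectedComponentIn ⟨x, ⟨x, hxW, rfl⟩, rfl⟩, ⟨x, hxA', rfl⟩⟩
  refine hsub.trans ?_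
  rintro _ ⟨y, hy, rfl⟩
  exact interior_subset (s := Subtype.val ⁻¹' U) hy.2

/-- A local diffeomorphism compatible with the projections restricts to a change of charts near
each point. -/
theorem exists_of_local (c d : OrbChart X n) (e : OpenPartialHomeomorph (Euc n) (Euc n))
    (he : ContDiffOn ℝ ∞ e e.source) (he' : ContDiffOn ℝ ∞ e.symm e.target)
    (hs : e.source ⊆ c.space) (ht : e.target ⊆ d.space)
    (hcomm : ∀ (x : Euc n) (h : x ∈ e.source),
      d.proj ⟨e x, ht (e.map_source h)⟩ = c.proj ⟨x, hs h⟩)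
    (x : Euc n) (hx : x ∈ e.source) (U : Set (Euc n)) (hU : U ∈ 𝓝 x) :
    ∃ l : ChangeOfCharts c d, x ∈ l.dom ∧ (l.dom : Set (Euc n)) ⊆ e.source ∩ U ∧
      ∀ y ∈ l.dom, l y = e y := by
  obtain ⟨Y, hY, hYr, hxY, hsub⟩ := exists_small_component c ⟨x, hs hx⟩ (e.source ∩ U)
    (inter_mem (e.open_source.mem_nhds hx) hU)
  have hpre : IsOpen (c.preim Y) :=
    c.space.2.isOpenMap_subtype_val _ (hY.preimage c.continuous_proj)
  have hxp : x ∈ c.preim Y := ⟨⟨x, hs hx⟩, hxY, rfl⟩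
  let D : Opens (Euc n) := ⟨connectedComponentIn (c.preim Y) x, hpre.connectedComponentIn⟩
  have hDs : (D : Set (Euc n)) ⊆ e.source := fun y hy => (hsub hy).1
  let C : Opens (Euc n) := ⟨e '' D, e.isOpen_image_of_subset_source D.2 hDs⟩
  have hCt : (C : Set (Euc n)) ⊆ e.target := by
    rintro _ ⟨y, hy, rfl⟩
    exact e.map_source (hDs hy)
  have hback : ∀ y ∈ C, e.symm y ∈ D := by
    rintro _ ⟨y, hy, rfl⟩
    rw [e.left_inv (hDs hy)]
    exact hy
  let l : ChangeOfCharts c d :=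
    { dom := D
      cod := C
      dom_le := hDs.trans hs
      cod_le := hCt.trans ht
      isComponent := ⟨Y, hY, ⟨_, hxY⟩, hYr, x, hxp, rfl⟩
      diffeo :=
        { toFun := fun y => ⟨e y, y, y.2, rfl⟩
          invFun := fun y => ⟨e.symm y, hback y y.2⟩
          left_inv := fun y => Subtype.ext (e.left_inv (hDs y.2))
          right_inv := fun y => Subtype.ext (e.right_inv (hCt y.2))
          contMDiff_toFun := by
            refine contMDiff_codRestrict fun y => ?_
            exact contMDiffAt_subtype_iff.2 (contMDiffAt_iff_contDiffAt.2
              (he.contDiffAt (e.open_source.mem_nhds (hDs y.2))))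
          contMDiff_invFun := by
            refine contMDiff_codRestrict fun y => ?_
            exact contMDiffAt_subtype_iff.2 (contMDiffAt_iff_contDiffAt.2
              (he'.contDiffAt (e.open_target.mem_nhds (hCt y.2)))) }
      comm := fun y => hcomm y (hDs y.2) }
  exact ⟨l, mem_connectedComponentIn hxp, hsub, fun y hy => l.ext_of_mem hy⟩

/-- Restricting a change of charts to a small neighbourhood of a point. -/
theorem exists_restrict (l : ChangeOfCharts c d) {x : Euc n} (hx : x ∈ l.dom) {U : Set (Euc n)}
    (hU : U ∈ 𝓝 x) : ∃ l' : ChangeOfCharts c d, x ∈ l'.dom ∧ (l'.dom : Set (Euc n)) ⊆ l.dom ∩ U ∧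
      ∀ y ∈ l'.dom, l' y = l y :=
  exists_of_local c d l.toPH l.contDiffOn l.contDiffOn_symm l.dom_le l.cod_le
    (fun y hy => l.proj_apply ⟨y, l.dom_le hy⟩ hy) x hx U hU

/-- Composing two changes of charts near a point. -/
theorem exists_comp {b : OrbChart X n} (l : ChangeOfCharts c d) (l' : ChangeOfCharts d b)
    {x : Euc n} (hx : x ∈ l.dom) (hx' : l x ∈ l'.dom) {U : Set (Euc n)} (hU : U ∈ 𝓝 x) :
    ∃ l'' : ChangeOfCharts c b, x ∈ l''.dom ∧ (l''.dom : Set (Euc n)) ⊆ U ∧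
      ∀ y ∈ l''.dom, y ∈ l.dom ∧ l y ∈ l'.dom ∧ l'' y = l' (l y) := by
  obtain ⟨l'', h1, h2, h3⟩ := exists_of_local c b (l.toPH.trans l'.toPH)
    (by
      rw [OpenPartialHomeomorph.coe_trans, OpenPartialHomeomorph.trans_source]
      exact l'.contDiffOn.comp (l.contDiffOn.mono inter_subset_left) fun y hy => hy.2)
    (by
      rw [OpenPartialHomeomorph.coe_trans_symm, OpenPartialHomeomorph.trans_target]
      exact l.contDiffOn_symm.comp (l'.contDiffOn_symm.mono inter_subset_left) fun y hy => hy.2)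
    (by
      rw [OpenPartialHomeomorph.trans_source]
      exact fun y hy => l.dom_le hy.1)
    (by
      rw [OpenPartialHomeomorph.trans_target]
      exact fun y hy => l'.cod_le hy.1)
    (by
      intro y hy
      rw [OpenPartialHomeomorph.trans_source] at hy
      exact (l'.proj_apply (l.apply ⟨y, l.dom_le hy.1⟩ hy.1) hy.2).trans
        (l.proj_apply ⟨y, l.dom_le hy.1⟩ hy.1))
    x (by rw [OpenPartialHomeomorph.trans_source]; exact ⟨hx, hx'⟩) U hU
  rw [OpenPartialHomeomorph.trans_source] at h2
  exact ⟨l'', h1, fun y hy => (h2 hy).2, fun y hy => ⟨(h2 hy).1.1, (h2 hy).1.2, h3 y hy⟩⟩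

/-- Inverting a change of charts near a point. -/
theorem exists_inv (l : ChangeOfCharts c d) {x : Euc n} (hx : x ∈ l.dom) :
    ∃ l' : ChangeOfCharts d c, l x ∈ l'.dom ∧ (l'.dom : Set (Euc n)) ⊆ l.cod ∧
      ∀ y ∈ l.dom, l y ∈ l'.dom → l' (l y) = y := by
  obtain ⟨l', h1, h2, h3⟩ := exists_of_local d c l.toPH.symm l.contDiffOn_symm
    l.contDiffOn l.cod_le l.dom_le
    (by
      intro y hy
      have hy' : l.toPH.symm y ∈ l.dom := l.toPH.map_target hy
      have h := l.proj_apply ⟨l.toPH.symm y, l.dom_le hy'⟩ hy'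
      rw [← h]
      congr 1
      exact Subtype.ext (l.toPH.right_inv hy))
    (l x) (l.mem_cod hx) univ univ_mem
  refine ⟨l', h1, fun y hy => (h2 hy).1, fun y hy hy' => ?_⟩
  rw [h3 _ hy']
  exact l.toPH.left_inv hy

/-- The identity of a chart, as a change of charts. -/
def refl (c : OrbChart X n) : ChangeOfCharts c c where
  dom := c.space
  cod := c.space
  dom_le := le_rfl
  cod_le := le_rfl
  isComponent := by
    obtain ⟨x, hx⟩ := c.isConnected_space.nonempty
    have h : c.preim (range c.proj) = c.space := by
      simp [OrbChart.preim]
    refine ⟨range c.proj, c.isOpenMap_proj.isOpen_range, ⟨_, ⟨x, hx⟩, rfl⟩, Subset.rfl, x, ?_, ?_⟩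
    · rw [h]; exact hx
    · rw [h]
      exact (c.isConnected_space.isPreconnected.connectedComponentIn hx).symm
  diffeo := Diffeomorph.refl _ _ _
  comm _ := rfl

theorem mem_refl_dom (c : OrbChart X n) (x : c.space) : (x : Euc n) ∈ (refl c).dom := x.2

theorem refl_apply (c : OrbChart X n) {x : Euc n} (hx : x ∈ c.space) : refl c x = x :=
  (refl c).ext_of_mem hx

theorem refl_eventuallyEq (c : OrbChart X n) {x : Euc n} (hx : x ∈ c.space) :
    refl c =ᶠ[𝓝 x] id :=
  (c.space.2.mem_nhds hx : _) |> fun h => mem_of_superset h fun _ hy => refl_apply c hy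

theorem eventually_mem (l : ChangeOfCharts c d) {x : Euc n} (hx : x ∈ l.dom) :
    ∀ᶠ y in 𝓝 x, y ∈ l.dom := l.dom.2.mem_nhds hx

theorem continuousAt (l : ChangeOfCharts c d) {x : Euc n} (hx : x ∈ l.dom) : ContinuousAt l x :=
  (l.contDiffOn.continuousOn).continuousAt (l.dom.2.mem_nhds hx)

end ChangeOfCharts

end Charts

/-! ### Reduced orbifold atlases and germs of changes of charts -/

/-- A reduced orbifold atlas on a paracompact, second countable, Hausdorff space. -/
structure RedAtl where
  carrier : Type u
  [topologicalSpace : TopologicalSpace carrier]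
  [t2Space : T2Space carrier]
  [secondCountable : SecondCountableTopology carrier]
  [paracompact : ParacompactSpace carrier]
  dim : ℕ
  Idx : Type u
  chart : Idx → OrbChart carrier dim
  cover : ⋃ i, range (chart i).proj = univ
  compatible : ∀ (i j : Idx) (x : (chart i).space) (y : (chart j).space),
    (chart i).proj x = (chart j).proj y →
      ∃ l : ChangeOfCharts (chart i) (chart j), (x : Euc dim) ∈ l.dom

attribute [instance] RedAtl.topologicalSpace

namespace RedAtl

/-- The domain `X̃ᵢ` of the `i`-th chart. -/
abbrev sp (X : RedAtl.{u}) (i : X.Idx) : Opens (Euc X.dim) := (X.chart i).space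

/-- The set of changes of charts from the `i`-th to the `j`-th chart. -/
abbrev Ch (X : RedAtl.{u}) (i j : X.Idx) : Type := ChangeOfCharts (X.chart i) (X.chart j)

/-- The disjoint union of the domains of all charts. -/
abbrev Obj (X : RedAtl.{u}) : Type u := Σ i : X.Idx, X.sp i

/-- A change of charts with a point of its domain. -/
structure LocalArr (X : RedAtl.{u}) where
  i : X.Idx
  j : X.Idx
  l : X.Ch i j
  x : X.sp i
  mem : (x : Euc X.dim) ∈ l.dom

/-- Two pointed changes of charts have the same germ: the source charts, the target charts and the
points agree, and the maps agree near the point. -/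
inductive SameGerm (X : RedAtl.{u}) : X.LocalArr → X.LocalArr → Prop
  | mk {i j : X.Idx} (l l' : X.Ch i j) (x : X.sp i) (h : (x : Euc X.dim) ∈ l.dom)
      (h' : (x : Euc X.dim) ∈ l'.dom) (e : l =ᶠ[𝓝 (x : Euc X.dim)] l') :
      SameGerm X ⟨i, j, l, x, h⟩ ⟨i, j, l', x, h'⟩

instance germSetoid (X : RedAtl.{u}) : Setoid X.LocalArr where
  r := X.SameGerm
  iseqv :=
    { refl := fun a => SameGerm.mk a.l a.l a.x a.mem a.mem EventuallyEq.rfl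
      symm := by rintro _ _ ⟨l, l', x, h, h', e⟩; exact SameGerm.mk l' l x h' h e.symm
      trans := by
        rintro _ _ _ ⟨l, l', x, h, h', e⟩ hb
        cases hb with
        | mk _ l'' _ _ h'' e' => exact SameGerm.mk l l'' x h h'' (e.trans e') }

/-- The set of germs of changes of charts of an atlas. -/
def Arr (X : RedAtl.{u}) : Type u := Quotient X.germSetoid

variable {X Y Z : RedAtl.{u}}

/-- The germ of `l` at `x`. -/
def germ {i j : X.Idx} (l : X.Ch i j) (x : X.sp i) (h : (x : Euc X.dim) ∈ l.dom) : X.Arr :=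
  Quotient.mk _ ⟨i, j, l, x, h⟩

theorem germ_eq_iff {i j : X.Idx} {l l' : X.Ch i j} {x : X.sp i}
    {h : (x : Euc X.dim) ∈ l.dom} {h' : (x : Euc X.dim) ∈ l'.dom} :
    germ l x h = germ l' x h' ↔ l =ᶠ[𝓝 (x : Euc X.dim)] l' := by
  constructor
  · intro e
    have e' : X.SameGerm _ _ := Quotient.exact e
    cases e'
    assumption
  · intro e
    exact Quotient.sound (SameGerm.mk l l' x h h' e)

theorem exists_germ (a : X.Arr) : ∃ (i j : X.Idx) (l : X.Ch i j) (x : X.sp i) (h : _),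
    a = germ l x h := by
  induction a using Quotient.inductionOn with
  | h a => exact ⟨a.i, a.j, a.l, a.x, a.mem, rfl⟩

/-- The source of a germ. -/
def src (a : X.Arr) : X.Obj :=
  Quotient.lift (fun a : X.LocalArr => (⟨a.i, a.x⟩ : X.Obj)) (by rintro _ _ ⟨⟩; rfl) a

/-- The target of a germ. -/
def tgt (a : X.Arr) : X.Obj :=
  Quotient.lift (fun a : X.LocalArr => (⟨a.j, a.l.apply a.x a.mem⟩ : X.Obj))
    (by
      rintro _ _ ⟨l, l', x, h, h', e⟩
      have : l.apply x h = l'.apply x h' := Subtype.ext e.eq_of_nhds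
      simp [this]) a

@[simp] theorem src_germ {i j : X.Idx} (l : X.Ch i j) (x : X.sp i) (h) :
    src (germ l x h) = ⟨i, x⟩ := rfl

@[simp] theorem tgt_germ {i j : X.Idx} (l : X.Ch i j) (x : X.sp i) (h) :
    tgt (germ l x h) = ⟨j, l.apply x h⟩ := rfl

/-- `c` is the product of the germs `a` (first) and `b` (second). -/
def IsMul (a b c : X.Arr) : Prop :=
  ∃ (i j k : X.Idx) (l : X.Ch i j) (l' : X.Ch j k) (l'' : X.Ch i k) (x : X.sp i)
    (h : (x : Euc X.dim) ∈ l.dom) (h' : (l.apply x h : Euc X.dim) ∈ l'.dom) (h'' : (x : Euc X.dim) ∈ l''.dom),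
    a = germ l x h ∧ b = germ l' (l.apply x h) h' ∧ c = germ l'' x h'' ∧
      l'' =ᶠ[𝓝 (x : Euc X.dim)] l' ∘ l

theorem exists_pair (a b : X.Arr) (e : tgt a = src b) :
    ∃ (i j k : X.Idx) (l : X.Ch i j) (l' : X.Ch j k) (x : X.sp i)
      (h : (x : Euc X.dim) ∈ l.dom) (h' : (l.apply x h : Euc X.dim) ∈ l'.dom),
      a = germ l x h ∧ b = germ l' (l.apply x h) h' := by
  obtain ⟨i, j, l, x, h, rfl⟩ := exists_germ a
  obtain ⟨j', k, l', y, h', rfl⟩ := exists_germ b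
  rw [tgt_germ, src_germ] at e
  cases e
  exact ⟨i, j, k, l, l', x, h, h', rfl, rfl⟩

theorem exists_isMul (a b : X.Arr) (e : tgt a = src b) : ∃ c, IsMul a b c := by
  obtain ⟨i, j, k, l, l', x, h, h', rfl, rfl⟩ := exists_pair a b e
  obtain ⟨l'', h'', -, hl⟩ := l.exists_comp l' h h' univ_mem
  exact ⟨germ l'' x h'', i, j, k, l, l', l'', x, h, h', h'', rfl, rfl, rfl,
    mem_of_superset (l''.eventually_mem h'') fun y hy => (hl y hy).2.2⟩

theorem IsMul.unique {a b c c' : X.Arr} (h : IsMul a b c) (h' : IsMul a b c') : c = c' := by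
  obtain ⟨i, j, k, l, m, n, x, hl, hm, hn, rfl, rfl, rfl, e⟩ := h
  obtain ⟨i', j', k', l', m', n', x', hl', hm', hn', ea, eb, rfl, e'⟩ := h'
  have ha : X.SameGerm _ _ := Quotient.exact ea
  cases ha with
  | mk _ l' _ _ hl' e1 =>
    obtain rfl : k = k' := congrArg (fun a => (tgt a).1) eb
    have hx : l'.apply x hl' = l.apply x hl := Subtype.ext e1.symm.eq_of_nhds
    have e2 : germ m (l.apply x hl) hm = germ m' (l.apply x hl) (hx ▸ hm') := by
      rw [eb]; congr 1
    refine germ_eq_iff.2 (e.trans (EventuallyEq.trans ?_ e'.symm))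
    refine EventuallyEq.trans (g := m' ∘ l) ?_ (e1.fun_comp m')
    exact (l.continuousAt hl).tendsto.eventually (germ_eq_iff.1 e2)

/-- The product of composable germs: `mul a b = b · a` as germs of maps. -/
def mul (a b : X.Arr) (e : tgt a = src b) : X.Arr := (exists_isMul a b e).choose

theorem mul_eq_of_isMul {a b c : X.Arr} (e : tgt a = src b) (h : IsMul a b c) : mul a b e = c :=
  (exists_isMul a b e).choose_spec.unique h

theorem mul_germ {i j k : X.Idx} {l : X.Ch i j} {l' : X.Ch j k} {l'' : X.Ch i k} {x : X.sp i}
    {y : X.sp j} (h : (x : Euc X.dim) ∈ l.dom) (h' : (y : Euc X.dim) ∈ l'.dom)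
    (h'' : (x : Euc X.dim) ∈ l''.dom) (hy : (y : Euc X.dim) = l x)
    (e : tgt (germ l x h) = src (germ l' y h')) (el : l'' =ᶠ[𝓝 (x : Euc X.dim)] l' ∘ l) :
    mul (germ l x h) (germ l' y h') e = germ l'' x h'' := by
  obtain rfl : y = l.apply x h := Subtype.ext hy
  exact mul_eq_of_isMul e ⟨i, j, k, l, l', l'', x, h, h', h'', rfl, rfl, rfl, el⟩

theorem comp_eventuallyEq_of_mul {i j k : X.Idx} {l : X.Ch i j} {l' : X.Ch j k} {l'' : X.Ch i k}
    {x : X.sp i} {y : X.sp j} (h : (x : Euc X.dim) ∈ l.dom) (h' : (y : Euc X.dim) ∈ l'.dom)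
    (h'' : (x : Euc X.dim) ∈ l''.dom) (hy : y = l.apply x h)
    (e : tgt (germ l x h) = src (germ l' y h'))
    (H : mul (germ l x h) (germ l' y h') e = germ l'' x h'') :
    l' ∘ l =ᶠ[𝓝 (x : Euc X.dim)] l'' := by
  subst hy
  obtain ⟨n, hn, -, en⟩ := l.exists_comp l' h h' univ_mem
  have e1 : n =ᶠ[𝓝 (x : Euc X.dim)] l' ∘ l :=
    mem_of_superset (n.eventually_mem hn) fun y hy => (en y hy).2.2
  rw [mul_germ h h' hn rfl e e1] at H
  exact e1.symm.trans (germ_eq_iff.1 H)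

/-- The germ of the identity at a point. -/
def one (o : X.Obj) : X.Arr := 
  germ (ChangeOfCharts.refl (X.chart o.1)) o.2 (ChangeOfCharts.mem_refl_dom _ o.2)

/-- `b` is the germ of the inverse of a change of charts with germ `a`. -/
def IsInv (a b : X.Arr) : Prop :=
  ∃ (i j : X.Idx) (l : X.Ch i j) (l' : X.Ch j i) (x : X.sp i)
    (h : (x : Euc X.dim) ∈ l.dom) (h' : (l.apply x h : Euc X.dim) ∈ l'.dom),
    a = germ l x h ∧ b = germ l' (l.apply x h) h' ∧
      ∀ᶠ y in 𝓝 (x : Euc X.dim), l' (l y) = y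

theorem exists_isInv (a : X.Arr) : ∃ b, IsInv a b := by
  obtain ⟨i, j, l, x, h, rfl⟩ := exists_germ a
  obtain ⟨l', h', -, hl⟩ := l.exists_inv h
  refine ⟨germ l' (l.apply x h) h', i, j, l, l', x, h, h', rfl, rfl, ?_⟩
  filter_upwards [l.eventually_mem h,
    (l.continuousAt h).tendsto.eventually (l'.eventually_mem h')] with y hy hy'
  exact hl y hy hy'

/-- The inverse of a germ. -/
def inv (a : X.Arr) : X.Arr := (exists_isInv a).choose

theorem src_mul (a b : X.Arr) (e : tgt a = src b) : src (mul a b e) = src a := by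
  obtain ⟨i, j, k, l, m, n, x, hl, hm, hn, rfl, rfl, h, -⟩ := (exists_isMul a b e).choose_spec
  rw [mul, h]; rfl

theorem tgt_mul (a b : X.Arr) (e : tgt a = src b) : tgt (mul a b e) = tgt b := by
  obtain ⟨i, j, k, l, m, n, x, hl, hm, hn, rfl, rfl, h, e'⟩ := (exists_isMul a b e).choose_spec
  rw [mul, h, tgt_germ, tgt_germ]
  congr 1
  exact Subtype.ext e'.eq_of_nhds

@[simp] theorem src_one (o : X.Obj) : src (one o) = o := rfl

@[simp] theorem tgt_one (o : X.Obj) : tgt (one o) = o := by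
  rw [one, tgt_germ]
  congr 1
  exact Subtype.ext (ChangeOfCharts.refl_apply _ o.2.2)

theorem one_mul' (a : X.Arr) (o : X.Obj) (e : tgt (one o) = src a) : mul (one o) a e = a := by
  obtain ⟨i, j, l, x, h, rfl⟩ := exists_germ a
  have e' := e
  rw [tgt_one, src_germ] at e'
  subst e'
  refine mul_germ _ _ _ (ChangeOfCharts.refl_apply _ x.2).symm _ ?_
  filter_upwards [ChangeOfCharts.refl_eventuallyEq (X.chart i) x.2] with y hy
  rw [Function.comp_apply, hy, id]

theorem mul_one' (a : X.Arr) (o : X.Obj) (e : tgt a = src (one o)) : mul a (one o) e = a := by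
  obtain ⟨i, j, l, x, h, rfl⟩ := exists_germ a
  have e' := e
  rw [tgt_germ, src_one] at e'
  subst e'
  refine mul_germ _ _ _ rfl _ ?_
  have := (l.continuousAt h).tendsto.eventually
    (ChangeOfCharts.refl_eventuallyEq (X.chart j) (l.apply x h).2)
  filter_upwards [this] with y hy
  rw [Function.comp_apply, hy, id]

theorem mul_assoc' (a b c : X.Arr) (e : tgt a = src b) (e' : tgt b = src c) :
    mul (mul a b e) c ((tgt_mul a b e).trans e') =
      mul a (mul b c e') (e.trans (src_mul b c e').symm) := by
  obtain ⟨i, j, k, l, m, x, hl, hm, rfl, rfl⟩ := exists_pair a b e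
  obtain ⟨k', p, q, z, hq, rfl⟩ := exists_germ c
  have e'' := e'
  rw [tgt_germ, src_germ] at e''
  cases e''
  obtain ⟨lm, hlm, -, elm⟩ := l.exists_comp m hl hm univ_mem
  obtain ⟨mq, hmq, -, emq⟩ := m.exists_comp q hm hq univ_mem
  obtain ⟨lmq, hlmq, -, elmq⟩ := l.exists_comp mq hl hmq univ_mem
  have h1 : mul _ _ e = germ lm x hlm := mul_germ hl hm hlm rfl e
    (mem_of_superset (lm.eventually_mem hlm) fun y hy => (elm y hy).2.2)
  have h2 : mul _ _ e' = germ mq (l.apply x hl) hmq := mul_germ hm hq hmq rfl e'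
    (mem_of_superset (mq.eventually_mem hmq) fun y hy => (emq y hy).2.2)
  simp only [h1, h2]
  rw [mul_germ hlm hq hlmq, mul_germ hl hmq hlmq]
  · rfl
  · exact mem_of_superset (lmq.eventually_mem hlmq) fun y hy => (elmq y hy).2.2
  · exact (elm x hlm).2.2.symm
  · filter_upwards [lmq.eventually_mem hlmq, lm.eventually_mem hlm] with y hy hy'
    rw [(elmq y hy).2.2, (emq _ (elmq y hy).2.1).2.2, Function.comp_apply, (elm y hy').2.2]

end RedAtl

/-! ### Proper, effective, étale groupoids -/

/-- The data of a groupoid internal to smooth manifolds modelled on `ℝⁿ`, without the axioms.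
The product `mul a b` is the arrow "first `a`, then `b`". -/
structure GroupoidData where
  dim : ℕ
  Obj : Type u
  Arr : Type u
  [topologicalSpaceObj : TopologicalSpace Obj]
  [chartedSpaceObj : ChartedSpace (Euc dim) Obj]
  [topologicalSpaceArr : TopologicalSpace Arr]
  [chartedSpaceArr : ChartedSpace (Euc dim) Arr]
  s : Arr → Obj
  t : Arr → Obj
  e : Obj → Arr
  inv : Arr → Arr
  mul : ∀ a b : Arr, t a = s b → Arr

attribute [instance] GroupoidData.topologicalSpaceObj GroupoidData.chartedSpaceObj
  GroupoidData.topologicalSpaceArr GroupoidData.chartedSpaceArr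

namespace GroupoidData

/-- The model with corners of the manifolds of objects and arrows. -/
abbrev 𝓜 (G : GroupoidData.{u}) : ModelWithCorners ℝ (Euc G.dim) (Euc G.dim) := 𝓘(ℝ, Euc G.dim)

/-- The axioms of an étale groupoid. The fibre product of arrows is an embedded submanifold of
`Arr × Arr`, so the multiplication is smooth iff locally it is the restriction of a smooth map
defined on an open subset of `Arr × Arr`. -/
structure IsEtaleGroupoid (G : GroupoidData.{u}) : Prop where
  isManifold_obj : IsManifold G.𝓜 ∞ G.Obj
  t2_obj : T2Space G.Obj
  paracompact_obj : ParacompactSpace G.Obj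
  isManifold_arr : IsManifold G.𝓜 ∞ G.Arr
  t2_arr : T2Space G.Arr
  paracompact_arr : ParacompactSpace G.Arr
  etale_s : IsLocalDiffeomorph G.𝓜 G.𝓜 ∞ G.s
  etale_t : IsLocalDiffeomorph G.𝓜 G.𝓜 ∞ G.t
  smooth_e : ContMDiff G.𝓜 G.𝓜 ∞ G.e
  smooth_inv : ContMDiff G.𝓜 G.𝓜 ∞ G.inv
  smooth_mul : ∀ (a b : G.Arr), G.t a = G.s b →
    ∃ (U : Set (G.Arr × G.Arr)) (F : G.Arr × G.Arr → G.Arr), IsOpen U ∧ (a, b) ∈ U ∧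
      ContMDiffOn (G.𝓜.prod G.𝓜) G.𝓜 ∞ F U ∧
      ∀ (a' b' : G.Arr) (h : G.t a' = G.s b'), (a', b') ∈ U → F (a', b') = G.mul a' b' h
  s_e : ∀ x, G.s (G.e x) = x
  t_e : ∀ x, G.t (G.e x) = x
  s_mul : ∀ a b h, G.s (G.mul a b h) = G.s a
  t_mul : ∀ a b h, G.t (G.mul a b h) = G.t b
  mul_assoc : ∀ (a b c : G.Arr) (h : G.t a = G.s b) (h' : G.t b = G.s c),
    G.mul (G.mul a b h) c ((t_mul a b h).trans h') =
      G.mul a (G.mul b c h') (h.trans (s_mul b c h').symm)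
  e_mul : ∀ a, G.mul (G.e (G.s a)) a (t_e (G.s a)) = a
  mul_e : ∀ a, G.mul a (G.e (G.t a)) (s_e (G.t a)).symm = a
  inv_inv : ∀ a, G.inv (G.inv a) = a
  s_inv : ∀ a, G.s (G.inv a) = G.t a
  t_inv : ∀ a, G.t (G.inv a) = G.s a
  mul_inv : ∀ a, G.mul a (G.inv a) (s_inv a).symm = G.e (G.s a)
  inv_mul : ∀ a, G.mul (G.inv a) a (t_inv a) = G.e (G.t a)

/-- A groupoid is proper if `(s, t)` is a proper map. -/
def IsProper (G : GroupoidData.{u}) : Prop := IsProperMap fun a : G.Arr => (G.s a, G.t a)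

/-- `κ(a)` is the germ at `s a` of the map `f`: as a germ at `a` we have `t = f ∘ s`, that is
`germ f = germ t · (germ s)⁻¹`. -/
def IsKappa (G : GroupoidData.{u}) (a : G.Arr) (f : G.Obj → G.Obj) : Prop :=
  G.t =ᶠ[𝓝 a] f ∘ G.s

/-- An (étale) groupoid is effective if for each `x` the map `κ` is injective on the set of arrows
from `x` to `x`. -/
def IsEffective (G : GroupoidData.{u}) : Prop :=
  ∀ (x : G.Obj) (a b : G.Arr) (f : G.Obj → G.Obj), G.s a = x → G.t a = x → G.s b = x → G.t b = x →
    G.IsKappa a f → G.IsKappa b f → a = b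

/-- The conditions on a morphism of étale groupoids. -/
structure IsHom (G H : GroupoidData.{u}) (φ₀ : G.Obj → H.Obj) (φ₁ : G.Arr → H.Arr) : Prop where
  smooth_obj : ContMDiff G.𝓜 H.𝓜 ∞ φ₀
  smooth_arr : ContMDiff G.𝓜 H.𝓜 ∞ φ₁
  s_map : ∀ a, H.s (φ₁ a) = φ₀ (G.s a)
  t_map : ∀ a, H.t (φ₁ a) = φ₀ (G.t a)
  map_e : ∀ x, φ₁ (G.e x) = H.e (φ₀ x)
  map_mul : ∀ (a b : G.Arr) (h : G.t a = G.s b), φ₁ (G.mul a b h) =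
    H.mul (φ₁ a) (φ₁ b) ((t_map a).trans ((congrArg φ₀ h).trans (s_map b).symm))
  map_inv : ∀ a, φ₁ (G.inv a) = H.inv (φ₁ a)

/-- A morphism of étale groupoids. -/
@[ext]
structure Hom (G H : GroupoidData.{u}) where
  obj : G.Obj → H.Obj
  arr : G.Arr → H.Arr
  isHom : IsHom G H obj arr

/-- The conditions on a natural transformation between morphisms of étale groupoids. -/
structure IsNatTrans {G H : GroupoidData.{u}} (φ ψ : Hom G H) (α : G.Obj → H.Arr) : Prop where
  smooth : ContMDiff G.𝓜 H.𝓜 ∞ α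
  s_app : ∀ x, H.s (α x) = φ.obj x
  t_app : ∀ x, H.t (α x) = ψ.obj x
  naturality : ∀ a : G.Arr,
    H.mul (α (G.s a)) (ψ.arr a) ((t_app _).trans (ψ.isHom.s_map a).symm) =
      H.mul (φ.arr a) (α (G.t a)) ((φ.isHom.t_map a).trans (s_app _).symm)

/-- A natural transformation between morphisms of étale groupoids. -/
@[ext]
structure GTrans {G H : GroupoidData.{u}} (φ ψ : Hom G H) where
  app : G.Obj → H.Arr
  isNatTrans : IsNatTrans φ ψ app

/-- The identity morphism. -/
def Hom.id (G : GroupoidData.{u}) : Hom G G where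
  obj x := x
  arr a := a
  isHom := ⟨contMDiff_id, contMDiff_id, fun _ => rfl, fun _ => rfl, fun _ => rfl,
    fun _ _ _ => rfl, fun _ => rfl⟩

/-- The composition `ψ ∘ φ` of morphisms. -/
def Hom.comp {G H K : GroupoidData.{u}} (φ : Hom G H) (ψ : Hom H K) : Hom G K where
  obj x := ψ.obj (φ.obj x)
  arr a := ψ.arr (φ.arr a)
  isHom :=
    { smooth_obj := ψ.isHom.smooth_obj.comp φ.isHom.smooth_obj
      smooth_arr := ψ.isHom.smooth_arr.comp φ.isHom.smooth_arr
      s_map := fun a => by rw [ψ.isHom.s_map, φ.isHom.s_map]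
      t_map := fun a => by rw [ψ.isHom.t_map, φ.isHom.t_map]
      map_e := fun x => by rw [φ.isHom.map_e, ψ.isHom.map_e]
      map_mul := fun a b h => by simp only [φ.isHom.map_mul, ψ.isHom.map_mul]
      map_inv := fun a => by rw [φ.isHom.map_inv, ψ.isHom.map_inv] }

theorem IsEtaleGroupoid.contMDiff_mul {G H : GroupoidData.{u}} (hH : H.IsEtaleGroupoid)
    {α β : G.Obj → H.Arr} (hα : ContMDiff G.𝓜 H.𝓜 ∞ α) (hβ : ContMDiff G.𝓜 H.𝓜 ∞ β)
    (h : ∀ x, H.t (α x) = H.s (β x)) :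
    ContMDiff G.𝓜 H.𝓜 ∞ fun x => H.mul (α x) (β x) (h x) := by
  intro x
  obtain ⟨U, F, hU, hx, hF, he⟩ := hH.smooth_mul _ _ (h x)
  have h1 : ContMDiffAt (H.𝓜.prod H.𝓜) H.𝓜 ∞ F (α x, β x) := hF.contMDiffAt (hU.mem_nhds hx)
  have h2 : ContMDiffAt G.𝓜 (H.𝓜.prod H.𝓜) ∞ (fun x => (α x, β x)) x := (hα x).prodMk (hβ x)
  refine (ContMDiffAt.comp x h1 h2).congr_of_eventuallyEq ?_
  filter_upwards [h2.continuousAt.preimage_mem_nhds (hU.mem_nhds hx)] with y hy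
  exact (he _ _ (h y) hy).symm

section

variable {G H K : GroupoidData.{u}}

/-- The identity natural transformation. -/
def GTrans.id (hH : H.IsEtaleGroupoid) (φ : Hom G H) : GTrans φ φ where
  app x := H.e (φ.obj x)
  isNatTrans :=
    { smooth := hH.smooth_e.comp φ.isHom.smooth_obj
      s_app := fun x => hH.s_e _
      t_app := fun x => hH.t_e _
      naturality := fun a => by
        have h1 := hH.e_mul (φ.arr a)
        have h2 := hH.mul_e (φ.arr a)
        simp only [← φ.isHom.s_map, ← φ.isHom.t_map]
        rw [h1, h2] }

/-- The vertical composition `β ⊙ α`. -/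
def GTrans.vcomp (hH : H.IsEtaleGroupoid) {φ ψ χ : Hom G H} (α : GTrans φ ψ)
    (β : GTrans ψ χ) : GTrans φ χ where
  app x := H.mul (α.app x) (β.app x) ((α.isNatTrans.t_app x).trans (β.isNatTrans.s_app x).symm)
  isNatTrans :=
    { smooth := hH.contMDiff_mul α.isNatTrans.smooth β.isNatTrans.smooth _
      s_app := fun x => by rw [hH.s_mul, α.isNatTrans.s_app]
      t_app := fun x => by rw [hH.t_mul, β.isNatTrans.t_app]
      naturality := fun a => by
        rw [hH.mul_assoc]
        · simp only [β.isNatTrans.naturality]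
          rw [← hH.mul_assoc]
          · simp only [α.isNatTrans.naturality]
            rw [hH.mul_assoc]
          · rw [α.isNatTrans.t_app, ψ.isHom.s_map]
        · rw [β.isNatTrans.t_app, χ.isHom.s_map] }

theorem GTrans.hcomp_isNatTrans (hK : K.IsEtaleGroupoid) {φ φ' : Hom G H} {ψ ψ' : Hom H K}
    (α : GTrans φ φ') (β : GTrans ψ ψ')
    (h : ∀ x, K.t (ψ.arr (α.app x)) = K.s (β.app (φ'.obj x))) :
    IsNatTrans (φ.comp ψ) (φ'.comp ψ')
      fun x => K.mul (ψ.arr (α.app x)) (β.app (φ'.obj x)) (h x) where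
  smooth := hK.contMDiff_mul (ψ.isHom.smooth_arr.comp α.isNatTrans.smooth)
    (β.isNatTrans.smooth.comp φ'.isHom.smooth_obj) _
  s_app x := by rw [hK.s_mul, ψ.isHom.s_map, α.isNatTrans.s_app]; rfl
  t_app x := by rw [hK.t_mul, β.isNatTrans.t_app]; rfl
  naturality a := by
    have h1 := β.isNatTrans.naturality (φ'.arr a)
    have h2 := congrArg ψ.arr (α.isNatTrans.naturality a)
    simp only [ψ.isHom.map_mul] at h2
    simp only [φ'.isHom.s_map, φ'.isHom.t_map] at h1
    simp only [Hom.comp]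
    rw [hK.mul_assoc]
    · simp only [h1]
      rw [← hK.mul_assoc]
      · simp only [h2]
        rw [hK.mul_assoc]
      · rw [ψ.isHom.t_map, ψ.isHom.s_map, α.isNatTrans.t_app, φ'.isHom.s_map]
    · rw [β.isNatTrans.t_app, ψ'.isHom.s_map, φ'.isHom.s_map]

/-- The horizontal composition `β ∗ α`. -/
def GTrans.hcomp (hK : K.IsEtaleGroupoid) {φ φ' : Hom G H} {ψ ψ' : Hom H K}
    (α : GTrans φ φ') (β : GTrans ψ ψ') : GTrans (φ.comp ψ) (φ'.comp ψ') where
  app x := K.mul (ψ.arr (α.app x)) (β.app (φ'.obj x)) ((ψ.isHom.t_map _).trans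
    ((congrArg ψ.obj (α.isNatTrans.t_app x)).trans (β.isNatTrans.s_app _).symm))
  isNatTrans := GTrans.hcomp_isNatTrans hK α β _

end

end GroupoidData

/-- Proper, effective, étale groupoids. -/
structure PEEGpd extends GroupoidData.{u} where
  isEtale : toGroupoidData.IsEtaleGroupoid
  isProper : toGroupoidData.IsProper
  isEffective : toGroupoidData.IsEffective

namespace PEEGpd

open GroupoidData

instance : CategoryStruct PEEGpd.{u} where
  Hom G H := Hom G.toGroupoidData H.toGroupoidData
  id G := Hom.id G.toGroupoidData
  comp φ ψ := Hom.comp φ ψ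

instance homCategory (G H : PEEGpd.{u}) : Category (G ⟶ H) where
  Hom φ ψ := GTrans φ ψ
  id φ := GTrans.id H.isEtale φ
  comp α β := GTrans.vcomp H.isEtale α β
  id_comp α := by
    refine GTrans.ext (funext fun x => ?_)
    have h := H.isEtale.e_mul (GTrans.app α x)
    simp only [α.isNatTrans.s_app] at h
    exact h
  comp_id α := by
    refine GTrans.ext (funext fun x => ?_)
    have h := H.isEtale.mul_e (GTrans.app α x)
    simp only [α.isNatTrans.t_app] at h
    exact h
  assoc α β γ := GTrans.ext (funext fun x => H.isEtale.mul_assoc _ _ _ _ _)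

theorem id_whisker {G H K : PEEGpd.{u}} (φ : G ⟶ H) {ψ χ : H ⟶ K} (β : ψ ⟶ χ) (x : G.Obj) :
    (GTrans.hcomp K.isEtale (𝟙 φ : φ ⟶ φ) β).app x = GTrans.app β (φ.obj x) := by
  have h := K.isEtale.e_mul (GTrans.app β (φ.obj x))
  have h1 : ψ.arr (H.e (φ.obj x)) = K.e (K.s (GTrans.app β (φ.obj x))) := by
    rw [ψ.isHom.map_e, β.isNatTrans.s_app]
  refine Eq.trans ?_ h
  change K.mul (ψ.arr (H.e (φ.obj x))) (GTrans.app β (φ.obj x)) _ = _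
  simp only [h1]

theorem whisker_id {G H K : PEEGpd.{u}} {φ ψ : G ⟶ H} (α : φ ⟶ ψ) (χ : H ⟶ K) (x : G.Obj) :
    (GTrans.hcomp K.isEtale α (𝟙 χ : χ ⟶ χ)).app x = χ.arr (GTrans.app α x) := by
  have h := K.isEtale.mul_e (χ.arr (GTrans.app α x))
  have h1 : K.e (χ.obj (ψ.obj x)) = K.e (K.t (χ.arr (GTrans.app α x))) := by
    rw [χ.isHom.t_map, α.isNatTrans.t_app]
  refine Eq.trans ?_ h
  change K.mul (χ.arr (GTrans.app α x)) (K.e (χ.obj (ψ.obj x))) _ = _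
  simp only [h1]

@[simp] theorem id_app {G H : PEEGpd.{u}} (φ : G ⟶ H) (x : G.Obj) :
    GTrans.app (𝟙 φ) x = H.e (φ.obj x) := rfl

theorem comp_app {G H : PEEGpd.{u}} {φ ψ χ : G ⟶ H} (α : φ ⟶ ψ) (β : ψ ⟶ χ) (x : G.Obj) :
    GTrans.app (α ≫ β) x = H.mul (GTrans.app α x) (GTrans.app β x)
      ((α.isNatTrans.t_app x).trans (β.isNatTrans.s_app x).symm) := rfl

theorem refl_conj {G H : PEEGpd.{u}} {φ ψ : G ⟶ H} (α : φ ⟶ ψ) : 𝟙 φ ≫ α ≫ 𝟙 ψ = α := by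
  rw [Category.id_comp, Category.comp_id]

theorem hcomp_id_id {G H K : PEEGpd.{u}} (φ : G ⟶ H) (ψ : H ⟶ K) :
    GTrans.hcomp K.isEtale (𝟙 φ : φ ⟶ φ) (𝟙 ψ : ψ ⟶ ψ) = 𝟙 (φ ≫ ψ) :=
  GTrans.ext (funext fun x => (whisker_id _ ψ x).trans (ψ.isHom.map_e _))

/-- The 2-category of proper, effective, étale groupoids. Whiskering is horizontal composition with
an identity 2-morphism. -/
instance : Bicategory PEEGpd.{u} where
  homCategory := homCategory
  whiskerLeft {_ _ K} φ {_ _} β := GTrans.hcomp K.isEtale (𝟙 φ : φ ⟶ φ) β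
  whiskerRight {_ _ K} {_ _} α χ := GTrans.hcomp K.isEtale α (𝟙 χ : χ ⟶ χ)
  associator φ ψ χ := Iso.refl (φ ≫ ψ ≫ χ)
  leftUnitor φ := Iso.refl φ
  rightUnitor φ := Iso.refl φ
  whiskerLeft_id {_ _ K} φ ψ := GTrans.ext (funext fun x => by
    rw [id_whisker]; rfl)
  whiskerLeft_comp {_ _ K} φ {_ _ _} η θ := GTrans.ext (funext fun x => by
    rw [id_whisker, comp_app, comp_app]; simp only [id_whisker])
  id_whiskerLeft η := Eq.trans (GTrans.ext (funext fun x => id_whisker _ η x))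
    (refl_conj η).symm
  comp_whiskerLeft {_ _ _ K} φ ψ {χ χ'} η := Eq.trans
    (b := (show φ ≫ ψ ≫ χ ⟶ φ ≫ ψ ≫ χ' from GTrans.hcomp K.isEtale (𝟙 φ : φ ⟶ φ)
      (show ψ ≫ χ ⟶ ψ ≫ χ' from GTrans.hcomp K.isEtale (𝟙 ψ : ψ ⟶ ψ) η)))
    (GTrans.ext (funext fun x => by
      refine (id_whisker (φ ≫ ψ) η x).trans ?_
      refine Eq.trans ?_ (id_whisker φ _ x).symm
      exact (id_whisker ψ η _).symm))
    (refl_conj _).symm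
  id_whiskerRight {_ _ K} φ ψ := GTrans.ext (funext fun x =>
    (whisker_id _ ψ x).trans (ψ.isHom.map_e _))
  comp_whiskerRight {_ _ K} {_ _ _} η θ χ := GTrans.ext (funext fun x => by
    rw [whisker_id, comp_app, comp_app]; simp only [whisker_id]; exact χ.isHom.map_mul _ _ _)
  whiskerRight_id η := Eq.trans (GTrans.ext (funext fun x => whisker_id η _ x))
    (refl_conj η).symm
  whiskerRight_comp {_ _ _ K} {φ φ'} η ψ χ := Eq.trans
    (b := (show (φ ≫ ψ) ≫ χ ⟶ (φ' ≫ ψ) ≫ χ from GTrans.hcomp K.isEtale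
      (show φ ≫ ψ ⟶ φ' ≫ ψ from GTrans.hcomp _ η (𝟙 ψ : ψ ⟶ ψ)) (𝟙 χ : χ ⟶ χ)))
    (GTrans.ext (funext fun x => by
      refine (whisker_id η (ψ ≫ χ) x).trans ?_
      refine Eq.trans ?_ (whisker_id _ χ x).symm
      exact congrArg χ.arr (whisker_id η ψ _).symm))
    (refl_conj _).symm
  whisker_assoc {_ _ H K} φ {ψ ψ'} η χ := Eq.trans
    (b := (show φ ≫ ψ ≫ χ ⟶ φ ≫ ψ' ≫ χ from GTrans.hcomp K.isEtale (𝟙 φ : φ ⟶ φ)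
      (show ψ ≫ χ ⟶ ψ' ≫ χ from GTrans.hcomp K.isEtale η (𝟙 χ : χ ⟶ χ))))
    (GTrans.ext (funext fun x => by
      refine (whisker_id _ χ x).trans ?_
      refine Eq.trans ?_ (id_whisker φ _ x).symm
      refine Eq.trans ?_ (whisker_id η χ _).symm
      exact congrArg χ.arr (id_whisker φ η x)))
    (refl_conj _).symm
  whisker_exchange {_ _ K} {φ ψ χ χ'} η θ := GTrans.ext (funext fun x => by
    rw [comp_app, comp_app]
    simp only [whisker_id, id_whisker]
    have h := θ.isNatTrans.naturality (GTrans.app η x)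
    simp only [η.isNatTrans.s_app, η.isNatTrans.t_app] at h
    exact h)
  pentagon {_ _ _ _ K} φ ψ χ θ := by
    exact (congrArg₂ (fun a b : φ ≫ ψ ≫ χ ≫ θ ⟶ φ ≫ ψ ≫ χ ≫ θ => a ≫ 𝟙 _ ≫ b)
      (hcomp_id_id (φ ≫ ψ ≫ χ) θ) (hcomp_id_id φ (ψ ≫ χ ≫ θ))).trans (Category.id_comp _)
  triangle {_ _ K} φ ψ := by
    change 𝟙 (φ ≫ ψ) ≫ (GTrans.hcomp K.isEtale (𝟙 φ : φ ⟶ φ) (𝟙 ψ : ψ ⟶ ψ) :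
        φ ≫ ψ ⟶ φ ≫ ψ) = GTrans.hcomp K.isEtale (𝟙 φ : φ ⟶ φ) (𝟙 ψ : ψ ⟶ ψ)
    exact Category.id_comp _

instance : Bicategory.Strict PEEGpd.{u} where
  id_comp _ := rfl
  comp_id _ := rfl
  assoc _ _ _ := rfl
  leftUnitor_eqToIso _ := rfl
  rightUnitor_eqToIso _ := rfl
  associator_eqToIso _ _ _ := rfl

end PEEGpd

/-! ### The groupoid of germs of changes of charts -/

namespace RedAtl

variable (X : RedAtl.{u})

open Classical in
/-- The chart of the disjoint union of the `X̃ᵢ` given by the inclusion of `X̃ᵢ` in `ℝⁿ`. -/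
def objChart (i : X.Idx) : OpenPartialHomeomorph X.Obj (Euc X.dim) where
  toFun o := o.2
  invFun y := if h : y ∈ X.sp i then ⟨i, y, h⟩ else
    ⟨i, _, (X.chart i).isConnected_space.nonempty.some_mem⟩
  source := range (Sigma.mk i)
  target := X.sp i
  map_source' := by rintro _ ⟨x, rfl⟩; exact x.2
  map_target' y h := by
    have h' : y ∈ X.sp i := h
    simp [h']
  left_inv' := by rintro _ ⟨x, rfl⟩; exact dif_pos x.2
  right_inv' y h := by
    have h' : y ∈ X.sp i := h
    rw [dif_pos h']
  open_source := isOpen_range_sigmaMk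
  open_target := (X.sp i).2
  continuousOn_toFun :=
    (continuous_sigma fun _ => continuous_subtype_val).continuousOn
  continuousOn_invFun := by
    rw [continuousOn_iff_continuous_domRestrict]
    have : Continuous (fun y : X.sp i => (⟨i, y⟩ : X.Obj)) :=
      continuous_sigmaMk (σ := fun i => X.sp i)
    exact this.congr fun y => by simp

/-- The smooth structure on the disjoint union of the `X̃ᵢ`. -/
instance chartedSpaceObj : ChartedSpace (Euc X.dim) X.Obj where
  atlas := range X.objChart
  chartAt o := X.objChart o.1
  mem_chart_source o := ⟨o.2, rfl⟩
  chart_mem_atlas o := ⟨o.1, rfl⟩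

variable {X}

/-- The set of germs of `l` at the points of its domain. -/
def germs {i j : X.Idx} (l : X.Ch i j) : Set X.Arr := {a | ∃ x h, a = germ l x h}

theorem dom_nonempty {i j : X.Idx} (l : X.Ch i j) : ∃ x, x ∈ l.dom := by
  obtain ⟨Y, -, -, -, x, hx, h⟩ := l.isComponent
  exact ⟨x, by rw [← SetLike.mem_coe, h]; exact mem_connectedComponentIn hx⟩

open Classical in
/-- The chart `germ_x l ↦ x` of the space of germs, defined on the germs of `l`. -/
def germChart {i j : X.Idx} (l : X.Ch i j) : PartialEquiv X.Arr (Euc X.dim) where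
  toFun a := (src a).2
  invFun y := if h : y ∈ l.dom then germ l ⟨y, l.dom_le h⟩ h else
    germ l ⟨_, l.dom_le (dom_nonempty l).choose_spec⟩ (dom_nonempty l).choose_spec
  source := germs l
  target := l.dom
  map_source' := by rintro _ ⟨x, h, rfl⟩; exact h
  map_target' y h := by
    have h' : y ∈ l.dom := h
    rw [dif_pos h']
    exact ⟨_, _, rfl⟩
  left_inv' := by
    rintro _ ⟨x, h, rfl⟩
    exact dif_pos h
  right_inv' y h := by
    have h' : y ∈ l.dom := h
    rw [dif_pos h']
    rfl

theorem germChart_symm_apply {i j : X.Idx} (l : X.Ch i j) {y : Euc X.dim} (h : y ∈ l.dom) :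
    (germChart l).symm y = germ l ⟨y, l.dom_le h⟩ h := dif_pos h

theorem isOpen_germChart_trans {i j i' j' : X.Idx} (l : X.Ch i j) (l' : X.Ch i' j') :
    IsOpen ((germChart l).symm.trans (germChart l')).source := by
  rw [isOpen_iff_mem_nhds]
  intro y hy
  obtain ⟨h, x, h', e⟩ : ∃ (h : y ∈ l.dom) (x : X.sp i') (h' : (x : Euc X.dim) ∈ l'.dom),
      germ l ⟨y, l.dom_le h⟩ h = germ l' x h' := by
    rw [PartialEquiv.trans_source] at hy
    have h : y ∈ l.dom := hy.1
    have h2 : (germChart l).symm y ∈ germs l' := hy.2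
    rw [germChart_symm_apply l h] at h2
    exact ⟨h, h2⟩
  have e' : X.SameGerm _ _ := Quotient.exact e
  cases e' with
  | mk _ l' _ _ h' e' =>
    filter_upwards [l.eventually_mem h, l'.eventually_mem h', e'.eventuallyEq_nhds] with z hz hz' ez
    rw [PartialEquiv.trans_source]
    refine ⟨hz, ?_⟩
    change (germChart l).symm z ∈ germs l'
    rw [germChart_symm_apply l hz]
    exact ⟨⟨z, _⟩, hz', germ_eq_iff.2 ez⟩

theorem germChart_trans_apply {i j : X.Idx} (l : X.Ch i j) (e : PartialEquiv X.Arr (Euc X.dim))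
    (he : ∀ a, e a = (src a).2) {y : Euc X.dim} (h : y ∈ ((germChart l).symm.trans e).source) :
    ((germChart l).symm.trans e) y = y := by
  rw [PartialEquiv.trans_source] at h
  have h' : y ∈ l.dom := h.1
  rw [PartialEquiv.coe_trans, Function.comp_apply, he, germChart_symm_apply l h']
  rfl

variable (X)

/-- The charts `germChart l` generate the topology and the smooth structure of the space of
germs. -/
def arrCore : ChartedSpaceCore (Euc X.dim) X.Arr where
  atlas := {e | ∃ (i j : X.Idx) (l : X.Ch i j), e = germChart l}
  chartAt a := germChart a.out.l
  mem_chart_source a := ⟨a.out.x, a.out.mem, (Quotient.out_eq a).symm⟩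
  chart_mem_atlas a := ⟨_, _, a.out.l, rfl⟩
  open_source := by
    rintro _ _ ⟨i, j, l, rfl⟩ ⟨i', j', l', rfl⟩
    exact isOpen_germChart_trans l l'
  continuousOn_toFun := by
    rintro _ _ ⟨i, j, l, rfl⟩ ⟨i', j', l', rfl⟩
    exact continuousOn_id.congr fun y hy => germChart_trans_apply l _ (fun _ => rfl) hy

instance topologicalSpaceArr : TopologicalSpace X.Arr := X.arrCore.toTopologicalSpace

instance chartedSpaceArr : ChartedSpace (Euc X.dim) X.Arr := X.arrCore.toChartedSpace

/-- The groupoid of germs of changes of charts of an atlas. -/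
def germGroupoid : GroupoidData.{u} where
  dim := X.dim
  Obj := X.Obj
  Arr := X.Arr
  s := src
  t := tgt
  e := one
  inv := inv
  mul := mul

end RedAtl

/-! ### Morphisms of atlases -/

/-- The data `(f, f̄, {f̃ᵢ})` of a morphism of atlases: a continuous map `f`, a map `f̄` between the
index sets, and local lifts `f̃ᵢ` of `f`. -/
structure PreMor (X Y : RedAtl.{u}) where
  base : C(X.carrier, Y.carrier)
  idx : X.Idx → Y.Idx
  image_subset : ∀ i, base '' range (X.chart i).proj ⊆ range (Y.chart (idx i)).proj
  lift : ∀ i, X.sp i → Y.sp (idx i)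
  smooth_lift : ∀ i, ContMDiff 𝓘(ℝ, Euc X.dim) 𝓘(ℝ, Euc Y.dim) ∞ (lift i)
  proj_lift : ∀ i (x : X.sp i), (Y.chart (idx i)).proj (lift i x) = base ((X.chart i).proj x)

variable {X Y Z W : RedAtl.{u}}

/-- A family `P(i, j)` of sets of changes of charts is good if every germ of a change of charts is
the germ of a member of `P`. -/
def IsGood (X : RedAtl.{u}) (P : ∀ i j, Set (X.Ch i j)) : Prop :=
  ∀ (i j : X.Idx) (l : X.Ch i j) (x : Euc X.dim), x ∈ l.dom →
    ∃ l' ∈ P i j, x ∈ l'.dom ∧ l =ᶠ[𝓝 x] l'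

/-- A pair `(P, ν)` completing `(f, f̄, {f̃ᵢ})` to a representative of a morphism of atlases. -/
structure PreMor.Rep (p : PreMor X Y) where
  P : ∀ i j, Set (X.Ch i j)
  good : IsGood X P
  ν : ∀ {i j : X.Idx}, P i j → Y.Ch (p.idx i) (p.idx j)
  lift_mem_dom : ∀ {i j : X.Idx} (l : P i j) (x : X.sp i), (x : Euc X.dim) ∈ l.1.dom →
    (p.lift i x : Euc Y.dim) ∈ (ν l).dom
  lift_mem_cod : ∀ {i j : X.Idx} (l : P i j) (x : X.sp j), (x : Euc X.dim) ∈ l.1.cod →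
    (p.lift j x : Euc Y.dim) ∈ (ν l).cod
  lift_apply : ∀ {i j : X.Idx} (l : P i j) (x : X.sp i) (h : (x : Euc X.dim) ∈ l.1.dom),
    (p.lift j (l.1.apply x h) : Euc Y.dim) = ν l (p.lift i x)
  germ_congr : ∀ {i j : X.Idx} (l l' : P i j) (x : X.sp i), (x : Euc X.dim) ∈ l.1.dom →
    (x : Euc X.dim) ∈ l'.1.dom → l.1 =ᶠ[𝓝 (x : Euc X.dim)] l'.1 →
    ν l =ᶠ[𝓝 (p.lift i x : Euc Y.dim)] ν l'
  germ_comp : ∀ {i j k : X.Idx} (l₁ : P i j) (l₂ : P j k) (l₃ : P i k) (x : X.sp i),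
    (x : Euc X.dim) ∈ l₁.1.dom → l₁.1 x ∈ l₂.1.dom → (x : Euc X.dim) ∈ l₃.1.dom →
    l₃.1 =ᶠ[𝓝 (x : Euc X.dim)] l₂.1 ∘ l₁.1 →
    ν l₂ ∘ ν l₁ =ᶠ[𝓝 (p.lift i x : Euc Y.dim)] ν l₃
  germ_id : ∀ {i : X.Idx} (l : P i i) (x : X.sp i), (x : Euc X.dim) ∈ l.1.dom →
    l.1 =ᶠ[𝓝 (x : Euc X.dim)] ChangeOfCharts.refl (X.chart i) →
    ν l =ᶠ[𝓝 (p.lift i x : Euc Y.dim)] ChangeOfCharts.refl (Y.chart (p.idx i))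

namespace PreMor

/-- The map `∐ X̃ᵢ → ∐ Ỹⱼ` given by the local lifts. -/
def objMap (p : PreMor X Y) (o : X.Obj) : Y.Obj := ⟨p.idx o.1, p.lift o.1 o.2⟩

namespace Rep

open RedAtl

variable {p : PreMor X Y}

/-- `b` is the germ of `ν(l)` at `f̃(x)`, where `a` is the germ at `x` of a member `l` of `P`. -/
def IsImage (r : p.Rep) (a : X.Arr) (b : Y.Arr) : Prop :=
  ∃ (i j : X.Idx) (l : r.P i j) (x : X.sp i) (h : (x : Euc X.dim) ∈ l.1.dom),
    a = germ l.1 x h ∧ b = germ (r.ν l) (p.lift i x) (r.lift_mem_dom l x h)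

theorem exists_mem (r : p.Rep) (a : X.Arr) : ∃ (i j : X.Idx) (l : r.P i j) (x : X.sp i)
    (h : (x : Euc X.dim) ∈ l.1.dom), a = germ l.1 x h := by
  obtain ⟨i, j, l, x, h, rfl⟩ := exists_germ a
  obtain ⟨l', hl', h', e⟩ := r.good i j l x h
  exact ⟨i, j, ⟨l', hl'⟩, x, h', germ_eq_iff.2 e⟩

theorem exists_isImage (r : p.Rep) (a : X.Arr) : ∃ b, r.IsImage a b := by
  obtain ⟨i, j, l, x, h, rfl⟩ := r.exists_mem a
  exact ⟨_, i, j, l, x, h, rfl, rfl⟩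

/-- The map between the spaces of germs induced by `(P, ν)`. -/
def arrMap (r : p.Rep) (a : X.Arr) : Y.Arr := (r.exists_isImage a).choose

theorem arrMap_germ (r : p.Rep) {i j : X.Idx} (l : r.P i j) (x : X.sp i)
    (h : (x : Euc X.dim) ∈ l.1.dom) :
    r.arrMap (germ l.1 x h) = germ (r.ν l) (p.lift i x) (r.lift_mem_dom l x h) := by
  obtain ⟨i', j', l', x', h', e, e'⟩ := (r.exists_isImage (germ l.1 x h)).choose_spec
  rw [arrMap, e']
  obtain ⟨l', hl'⟩ := l'
  obtain ⟨l, hl⟩ := l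
  have e'' : X.SameGerm _ _ := Quotient.exact e
  cases e'' with
  | mk _ _ _ _ _ e'' => exact germ_eq_iff.2 (r.germ_congr ⟨_, hl'⟩ ⟨l, hl⟩ x h' h e''.symm)

theorem src_arrMap (r : p.Rep) (a : X.Arr) : src (r.arrMap a) = p.objMap (src a) := by
  obtain ⟨i, j, l, x, h, rfl⟩ := r.exists_mem a
  rw [arrMap_germ]; rfl

theorem tgt_arrMap (r : p.Rep) (a : X.Arr) : tgt (r.arrMap a) = p.objMap (tgt a) := by
  obtain ⟨i, j, l, x, h, rfl⟩ := r.exists_mem a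
  rw [arrMap_germ, tgt_germ, tgt_germ, objMap]
  congr 1
  exact Subtype.ext (r.lift_apply l x h).symm

theorem arrMap_one (r : p.Rep) (o : X.Obj) : r.arrMap (one o) = one (p.objMap o) := by
  obtain ⟨i, x⟩ := o
  obtain ⟨l, hl, h, e⟩ := r.good i i (ChangeOfCharts.refl (X.chart i)) x
    (ChangeOfCharts.mem_refl_dom _ x)
  have : one (⟨i, x⟩ : X.Obj) = germ l x h := germ_eq_iff.2 e
  rw [this, r.arrMap_germ ⟨l, hl⟩]
  exact germ_eq_iff.2 (r.germ_id ⟨l, hl⟩ x h e.symm)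

theorem arrMap_mul (r : p.Rep) (a b : X.Arr) (h : tgt a = src b) :
    r.arrMap (mul a b h) = mul (r.arrMap a) (r.arrMap b)
      ((r.tgt_arrMap a).trans ((congrArg p.objMap h).trans (r.src_arrMap b).symm)) := by
  obtain ⟨i, j, k, l, m, x, hl, hm, rfl, rfl⟩ := exists_pair a b h
  obtain ⟨l', hl'P, hl', el⟩ := r.good _ _ l x hl
  obtain ⟨m', hm'P, hm', em⟩ := r.good _ _ m _ hm
  obtain ⟨n, hn, -, en⟩ := l.exists_comp m hl hm univ_mem
  obtain ⟨n', hn'P, hn', en'⟩ := r.good _ _ n x hn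
  have e1 : germ l x hl = germ l' x hl' := germ_eq_iff.2 el
  have e2 : germ m (l.apply x hl) hm = germ m' (l.apply x hl) hm' := germ_eq_iff.2 em
  have elm : n =ᶠ[𝓝 (x : Euc X.dim)] m ∘ l :=
    mem_of_superset (n.eventually_mem hn) fun y hy => (en y hy).2.2
  have e3 : mul _ _ h = germ n' x hn' := (mul_germ hl hm hn rfl h elm).trans (germ_eq_iff.2 en')
  have hx : l x = l' x := el.eq_of_nhds
  have hm'' : l' x ∈ m'.dom := hx ▸ hm'
  have ecomp : n' =ᶠ[𝓝 (x : Euc X.dim)] m' ∘ l' := by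
    refine en'.symm.trans (elm.trans ?_)
    refine EventuallyEq.trans (g := m' ∘ l) ?_ (el.fun_comp m')
    exact (l.continuousAt hl).tendsto.eventually em
  have i1 : r.arrMap (germ l x hl) = _ := (congrArg r.arrMap e1).trans
    (r.arrMap_germ ⟨l', hl'P⟩ x hl')
  have i2 : r.arrMap (germ m (l.apply x hl) hm) = _ := (congrArg r.arrMap e2).trans
    (r.arrMap_germ ⟨m', hm'P⟩ _ hm')
  simp only [i1, i2]
  rw [e3, r.arrMap_germ ⟨n', hn'P⟩ x hn']
  refine (mul_germ _ _ _ ?_ _ ?_).symm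
  · have := r.lift_apply ⟨l', hl'P⟩ x hl'
    rw [← this]
    congr 2
    exact Subtype.ext hx
  · exact (r.germ_comp ⟨l', hl'P⟩ ⟨m', hm'P⟩ ⟨n', hn'P⟩ x hl' hm'' hn' ecomp).symm

/-- Two pairs `(P, ν)` and `(P', ν')` are equivalent if equal germs of members of `P` and `P'` are
sent to equal germs. -/
def Equivalent (r r' : p.Rep) : Prop :=
  ∀ {i j : X.Idx} (l : r.P i j) (l' : r'.P i j) (x : X.sp i), (x : Euc X.dim) ∈ l.1.dom →
    (x : Euc X.dim) ∈ l'.1.dom → l.1 =ᶠ[𝓝 (x : Euc X.dim)] l'.1 →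
    r.ν l =ᶠ[𝓝 (p.lift i x : Euc Y.dim)] r'.ν l'

theorem equivalent_iff (r r' : p.Rep) : r.Equivalent r' ↔ r.arrMap = r'.arrMap := by
  constructor
  · intro H
    funext a
    obtain ⟨i, j, l, x, h, rfl⟩ := r.exists_mem a
    obtain ⟨l', hl', h', e⟩ := r'.good i j l.1 x h
    have e' : germ l.1 x h = germ l' x h' := germ_eq_iff.2 e
    rw [r.arrMap_germ, e', r'.arrMap_germ ⟨l', hl'⟩]
    exact germ_eq_iff.2 (H l ⟨l', hl'⟩ x h h' e)
  · intro H i j l l' x h h' e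
    have e' : germ l.1 x h = germ l'.1 x h' := germ_eq_iff.2 e
    have := congrFun H (germ l.1 x h)
    rw [r.arrMap_germ, e', r'.arrMap_germ] at this
    exact germ_eq_iff.1 this

instance setoid (p : PreMor X Y) : Setoid p.Rep where
  r r r' := r.Equivalent r'
  iseqv :=
    { refl := fun r => (equivalent_iff r r).2 rfl
      symm := fun h => (equivalent_iff _ _).2 ((equivalent_iff _ _).1 h).symm
      trans := fun h h' =>
        (equivalent_iff _ _).2 (((equivalent_iff _ _).1 h).trans ((equivalent_iff _ _).1 h')) }

end Rep

end PreMor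

/-- A morphism of atlases `(f, f̄, {f̃ᵢ}, [P, ν])`. -/
structure Mor (X Y : RedAtl.{u}) extends PreMor X Y where
  cls : Quotient (PreMor.Rep.setoid toPreMor)

namespace Mor

/-- The map between the spaces of germs induced by a morphism of atlases: if `l` is in `P`, the germ
of `l` at `x` is sent to the germ of `ν(l)` at `f̃(x)`. -/
def arrMap (f : Mor X Y) : X.Arr → Y.Arr :=
  Quotient.lift PreMor.Rep.arrMap (fun r r' h => (PreMor.Rep.equivalent_iff r r').1 @h) f.cls

theorem ext_of_arrMap {f g : Mor X Y} (h : f.toPreMor = g.toPreMor) (h' : f.arrMap = g.arrMap) :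
    f = g := by
  obtain ⟨p, c⟩ := f
  obtain ⟨q, d⟩ := g
  obtain rfl : p = q := h
  congr 1
  induction c using Quotient.inductionOn with
  | h r =>
    induction d using Quotient.inductionOn with
    | h r' => exact Quotient.sound ((PreMor.Rep.equivalent_iff r r').2 h')

open RedAtl

theorem src_arrMap (f : Mor X Y) (a : X.Arr) : src (f.arrMap a) = f.objMap (src a) := by
  obtain ⟨p, c⟩ := f
  induction c using Quotient.inductionOn with
  | h r => exact r.src_arrMap a

theorem tgt_arrMap (f : Mor X Y) (a : X.Arr) : tgt (f.arrMap a) = f.objMap (tgt a) := by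
  obtain ⟨p, c⟩ := f
  induction c using Quotient.inductionOn with
  | h r => exact r.tgt_arrMap a

theorem arrMap_one (f : Mor X Y) (o : X.Obj) : f.arrMap (one o) = one (f.objMap o) := by
  obtain ⟨p, c⟩ := f
  induction c using Quotient.inductionOn with
  | h r => exact r.arrMap_one o

theorem arrMap_mul (f : Mor X Y) (a b : X.Arr) (h : tgt a = src b) :
    f.arrMap (mul a b h) = mul (f.arrMap a) (f.arrMap b)
      ((f.tgt_arrMap a).trans ((congrArg f.objMap h).trans (f.src_arrMap b).symm)) := by
  obtain ⟨p, c⟩ := f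
  induction c using Quotient.inductionOn with
  | h r => exact r.arrMap_mul a b h

theorem arrMap_germ (f : Mor X Y) (r : f.Rep) (hr : ⟦r⟧ = f.cls) {i j : X.Idx} (l : r.P i j)
    (x : X.sp i) (h : (x : Euc X.dim) ∈ l.1.dom) :
    f.arrMap (germ l.1 x h) = germ (r.ν l) (f.lift i x) (r.lift_mem_dom l x h) := by
  rw [arrMap, ← hr]
  exact r.arrMap_germ l x h

end Mor

namespace PreMor

/-- The identity of an atlas, before adding `[P, ν]`. -/
def id (X : RedAtl.{u}) : PreMor X X where
  base := ContinuousMap.id _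
  idx i := i
  image_subset i := by simp
  lift i x := x
  smooth_lift i := contMDiff_id
  proj_lift i x := rfl

/-- The pair `(P, ν)` of the identity: all changes of charts, and the identity map. -/
def idRep (X : RedAtl.{u}) : (PreMor.id X).Rep where
  P i j := univ
  good i j l x h := ⟨l, mem_univ l, h, EventuallyEq.rfl⟩
  ν l := l.1
  lift_mem_dom l x h := h
  lift_mem_cod l x h := h
  lift_apply l x h := rfl
  germ_congr l l' x h h' e := e
  germ_comp l₁ l₂ l₃ x h₁ h₂ h₃ e := e.symm
  germ_id l x h e := e

/-- The composition of the maps, the index maps and the lifts of two morphisms. -/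
def comp (p : PreMor X Y) (q : PreMor Y Z) : PreMor X Z where
  base := q.base.comp p.base
  idx i := q.idx (p.idx i)
  image_subset i := by
    rintro _ ⟨y, hy, rfl⟩
    exact q.image_subset _ ⟨p.base y, p.image_subset i ⟨y, hy, rfl⟩, rfl⟩
  lift i x := q.lift (p.idx i) (p.lift i x)
  smooth_lift i := (q.smooth_lift _).comp (p.smooth_lift i)
  proj_lift i x := by rw [q.proj_lift, p.proj_lift]; rfl

namespace Rep

open RedAtl

variable {p : PreMor X Y} {q : PreMor Y Z}

/-- The change of charts `l` is a restriction of a member `l₀` of `P_f`, and on the image of its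
domain under `f̃` the germs of `ν_f(l₀)` are the germs of the member `m` of `P_g`. -/
def CompData (r : p.Rep) (r' : q.Rep) {i j : X.Idx} (l : X.Ch i j)
    (m : r'.P (p.idx i) (p.idx j)) : Prop :=
  ∃ l₀ : r.P i j, l.dom ≤ l₀.1.dom ∧ (∀ y ∈ l.dom, l y = l₀.1 y) ∧
    ∀ x : X.sp i, (x : Euc X.dim) ∈ l.dom → (p.lift i x : Euc Y.dim) ∈ m.1.dom ∧
      r.ν l₀ =ᶠ[𝓝 (p.lift i x : Euc Y.dim)] m.1

theorem CompData.arrMap_germ {r : p.Rep} {r' : q.Rep} {i j : X.Idx} {l : X.Ch i j}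
    {m : r'.P (p.idx i) (p.idx j)} (H : CompData r r' l m) (x : X.sp i)
    (h : (x : Euc X.dim) ∈ l.dom) :
    r.arrMap (germ l x h) = germ m.1 (p.lift i x) (H.choose_spec.2.2 x h).1 := by
  have h0 := H.choose_spec
  have e : germ l x h = germ H.choose.1 x (h0.1 h) :=
    germ_eq_iff.2 (mem_of_superset (l.eventually_mem h) fun y hy => h0.2.1 y hy)
  rw [e, r.arrMap_germ]
  exact germ_eq_iff.2 (h0.2.2 x h).2

theorem CompData.arrMap_arrMap {r : p.Rep} {r' : q.Rep} {i j : X.Idx} {l : X.Ch i j}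
    {m : r'.P (p.idx i) (p.idx j)} (H : CompData r r' l m) (x : X.sp i)
    (h : (x : Euc X.dim) ∈ l.dom) :
    r'.arrMap (r.arrMap (germ l x h)) = germ (r'.ν m) ((p.comp q).lift i x)
      (r'.lift_mem_dom _ _ (H.choose_spec.2.2 x h).1) := by
  rw [H.arrMap_germ x h, r'.arrMap_germ]
  rfl

theorem CompData.apply {r : p.Rep} {r' : q.Rep} {i j : X.Idx} {l : X.Ch i j}
    {m : r'.P (p.idx i) (p.idx j)} (H : CompData r r' l m) (x : X.sp i)
    (h : (x : Euc X.dim) ∈ l.dom) :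
    p.lift j (l.apply x h) = m.1.apply (p.lift i x) (H.choose_spec.2.2 x h).1 := by
  have := r.tgt_arrMap (germ l x h)
  rw [H.arrMap_germ x h, tgt_germ, tgt_germ] at this
  exact (eq_of_heq (Sigma.mk.inj this).2).symm

/-- The pair `(P, ν)` of a composition `g ∘ f`: the members of `P` are the restrictions `l` of
members `l₀` of `P_f` such that `ν_f(l₀)` coincides, near the image of the domain of `l`, with some
member `m` of `P_g`; for a choice of such an `m` one sets `ν(l) = ν_g(m)`. -/
def comp (r : p.Rep) (r' : q.Rep) : (p.comp q).Rep where
  P i j := {l | ∃ m, CompData r r' l m}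
  good i j l x hx := by
    obtain ⟨l₀, hl₀, hx₀, e⟩ := r.good i j l x hx
    let x' : X.sp i := ⟨x, l.dom_le hx⟩
    have hy := r.lift_mem_dom ⟨l₀, hl₀⟩ x' hx₀
    obtain ⟨m, hm, hym, em⟩ := r'.good _ _ (r.ν ⟨l₀, hl₀⟩) _ hy
    have hN : ∀ᶠ z in 𝓝 x', (p.lift i z : Euc Y.dim) ∈ m.dom ∧
        r.ν ⟨l₀, hl₀⟩ =ᶠ[𝓝 (p.lift i z : Euc Y.dim)] m := by
      have hc : ContinuousAt (fun z => (p.lift i z : Euc Y.dim)) x' :=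
        (continuous_subtype_val.comp (p.smooth_lift i).continuous).continuousAt
      exact hc.tendsto.eventually ((m.eventually_mem hym).and em.eventuallyEq_nhds)
    have hU : Subtype.val '' {z : X.sp i | (p.lift i z : Euc Y.dim) ∈ m.dom ∧
        r.ν ⟨l₀, hl₀⟩ =ᶠ[𝓝 (p.lift i z : Euc Y.dim)] m} ∈ 𝓝 x :=
      (X.sp i).2.isOpenMap_subtype_val.image_mem_nhds hN
    obtain ⟨l', hx', hsub, hl'⟩ := l₀.exists_restrict hx₀ hU
    refine ⟨l', ⟨⟨m, hm⟩, ⟨l₀, hl₀⟩, fun y hy => (hsub hy).1, hl', fun z hz => ?_⟩, hx', ?_⟩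
    · obtain ⟨z', hz', ez⟩ := (hsub hz).2
      obtain rfl : z' = z := Subtype.ext ez
      exact hz'
    · exact e.trans (mem_of_superset (l'.eventually_mem hx') fun y hy => (hl' y hy).symm)
  ν l := r'.ν l.2.choose
  lift_mem_dom l x h := r'.lift_mem_dom _ _ (l.2.choose_spec.choose_spec.2.2 x h).1
  lift_mem_cod {i j} l y h := by
    obtain ⟨x, hx, hxy⟩ : ∃ (x : X.sp i) (hx : (x : Euc X.dim) ∈ l.1.dom),
        y = l.1.apply x hx := by
      refine ⟨⟨_, l.1.dom_le (l.1.toPH.map_target h)⟩, l.1.toPH.map_target h, ?_⟩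
      exact Subtype.ext (l.1.toPH.right_inv h).symm
    subst hxy
    refine r'.lift_mem_cod _ _ ?_
    rw [l.2.choose_spec.apply x hx]
    exact ChangeOfCharts.mem_cod _ (l.2.choose_spec.choose_spec.2.2 x hx).1
  lift_apply l x h := by
    have := r'.lift_apply l.2.choose _ (l.2.choose_spec.choose_spec.2.2 x h).1
    rw [← l.2.choose_spec.apply x h] at this
    exact this
  germ_congr l l' x h h' e := by
    have H := (l.2.choose_spec.arrMap_arrMap x h).symm.trans
      ((congrArg (fun a => r'.arrMap (r.arrMap a)) (germ_eq_iff.2 e)).trans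
        (l'.2.choose_spec.arrMap_arrMap x h'))
    exact germ_eq_iff.1 H
  germ_comp {i j k} l₁ l₂ l₃ x h₁ h₂ h₃ e := by
    have h : tgt (germ l₁.1 x h₁) = src (germ l₂.1 (l₁.1.apply x h₁) h₂) := rfl
    have H := congrArg (fun a => r'.arrMap (r.arrMap a)) (mul_germ h₁ h₂ h₃ rfl h e)
    simp only [r.arrMap_mul, r'.arrMap_mul, l₁.2.choose_spec.arrMap_arrMap x h₁,
      l₂.2.choose_spec.arrMap_arrMap (l₁.1.apply x h₁) h₂, l₃.2.choose_spec.arrMap_arrMap x h₃] at H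
    refine comp_eventuallyEq_of_mul _ _ _ ?_ _ H
    refine Subtype.ext ?_
    have := r'.lift_apply l₁.2.choose _ (l₁.2.choose_spec.choose_spec.2.2 x h₁).1
    rw [← l₁.2.choose_spec.apply x h₁] at this
    exact this
  germ_id {i} l x h e := by
    have h1 : germ l.1 x h = one ⟨i, x⟩ := germ_eq_iff.2 e
    have H := l.2.choose_spec.arrMap_arrMap x h
    rw [h1, r.arrMap_one, r'.arrMap_one] at H
    exact (germ_eq_iff.1 H).symm

theorem arrMap_comp (r : p.Rep) (r' : q.Rep) (a : X.Arr) :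
    (r.comp r').arrMap a = r'.arrMap (r.arrMap a) := by
  obtain ⟨i, j, l, x, h, rfl⟩ := (r.comp r').exists_mem a
  rw [arrMap_germ]
  exact (l.2.choose_spec.arrMap_arrMap x h).symm

theorem arrMap_idRep (a : X.Arr) : (idRep X).arrMap a = a := by
  obtain ⟨i, j, l, x, h, rfl⟩ := (idRep X).exists_mem a
  rw [arrMap_germ]
  rfl

end Rep

end PreMor

namespace Mor

/-- The identity morphism of an atlas. -/
def id (X : RedAtl.{u}) : Mor X X := ⟨PreMor.id X, ⟦PreMor.idRep X⟧⟩

/-- The composition `g ∘ f` of morphisms of atlases. -/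
def comp (f : Mor X Y) (g : Mor Y Z) : Mor X Z where
  toPreMor := f.toPreMor.comp g.toPreMor
  cls := Quotient.map₂ PreMor.Rep.comp
    (fun r₁ r₂ h r₁' r₂' h' => (PreMor.Rep.equivalent_iff _ _).2 (funext fun a => by
      rw [PreMor.Rep.arrMap_comp, PreMor.Rep.arrMap_comp, (PreMor.Rep.equivalent_iff _ _).1 @h,
        (PreMor.Rep.equivalent_iff _ _).1 @h'])) f.cls g.cls

@[simp] theorem arrMap_id (a : X.Arr) : (id X).arrMap a = a := PreMor.Rep.arrMap_idRep a

@[simp] theorem arrMap_comp (f : Mor X Y) (g : Mor Y Z) (a : X.Arr) :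
    (f.comp g).arrMap a = g.arrMap (f.arrMap a) := by
  obtain ⟨p, c⟩ := f
  obtain ⟨q, d⟩ := g
  induction c using Quotient.inductionOn with
  | h r =>
    induction d using Quotient.inductionOn with
    | h r' => exact PreMor.Rep.arrMap_comp r r' a

theorem id_comp (f : Mor X Y) : (id X).comp f = f :=
  ext_of_arrMap rfl (funext fun a => by rw [arrMap_comp, arrMap_id])

theorem comp_id (f : Mor X Y) : f.comp (id Y) = f :=
  ext_of_arrMap rfl (funext fun a => by rw [arrMap_comp, arrMap_id])

theorem comp_assoc (f : Mor X Y) (g : Mor Y Z) (h : Mor Z W) :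
    (f.comp g).comp h = f.comp (g.comp h) :=
  ext_of_arrMap rfl (funext fun a => by simp only [arrMap_comp])

end Mor

/-! ### 2-morphisms of atlases -/

namespace RedAtl

theorem mul_germ_eq_mul_germ_iff {i j j' k : X.Idx} {l : X.Ch i j} {l' : X.Ch j k}
    {m : X.Ch i j'} {m' : X.Ch j' k} {x : X.sp i} {y : X.sp j} {y' : X.sp j'}
    (h : (x : Euc X.dim) ∈ l.dom) (h' : (y : Euc X.dim) ∈ l'.dom)
    (hm : (x : Euc X.dim) ∈ m.dom) (hm' : (y' : Euc X.dim) ∈ m'.dom)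
    (hy : (y : Euc X.dim) = l x) (hy' : (y' : Euc X.dim) = m x)
    (e : tgt (germ l x h) = src (germ l' y h')) (e' : tgt (germ m x hm) = src (germ m' y' hm')) :
    mul (germ l x h) (germ l' y h') e = mul (germ m x hm) (germ m' y' hm') e' ↔
      l' ∘ l =ᶠ[𝓝 (x : Euc X.dim)] m' ∘ m := by
  have h1 : l x ∈ l'.dom := hy ▸ h'
  have h2 : m x ∈ m'.dom := hy' ▸ hm'
  obtain ⟨n, hn, -, en⟩ := l.exists_comp l' h h1 univ_mem
  obtain ⟨p, hp, -, ep⟩ := m.exists_comp m' hm h2 univ_mem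
  have e1 : n =ᶠ[𝓝 (x : Euc X.dim)] l' ∘ l :=
    mem_of_superset (n.eventually_mem hn) fun y hy => (en y hy).2.2
  have e2 : p =ᶠ[𝓝 (x : Euc X.dim)] m' ∘ m :=
    mem_of_superset (p.eventually_mem hp) fun y hy => (ep y hy).2.2
  rw [mul_germ h h' hn hy e e1, mul_germ hm hm' hp hy' e' e2, germ_eq_iff]
  exact ⟨fun H => e1.symm.trans (H.trans e2), fun H => e1.trans (H.trans e2.symm)⟩

end RedAtl

open RedAtl

/-- A representative of a 2-morphism from `f` to `g`. The family of the pairs `(X̃ᵢᵃ, δᵢᵃ)` with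
fixed `i` is given as a set of pairs. -/
structure TwoRep (f g : Mor X Y) where
  base_eq : f.base = g.base
  pieces : ∀ i, Set (Opens (X.sp i) × Y.Ch (f.idx i) (g.idx i))
  cover : ∀ i (x : X.sp i), ∃ a ∈ pieces i, x ∈ a.1
  mem_dom : ∀ {i a}, a ∈ pieces i → ∀ x ∈ a.1, (f.lift i x : Euc Y.dim) ∈ a.2.dom
  mem_cod : ∀ {i a}, a ∈ pieces i → ∀ x ∈ a.1, (g.lift i x : Euc Y.dim) ∈ a.2.cod
  comm : ∀ {i a}, a ∈ pieces i → ∀ x ∈ a.1, (g.lift i x : Euc Y.dim) = a.2 (f.lift i x)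
  germ_eq : ∀ {i a a'}, a ∈ pieces i → a' ∈ pieces i → ∀ x, x ∈ a.1 → x ∈ a'.1 →
    a.2 =ᶠ[𝓝 (f.lift i x : Euc Y.dim)] a'.2
  natural : ∀ {i i' a a'}, a ∈ pieces i → a' ∈ pieces i' → ∀ (l : X.Ch i i') (x : X.sp i)
    (h : (x : Euc X.dim) ∈ l.dom), x ∈ a.1 → l.apply x h ∈ a'.1 →
    ∃ (r₁ : f.Rep) (r₂ : g.Rep) (l₁ : r₁.P i i') (l₂ : r₂.P i i'), ⟦r₁⟧ = f.cls ∧ ⟦r₂⟧ = g.cls ∧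
      (x : Euc X.dim) ∈ l₁.1.dom ∧ (x : Euc X.dim) ∈ l₂.1.dom ∧
      l₁.1 =ᶠ[𝓝 (x : Euc X.dim)] l ∧ l₂.1 =ᶠ[𝓝 (x : Euc X.dim)] l ∧
      r₂.ν l₂ ∘ a.2 =ᶠ[𝓝 (f.lift i x : Euc Y.dim)] a'.2 ∘ r₁.ν l₁

/-- `α` has the formal properties of a natural transformation between the maps of germs induced by
`f` and `g`. -/
structure IsNat (f g : Mor X Y) (α : X.Obj → Y.Arr) : Prop where
  src_app : ∀ o, src (α o) = f.objMap o
  tgt_app : ∀ o, tgt (α o) = g.objMap o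
  natural : ∀ a : X.Arr,
    mul (α (src a)) (g.arrMap a) ((tgt_app _).trans (g.src_arrMap a).symm) =
      mul (f.arrMap a) (α (tgt a)) ((f.tgt_arrMap a).trans (src_app _).symm)

namespace TwoRep

variable {f g f' : Mor X Y}

/-- The map `x ↦ germ_{f̃(x)} δᵢᵃ`, for `x` in `X̃ᵢᵃ`. -/
def val (δ : TwoRep f g) (o : X.Obj) : Y.Arr :=
  germ (δ.cover o.1 o.2).choose.2 (f.lift o.1 o.2)
    (δ.mem_dom (δ.cover o.1 o.2).choose_spec.1 _ (δ.cover o.1 o.2).choose_spec.2)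

theorem val_eq (δ : TwoRep f g) {i : X.Idx} {a} (ha : a ∈ δ.pieces i) (x : X.sp i) (hx : x ∈ a.1) :
    δ.val ⟨i, x⟩ = germ a.2 (f.lift i x) (δ.mem_dom ha x hx) :=
  germ_eq_iff.2 (δ.germ_eq (δ.cover i x).choose_spec.1 ha x (δ.cover i x).choose_spec.2 hx)

/-- Two representatives are equivalent if their members have equal germs. -/
def Equivalent (δ δ' : TwoRep f g) : Prop :=
  ∀ {i a a'}, a ∈ δ.pieces i → a' ∈ δ'.pieces i → ∀ x, x ∈ a.1 → x ∈ a'.1 →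
    a.2 =ᶠ[𝓝 (f.lift i x : Euc Y.dim)] a'.2

theorem equivalent_iff (δ δ' : TwoRep f g) : δ.Equivalent δ' ↔ δ.val = δ'.val := by
  constructor
  · intro H
    funext ⟨i, x⟩
    obtain ⟨a, ha, hx⟩ := δ.cover i x
    obtain ⟨a', ha', hx'⟩ := δ'.cover i x
    rw [δ.val_eq ha x hx, δ'.val_eq ha' x hx']
    exact germ_eq_iff.2 (H ha ha' x hx hx')
  · intro H i a a' ha ha' x hx hx'
    have := congrFun H ⟨i, x⟩
    rw [δ.val_eq ha x hx, δ'.val_eq ha' x hx'] at this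
    exact germ_eq_iff.1 this

instance setoid (f g : Mor X Y) : Setoid (TwoRep f g) where
  r δ δ' := δ.Equivalent δ'
  iseqv :=
    { refl := fun δ => (equivalent_iff δ δ).2 rfl
      symm := fun h => (equivalent_iff _ _).2 ((equivalent_iff _ _).1 h).symm
      trans := fun h h' =>
        (equivalent_iff _ _).2 (((equivalent_iff _ _).1 h).trans ((equivalent_iff _ _).1 h')) }

theorem isNat (δ : TwoRep f g) : IsNat f g δ.val where
  src_app o := rfl
  tgt_app := by
    rintro ⟨i, x⟩
    obtain ⟨a, ha, hx⟩ := δ.cover i x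
    rw [δ.val_eq ha x hx, tgt_germ, PreMor.objMap]
    congr 1
    exact Subtype.ext (δ.comm ha x hx).symm
  natural b := by
    obtain ⟨i, i', l, x, h, rfl⟩ := exists_germ b
    obtain ⟨a, ha, hx⟩ := δ.cover i x
    obtain ⟨a', ha', hx'⟩ := δ.cover i' (l.apply x h)
    obtain ⟨r₁, r₂, l₁, l₂, hr₁, hr₂, h₁, h₂, e₁, e₂, e⟩ := δ.natural ha ha' l x h hx hx'
    have i1 : f.arrMap (germ l x h) = germ (r₁.ν l₁) (f.lift i x) (r₁.lift_mem_dom l₁ x h₁) :=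
      (congrArg f.arrMap (germ_eq_iff.2 e₁.symm)).trans (f.arrMap_germ r₁ hr₁ l₁ x h₁)
    have i2 : g.arrMap (germ l x h) = germ (r₂.ν l₂) (g.lift i x) (r₂.lift_mem_dom l₂ x h₂) :=
      (congrArg g.arrMap (germ_eq_iff.2 e₂.symm)).trans (g.arrMap_germ r₂ hr₂ l₂ x h₂)
    have j1 : δ.val (src (germ l x h)) = _ := δ.val_eq ha x hx
    have j2 : δ.val (tgt (germ l x h)) = _ := δ.val_eq ha' _ hx'
    simp only [i1, i2, j1, j2]
    refine (mul_germ_eq_mul_germ_iff _ _ _ _ (δ.comm ha x hx) ?_ _ _).2 e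
    rw [← r₁.lift_apply l₁ x h₁]
    congr 2
    exact Subtype.ext e₁.symm.eq_of_nhds

/-- A family of pairs whose germs are given by `α` is a representative of a 2-morphism as soon as
`α` has the formal properties of a natural transformation. -/
def ofVal (base_eq : f.base = g.base)
    (pieces : ∀ i, Set (Opens (X.sp i) × Y.Ch (f.idx i) (g.idx i)))
    (cover : ∀ i (x : X.sp i), ∃ a ∈ pieces i, x ∈ a.1) (α : X.Obj → Y.Arr) (hα : IsNat f g α)
    (H : ∀ i, ∀ a ∈ pieces i, ∀ x ∈ a.1, ∃ h, α ⟨i, x⟩ = germ a.2 (f.lift i x) h) : TwoRep f g :=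
  have mem_dom : ∀ {i a}, a ∈ pieces i → ∀ x ∈ a.1, (f.lift i x : Euc Y.dim) ∈ a.2.dom :=
    fun {i a} ha x hx => (H i a ha x hx).1
  have hgerm : ∀ {i a} (ha : a ∈ pieces i) (x) (hx : x ∈ a.1),
      α ⟨i, x⟩ = germ a.2 (f.lift i x) (mem_dom ha x hx) :=
    fun {i a} ha x hx => (H i a ha x hx).2
  have comm : ∀ {i a}, a ∈ pieces i → ∀ x ∈ a.1, (g.lift i x : Euc Y.dim) = a.2 (f.lift i x) := by
    intro i a ha x hx
    have h := hα.tgt_app ⟨i, x⟩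
    rw [hgerm ha x hx, tgt_germ] at h
    exact congrArg Subtype.val (eq_of_heq (Sigma.mk.inj h).2).symm
  { base_eq := base_eq
    pieces := pieces
    cover := cover
    mem_dom := mem_dom
    mem_cod := fun {i a} ha x hx => by
      rw [comm ha x hx]
      exact a.2.mem_cod (mem_dom ha x hx)
    comm := comm
    germ_eq := fun ha ha' x hx hx' =>
      germ_eq_iff.1 ((hgerm ha x hx).symm.trans (hgerm ha' x hx'))
    natural := fun {i i' a a'} ha ha' l x h hx hx' => by
      obtain ⟨r₁, hr₁⟩ := Quotient.exists_rep f.cls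
      obtain ⟨r₂, hr₂⟩ := Quotient.exists_rep g.cls
      obtain ⟨l₁, hl₁, h₁, e₁⟩ := r₁.good i i' l x h
      obtain ⟨l₂, hl₂, h₂, e₂⟩ := r₂.good i i' l x h
      refine ⟨r₁, r₂, ⟨l₁, hl₁⟩, ⟨l₂, hl₂⟩, hr₁, hr₂, h₁, h₂, e₁.symm, e₂.symm, ?_⟩
      have i1 : f.arrMap (germ l x h) = _ :=
        (congrArg f.arrMap (germ_eq_iff.2 e₁)).trans (f.arrMap_germ r₁ hr₁ ⟨l₁, hl₁⟩ x h₁)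
      have i2 : g.arrMap (germ l x h) = _ :=
        (congrArg g.arrMap (germ_eq_iff.2 e₂)).trans (g.arrMap_germ r₂ hr₂ ⟨l₂, hl₂⟩ x h₂)
      have j1 : α (src (germ l x h)) = _ := hgerm ha x hx
      have j2 : α (tgt (germ l x h)) = _ := hgerm ha' _ hx'
      have H := hα.natural (germ l x h)
      simp only [i1, i2, j1, j2] at H
      refine (mul_germ_eq_mul_germ_iff _ _ _ _ (comm ha x hx) ?_ _ _).1 H
      rw [← r₁.lift_apply ⟨l₁, hl₁⟩ x h₁]
      congr 2
      exact Subtype.ext e₁.eq_of_nhds }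

theorem val_ofVal (base_eq : f.base = g.base)
    (pieces : ∀ i, Set (Opens (X.sp i) × Y.Ch (f.idx i) (g.idx i)))
    (cover : ∀ i (x : X.sp i), ∃ a ∈ pieces i, x ∈ a.1) (α : X.Obj → Y.Arr) (hα : IsNat f g α)
    (H : ∀ i, ∀ a ∈ pieces i, ∀ x ∈ a.1, ∃ h, α ⟨i, x⟩ = germ a.2 (f.lift i x) h) :
    (ofVal base_eq pieces cover α hα H).val = α := by
  funext ⟨i, x⟩
  obtain ⟨a, ha, hx⟩ := cover i x
  rw [val_eq (ofVal base_eq pieces cover α hα H) ha x hx]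
  exact (H i a ha x hx).2.symm

end TwoRep

theorem IsNat.one (f : Mor X Y) : IsNat f f fun o => RedAtl.one (f.objMap o) where
  src_app o := rfl
  tgt_app o := tgt_one _
  natural a := by rw [one_mul', mul_one']

theorem IsNat.mul {f g h : Mor X Y} {α β : X.Obj → Y.Arr} (hα : IsNat f g α) (hβ : IsNat g h β) :
    IsNat f h fun o => RedAtl.mul (α o) (β o) ((hα.tgt_app o).trans (hβ.src_app o).symm) where
  src_app o := by rw [src_mul, hα.src_app]
  tgt_app o := by rw [tgt_mul, hβ.tgt_app]
  natural a := by
    rw [mul_assoc' _ _ _ _ ((hβ.tgt_app _).trans (h.src_arrMap a).symm)]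
    simp only [hβ.natural]
    rw [← mul_assoc' _ _ _ ((hα.tgt_app _).trans (g.src_arrMap a).symm)
      ((g.tgt_arrMap a).trans (hβ.src_app _).symm)]
    simp only [hα.natural]
    rw [mul_assoc' _ _ _ _ ((hα.tgt_app _).trans (hβ.src_app _).symm)]

theorem IsNat.hmul_eq {f₁ f₂ : Mor X Y} {g₁ g₂ : Mor Y Z} {α : X.Obj → Y.Arr} {β : Y.Obj → Z.Arr}
    (hα : IsNat f₁ f₂ α) (hβ : IsNat g₁ g₂ β) (o : X.Obj) :
    tgt (g₁.arrMap (α o)) = src (β (f₂.objMap o)) := by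
  rw [g₁.tgt_arrMap, hα.tgt_app, hβ.src_app]

theorem IsNat.hmul {f₁ f₂ : Mor X Y} {g₁ g₂ : Mor Y Z} {α : X.Obj → Y.Arr} {β : Y.Obj → Z.Arr}
    (hα : IsNat f₁ f₂ α) (hβ : IsNat g₁ g₂ β) : IsNat (f₁.comp g₁) (f₂.comp g₂)
      fun o => RedAtl.mul (g₁.arrMap (α o)) (β (f₂.objMap o)) (hα.hmul_eq hβ o) where
  src_app o := by rw [src_mul, g₁.src_arrMap, hα.src_app]; rfl
  tgt_app o := by rw [tgt_mul, hβ.tgt_app]; rfl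
  natural a := by
    have h1 := hβ.natural (f₂.arrMap a)
    have h2 := congrArg g₁.arrMap (hα.natural a)
    simp only [g₁.arrMap_mul] at h2
    simp only [f₂.src_arrMap, f₂.tgt_arrMap] at h1
    simp only [Mor.arrMap_comp]
    have k1 : tgt (β (f₂.objMap (src a))) = src (g₂.arrMap (f₂.arrMap a)) := by
      rw [hβ.tgt_app, g₂.src_arrMap, f₂.src_arrMap]
    rw [mul_assoc' _ _ _ _ k1]
    simp only [h1]
    have k2 : tgt (g₁.arrMap (α (src a))) = src (g₁.arrMap (f₂.arrMap a)) := by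
      rw [g₁.tgt_arrMap, g₁.src_arrMap, hα.tgt_app, f₂.src_arrMap]
    have k3 : tgt (g₁.arrMap (f₂.arrMap a)) = src (β (f₂.objMap (tgt a))) := by
      rw [g₁.tgt_arrMap, hβ.src_app, f₂.tgt_arrMap]
    rw [← mul_assoc' _ _ _ k2 k3]
    simp only [h2]
    rw [mul_assoc' _ _ _ _ (hα.hmul_eq hβ _)]

/-- A 2-morphism from `f` to `g`: an equivalence class of representatives. -/
def TwoMor (f g : Mor X Y) : Type u := Quotient (TwoRep.setoid f g)

namespace TwoMor

/-- The map `x ↦ germ_{f̃(x)} δᵢᵃ`, for `x` in `X̃ᵢᵃ`. -/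
def val {f g : Mor X Y} (δ : TwoMor f g) : X.Obj → Y.Arr :=
  Quotient.lift TwoRep.val (fun δ δ' h => (TwoRep.equivalent_iff δ δ').1 @h) δ

@[ext]
theorem ext {f g : Mor X Y} {δ δ' : TwoMor f g} (h : ∀ o, δ.val o = δ'.val o) : δ = δ' := by
  induction δ using Quotient.inductionOn with
  | h d =>
    induction δ' using Quotient.inductionOn with
    | h d' => exact Quotient.sound ((TwoRep.equivalent_iff d d').2 (funext h))

theorem isNat {f g : Mor X Y} (δ : TwoMor f g) : IsNat f g δ.val := by
  induction δ using Quotient.inductionOn with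
  | h d => exact d.isNat

end TwoMor

namespace TwoRep

theorem id_germ (f : Mor X Y) (i : X.Idx)
    (a : Opens (X.sp i) × Y.Ch (f.idx i) (f.idx i))
    (ha : a ∈ ({(⊤, ChangeOfCharts.refl (Y.chart (f.idx i)))} : Set _)) (x) (hx : x ∈ a.1) :
    ∃ h, one (f.objMap ⟨i, x⟩) = germ a.2 (f.lift i x) h := by
  obtain rfl := ha
  exact ⟨ChangeOfCharts.mem_refl_dom _ _, rfl⟩

/-- The identity 2-morphism of `f`, given by the pairs `(X̃ᵢ, id)`. -/
def id (f : Mor X Y) : TwoRep f f :=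
  ofVal rfl (fun i => {(⊤, ChangeOfCharts.refl (Y.chart (f.idx i)))})
    (fun i x => ⟨_, rfl, trivial⟩) (fun o => one (f.objMap o)) (IsNat.one f)
    (id_germ f)

/-- The pairs of a vertical composition: the maps are restrictions of the composites `σᵢᵇ ∘ δᵢᵃ`,
over subsets of the intersections of the open sets. -/
def vpieces {f g h : Mor X Y} (δ : TwoRep f g) (σ : TwoRep g h) (i : X.Idx) :
    Set (Opens (X.sp i) × Y.Ch (f.idx i) (h.idx i)) :=
  {p | ∃ a ∈ δ.pieces i, ∃ b ∈ σ.pieces i, p.1 ≤ a.1 ⊓ b.1 ∧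
    (∀ y ∈ p.2.dom, y ∈ a.2.dom ∧ a.2 y ∈ b.2.dom ∧ p.2 y = b.2 (a.2 y)) ∧
    ∀ x ∈ p.1, (f.lift i x : Euc Y.dim) ∈ p.2.dom}

theorem vcomp_germ {f g h : Mor X Y} (δ : TwoRep f g) (σ : TwoRep g h) (i : X.Idx) (p)
    (hp : p ∈ vpieces δ σ i) (x) (hx : x ∈ p.1) :
    ∃ hd, mul (δ.val ⟨i, x⟩) (σ.val ⟨i, x⟩) ((δ.isNat.tgt_app _).trans (σ.isNat.src_app _).symm) =
      germ p.2 (f.lift i x) hd := by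
  obtain ⟨a, ha, b, hb, h1, h2, h3⟩ := hp
  have e1 := δ.val_eq ha x (h1 hx).1
  have e2 := σ.val_eq hb x (h1 hx).2
  refine ⟨h3 x hx, ?_⟩
  simp only [e1, e2]
  refine mul_germ _ _ _ (δ.comm ha x (h1 hx).1) _ ?_
  exact mem_of_superset (p.2.eventually_mem (h3 x hx)) fun y hy => (h2 y hy).2.2

/-- The vertical composition `σ ⊙ δ`. -/
def vcomp {f g h : Mor X Y} (δ : TwoRep f g) (σ : TwoRep g h) : TwoRep f h :=
  ofVal (δ.base_eq.trans σ.base_eq) (vpieces δ σ)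
    (by
      intro i x
      obtain ⟨a, ha, hxa⟩ := δ.cover i x
      obtain ⟨b, hb, hxb⟩ := σ.cover i x
      obtain ⟨θ, h1, -, h2⟩ := a.2.exists_comp b.2 (δ.mem_dom ha x hxa)
        (by rw [← δ.comm ha x hxa]; exact σ.mem_dom hb x hxb) univ_mem
      let V : Opens (X.sp i) := ⟨(fun z => (f.lift i z : Euc Y.dim)) ⁻¹' θ.dom,
        θ.dom.2.preimage (continuous_subtype_val.comp (f.smooth_lift i).continuous)⟩
      exact ⟨(a.1 ⊓ b.1 ⊓ V, θ), ⟨a, ha, b, hb, inf_le_left, h2, fun z hz => hz.2⟩,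
        ⟨hxa, hxb⟩, h1⟩)
    _ (δ.isNat.mul σ.isNat)
    (vcomp_germ δ σ)

/-- The pairs of a horizontal composition: on a set where the germs of `δᵢᵃ` are those of a member
`m` of `P`, for a representative `(P, ν)` of the class of `g₁`, the map is a restriction of the
composite of `ν(m)` and `ξⱼᶜ`. -/
def hpieces {f₁ f₂ : Mor X Y} {g₁ g₂ : Mor Y Z} (δ : TwoRep f₁ f₂) (ξ : TwoRep g₁ g₂) (i : X.Idx) :
    Set (Opens (X.sp i) × Z.Ch ((f₁.comp g₁).idx i) ((f₂.comp g₂).idx i)) :=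
  {p | ∃ r : g₁.Rep, ⟦r⟧ = g₁.cls ∧ ∃ a ∈ δ.pieces i, ∃ m : r.P (f₁.idx i) (f₂.idx i),
    ∃ c ∈ ξ.pieces (f₂.idx i), p.1 ≤ a.1 ∧
    (∀ x ∈ p.1, (f₁.lift i x : Euc Y.dim) ∈ m.1.dom ∧
      m.1 =ᶠ[𝓝 (f₁.lift i x : Euc Y.dim)] a.2 ∧ f₂.lift i x ∈ c.1 ∧
      (g₁.lift _ (f₁.lift i x) : Euc Z.dim) ∈ p.2.dom) ∧
    ∀ y ∈ p.2.dom, y ∈ (r.ν m).dom ∧ r.ν m y ∈ c.2.dom ∧ p.2 y = c.2 (r.ν m y)}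

theorem hcomp_germ {f₁ f₂ : Mor X Y} {g₁ g₂ : Mor Y Z} (δ : TwoRep f₁ f₂) (ξ : TwoRep g₁ g₂)
    (i : X.Idx) (p) (hp : p ∈ hpieces δ ξ i) (x) (hx : x ∈ p.1) :
    ∃ hd, mul (g₁.arrMap (δ.val ⟨i, x⟩)) (ξ.val (f₂.objMap ⟨i, x⟩)) (δ.isNat.hmul_eq ξ.isNat _) =
      germ p.2 ((f₁.comp g₁).lift i x) hd := by
  obtain ⟨r, hr, a, ha, m, c, hc, h1, h2, h3⟩ := hp
  obtain ⟨k1, k2, k3, k4⟩ := h2 x hx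
  have e1 : g₁.arrMap (δ.val ⟨i, x⟩) = germ (r.ν m) (g₁.lift _ (f₁.lift i x))
      (r.lift_mem_dom m _ k1) := by
    rw [δ.val_eq ha x (h1 hx), ← g₁.arrMap_germ r hr m _ k1]
    exact congrArg g₁.arrMap (germ_eq_iff.2 k2.symm)
  have e2 : ξ.val (f₂.objMap ⟨i, x⟩) = _ := ξ.val_eq hc _ k3
  refine ⟨k4, ?_⟩
  simp only [e1, e2]
  refine mul_germ (l := r.ν m) (x := g₁.lift _ (f₁.lift i x)) (r.lift_mem_dom m _ k1) _ k4 ?_ _ ?_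
  · refine Eq.trans ?_ (r.lift_apply m (f₁.lift i x) k1)
    refine congrArg (fun y => (g₁.lift _ y : Euc Z.dim)) ?_
    exact Subtype.ext ((δ.comm ha x (h1 hx)).trans k2.symm.eq_of_nhds)
  · exact mem_of_superset (p.2.eventually_mem k4) fun y hy => (h3 y hy).2.2

/-- The horizontal composition `ξ ∗ δ`. -/
def hcomp {f₁ f₂ : Mor X Y} {g₁ g₂ : Mor Y Z} (δ : TwoRep f₁ f₂) (ξ : TwoRep g₁ g₂) :
    TwoRep (f₁.comp g₁) (f₂.comp g₂) :=
  ofVal (congrArg₂ ContinuousMap.comp ξ.base_eq δ.base_eq) (hpieces δ ξ)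
    (by
      intro i x
      obtain ⟨a, ha, hxa⟩ := δ.cover i x
      obtain ⟨c, hc, hxc⟩ := ξ.cover _ (f₂.lift i x)
      obtain ⟨r, hr⟩ := Quotient.exists_rep g₁.cls
      obtain ⟨m, hm, hxm, em⟩ := r.good _ _ a.2 _ (δ.mem_dom ha x hxa)
      have hx1 := r.lift_mem_dom ⟨m, hm⟩ (f₁.lift i x) hxm
      have hx2 : r.ν ⟨m, hm⟩ (g₁.lift _ (f₁.lift i x)) ∈ c.2.dom := by
        rw [← r.lift_apply ⟨m, hm⟩ (f₁.lift i x) hxm]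
        have : m.apply (f₁.lift i x) hxm = f₂.lift i x :=
          Subtype.ext (em.symm.eq_of_nhds.trans (δ.comm ha x hxa).symm)
        rw [this]
        exact ξ.mem_dom hc _ hxc
      obtain ⟨γ, h1, -, h2⟩ := (r.ν ⟨m, hm⟩).exists_comp c.2 hx1 hx2 univ_mem
      have c1 : Continuous fun z => (f₁.lift i z : Euc Y.dim) :=
        continuous_subtype_val.comp (f₁.smooth_lift i).continuous
      have c2 : Continuous fun z => (g₁.lift _ (f₁.lift i z) : Euc Z.dim) :=
        continuous_subtype_val.comp
          ((g₁.smooth_lift _).continuous.comp (f₁.smooth_lift i).continuous)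
      have hN : {z : X.sp i | z ∈ a.1 ∧ ((f₁.lift i z : Euc Y.dim) ∈ m.dom ∧
          m =ᶠ[𝓝 (f₁.lift i z : Euc Y.dim)] a.2 ∧ f₂.lift i z ∈ c.1 ∧
          (g₁.lift _ (f₁.lift i z) : Euc Z.dim) ∈ γ.dom)} ∈ 𝓝 x := by
        have n1 := a.1.2.mem_nhds hxa
        have n2 := c1.continuousAt.tendsto.eventually (m.eventually_mem hxm)
        have n3 := c1.continuousAt.tendsto.eventually (em.symm.eventuallyEq_nhds)
        have n4 := ((f₂.smooth_lift i).continuous.continuousAt (x := x)).tendsto.eventually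
          (c.1.2.mem_nhds hxc)
        have n5 := c2.continuousAt.tendsto.eventually (γ.eventually_mem h1)
        filter_upwards [n1, n2, n3, n4, n5] with z z1 z2 z3 z4 z5
        exact ⟨z1, z2, z3, z4, z5⟩
      obtain ⟨V, hV, hVo, hxV⟩ := mem_nhds_iff.1 hN
      exact ⟨(⟨V, hVo⟩, γ), ⟨r, hr, a, ha, ⟨m, hm⟩, c, hc, fun z hz => (hV hz).1,
        fun z hz => (hV hz).2, h2⟩, hxV⟩)
    _ (δ.isNat.hmul ξ.isNat)
    (hcomp_germ δ ξ)

theorem val_id (f : Mor X Y) : (id f).val = fun o => one (f.objMap o) :=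
  val_ofVal _ _ _ _ _ (id_germ f)

theorem val_vcomp {f g h : Mor X Y} (δ : TwoRep f g) (σ : TwoRep g h) : (δ.vcomp σ).val = fun o =>
    mul (δ.val o) (σ.val o) ((δ.isNat.tgt_app o).trans (σ.isNat.src_app o).symm) :=
  val_ofVal _ _ _ _ _ (vcomp_germ δ σ)

theorem val_hcomp {f₁ f₂ : Mor X Y} {g₁ g₂ : Mor Y Z} (δ : TwoRep f₁ f₂) (ξ : TwoRep g₁ g₂) :
    (δ.hcomp ξ).val = fun o =>
      mul (g₁.arrMap (δ.val o)) (ξ.val (f₂.objMap o)) (δ.isNat.hmul_eq ξ.isNat o) :=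
  val_ofVal _ _ _ _ _ (hcomp_germ δ ξ)

end TwoRep

namespace TwoMor

/-- The identity 2-morphism of `f`. -/
def id (f : Mor X Y) : TwoMor f f := Quotient.mk _ (TwoRep.id f)

@[simp] theorem val_id (f : Mor X Y) (o : X.Obj) : (id f).val o = one (f.objMap o) :=
  congrFun (TwoRep.val_id f) o

/-- The vertical composition `σ ⊙ δ`. -/
def vcomp {f g h : Mor X Y} (δ : TwoMor f g) (σ : TwoMor g h) : TwoMor f h :=
  Quotient.map₂ TwoRep.vcomp
    (fun δ δ' e σ σ' e' => (TwoRep.equivalent_iff _ _).2 (by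
      simp only [TwoRep.val_vcomp]
      simp only [(TwoRep.equivalent_iff _ _).1 @e, (TwoRep.equivalent_iff _ _).1 @e'])) δ σ

theorem val_vcomp {f g h : Mor X Y} (δ : TwoMor f g) (σ : TwoMor g h) (o : X.Obj) :
    (δ.vcomp σ).val o =
      mul (δ.val o) (σ.val o) ((δ.isNat.tgt_app o).trans (σ.isNat.src_app o).symm) := by
  induction δ using Quotient.inductionOn with
  | h d =>
    induction σ using Quotient.inductionOn with
    | h s => exact congrFun (TwoRep.val_vcomp d s) o

/-- The horizontal composition `ξ ∗ δ`. -/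
def hcomp {f₁ f₂ : Mor X Y} {g₁ g₂ : Mor Y Z} (δ : TwoMor f₁ f₂) (ξ : TwoMor g₁ g₂) :
    TwoMor (f₁.comp g₁) (f₂.comp g₂) :=
  Quotient.map₂ TwoRep.hcomp
    (fun δ δ' e σ σ' e' => (TwoRep.equivalent_iff _ _).2 (by
      simp only [TwoRep.val_hcomp]
      simp only [(TwoRep.equivalent_iff _ _).1 @e, (TwoRep.equivalent_iff _ _).1 @e'])) δ ξ

theorem val_hcomp {f₁ f₂ : Mor X Y} {g₁ g₂ : Mor Y Z} (δ : TwoMor f₁ f₂) (ξ : TwoMor g₁ g₂)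
    (o : X.Obj) : (δ.hcomp ξ).val o =
      mul (g₁.arrMap (δ.val o)) (ξ.val (f₂.objMap o)) (δ.isNat.hmul_eq ξ.isNat o) := by
  induction δ using Quotient.inductionOn with
  | h d =>
    induction ξ using Quotient.inductionOn with
    | h s => exact congrFun (TwoRep.val_hcomp d s) o

theorem val_id_hcomp (f : Mor X Y) {g₁ g₂ : Mor Y Z} (ξ : TwoMor g₁ g₂) (o : X.Obj) :
    ((id f).hcomp ξ).val o = ξ.val (f.objMap o) := by
  rw [val_hcomp]
  simp only [val_id, g₁.arrMap_one]
  exact one_mul' _ _ _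

theorem val_hcomp_id {f₁ f₂ : Mor X Y} (δ : TwoMor f₁ f₂) (g : Mor Y Z) (o : X.Obj) :
    (δ.hcomp (id g)).val o = g.arrMap (δ.val o) := by
  rw [val_hcomp]
  simp only [val_id]
  exact mul_one' _ _ _

end TwoMor

/-! ### The 2-category of reduced orbifold atlases -/

namespace RedAtl

instance : CategoryStruct RedAtl.{u} where
  Hom X Y := Mor X Y
  id X := Mor.id X
  comp f g := Mor.comp f g

instance homCategory (X Y : RedAtl.{u}) : Category (X ⟶ Y) where
  Hom f g := TwoMor f g
  id f := TwoMor.id f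
  comp δ σ := TwoMor.vcomp δ σ
  id_comp δ := TwoMor.ext fun o => by
    rw [TwoMor.val_vcomp]; simp only [TwoMor.val_id]; exact one_mul' _ _ _
  comp_id δ := TwoMor.ext fun o => by
    rw [TwoMor.val_vcomp]; simp only [TwoMor.val_id]; exact mul_one' _ _ _
  assoc δ σ τ := TwoMor.ext fun o => by
    simp only [TwoMor.val_vcomp]; exact mul_assoc' _ _ _ _ _

theorem val_comp {X Y : RedAtl.{u}} {f g h : X ⟶ Y} (δ : f ⟶ g) (σ : g ⟶ h) (o : X.Obj) :
    TwoMor.val (δ ≫ σ) o = mul (TwoMor.val δ o) (TwoMor.val σ o)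
      ((TwoMor.isNat δ).tgt_app o |>.trans ((TwoMor.isNat σ).src_app o).symm) :=
  TwoMor.val_vcomp δ σ o

theorem val_conj {X Y : RedAtl.{u}} {f f' g g' : X ⟶ Y} (e : f = f') (e' : g' = g) (δ : f' ⟶ g')
    (o : X.Obj) : TwoMor.val (eqToHom e ≫ δ ≫ eqToHom e') o = TwoMor.val δ o := by
  subst e e'
  rw [eqToHom_refl, eqToHom_refl, Category.id_comp, Category.comp_id]

theorem val_eqToHom {X Y : RedAtl.{u}} {f g : X ⟶ Y} (e : f = g) (o : X.Obj) :
    TwoMor.val (eqToHom e) o = one (Mor.toPreMor f |>.objMap o) := by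
  subst e
  exact TwoMor.val_id _ _

theorem val_comp_of_one {X Y : RedAtl.{u}} {f g h : X ⟶ Y} {δ : f ⟶ g} {σ : g ⟶ h} {o : X.Obj}
    (hδ : TwoMor.val δ o = one (Mor.toPreMor f |>.objMap o))
    (hσ : TwoMor.val σ o = one (Mor.toPreMor g |>.objMap o)) :
    TwoMor.val (δ ≫ σ) o = one (Mor.toPreMor f |>.objMap o) := by
  rw [val_comp]
  simp only [hδ, hσ]
  exact mul_one' _ _ _

/-- The 2-category of reduced orbifold atlases. Whiskering is horizontal composition with an
identity 2-morphism. -/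
instance : Bicategory RedAtl.{u} where
  homCategory := homCategory
  whiskerLeft {_ _ _} f {_ _} ξ := TwoMor.hcomp (TwoMor.id f) ξ
  whiskerRight {_ _ _} {_ _} δ g := TwoMor.hcomp δ (TwoMor.id g)
  associator f g h := eqToIso (Mor.comp_assoc f g h)
  leftUnitor f := eqToIso (Mor.id_comp f)
  rightUnitor f := eqToIso (Mor.comp_id f)
  whiskerLeft_id f g := TwoMor.ext fun o => by
    rw [TwoMor.val_id_hcomp]; exact (TwoMor.val_id g _).trans (TwoMor.val_id (Mor.comp f g) _).symm
  whiskerLeft_comp f _ _ _ η θ := TwoMor.ext fun o => by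
    rw [val_comp, TwoMor.val_id_hcomp, val_comp]; simp only [TwoMor.val_id_hcomp]
  id_whiskerLeft η := TwoMor.ext fun o => by
    rw [eqToIso.hom, eqToIso.inv, val_conj, TwoMor.val_id_hcomp]; rfl
  comp_whiskerLeft f g _ _ η := TwoMor.ext fun o => by
    rw [eqToIso.hom, eqToIso.inv, val_conj, TwoMor.val_id_hcomp, TwoMor.val_id_hcomp,
      TwoMor.val_id_hcomp]; rfl
  id_whiskerRight f g := TwoMor.ext fun o => by
    rw [TwoMor.val_hcomp_id]
    exact (congrArg (Mor.arrMap g) (TwoMor.val_id _ _)).trans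
      ((Mor.arrMap_one g _).trans (TwoMor.val_id (Mor.comp f g) _).symm)
  comp_whiskerRight η θ g := TwoMor.ext fun o => by
    rw [val_comp, TwoMor.val_hcomp_id, val_comp]; simp only [TwoMor.val_hcomp_id]
    exact Mor.arrMap_mul g _ _ _
  whiskerRight_id η := TwoMor.ext fun o => by
    rw [eqToIso.hom, eqToIso.inv, val_conj, TwoMor.val_hcomp_id]; exact Mor.arrMap_id _
  whiskerRight_comp η g h := TwoMor.ext fun o => by
    rw [eqToIso.hom, eqToIso.inv, val_conj, TwoMor.val_hcomp_id, TwoMor.val_hcomp_id,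
      TwoMor.val_hcomp_id]; exact Mor.arrMap_comp g h _
  whisker_assoc f _ _ η h := TwoMor.ext fun o => by
    rw [eqToIso.hom, eqToIso.inv, val_conj, TwoMor.val_hcomp_id, TwoMor.val_id_hcomp,
      TwoMor.val_id_hcomp, TwoMor.val_hcomp_id]
  whisker_exchange η θ := TwoMor.ext fun o => by
    rw [val_comp, val_comp]
    simp only [TwoMor.val_hcomp_id, TwoMor.val_id_hcomp]
    have h := (TwoMor.isNat θ).natural (TwoMor.val η o)
    simp only [(TwoMor.isNat η).src_app, (TwoMor.isNat η).tgt_app] at h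
    exact h
  pentagon f g h k := TwoMor.ext fun o => by
    refine Eq.trans (val_comp_of_one ?_ (val_comp_of_one
      (val_eqToHom (Mor.comp_assoc f (Mor.comp g h) k) _) ?_)) (val_comp_of_one
        (val_eqToHom (Mor.comp_assoc (Mor.comp f g) h k) _)
        (val_eqToHom (Mor.comp_assoc f g (Mor.comp h k)) _)).symm
    · exact (TwoMor.val_hcomp_id _ _ _).trans ((congrArg (Mor.arrMap k)
        (val_eqToHom (Mor.comp_assoc f g h) _)).trans (Mor.arrMap_one k _))
    · exact (TwoMor.val_id_hcomp _ _ _).trans (val_eqToHom (Mor.comp_assoc g h k) _)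
  triangle f g := TwoMor.ext fun o => by
    refine Eq.trans (val_comp_of_one
      (val_eqToHom (Mor.comp_assoc f (Mor.id _) g) _) ?_) ?_
    · exact (TwoMor.val_id_hcomp _ _ _).trans (val_eqToHom (Mor.id_comp g) _)
    · exact ((TwoMor.val_hcomp_id _ _ _).trans ((congrArg (Mor.arrMap g)
        (val_eqToHom (Mor.comp_id f) _)).trans (Mor.arrMap_one g _))).symm

instance : Bicategory.Strict RedAtl.{u} where
  id_comp := Mor.id_comp
  comp_id := Mor.comp_id
  assoc := Mor.comp_assoc
  leftUnitor_eqToIso _ := rfl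
  rightUnitor_eqToIso _ := rfl
  associator_eqToIso _ _ _ := rfl

end RedAtl

end RedOrb

end

open RedOrb

/-!
The algebraic part of the theorem says that passing to germs turns changes of charts, the
assignments `ν` and the families `δ` into arrows, functors and natural transformations; all these
identities are identities of germs, so they hold once they hold for representatives. Smoothness is
also local: near a given germ of a change of charts `l`, the arrows are the germs of `l`, and in the
chart `germ_x l ↦ x` all structure maps become maps between base points
(`RedAtl.contMDiffAt_of_eventually_germ`).

The part with geometric content is that the space of germs is Hausdorff, that `(s, t)` is proper,
and that the space of germs is paracompact. These rest on the rigidity of finite group actions: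

* A diffeomorphism of finite order that fixes `z` with derivative the identity is the identity near
  `z`, because the mean of its iterates is an invariant map that is injective near `z`
  (`eventually_eq_of_iterate_eq`). So the elements of the group of a chart have germs that are
  determined by their values and derivatives.
* If `l` and `l'` are changes of charts defined at `x`, then `l'(y)` lies in the orbit of `l(y)` for
  all `y` near `x`, so `l'` coincides at each point with one of the finitely many maps `g ∘ l`. One
  of the closed sets `{l' = g ∘ l}` has interior points arbitrarily close to `x`, and by continuity
  `l'` and `g ∘ l` have the same value and derivative at `x`. Near `x`, any other `g' ∘ l` that
  coincides with `l'` on an open set has a derivative close to that of `g ∘ l`, hence the same germ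
  as `g ∘ l` at `x`. So `l' = g ∘ l` near `x`
  (`ChangeOfCharts.exists_eventuallyEq_ofPerm_comp`).

Consequently a germ is determined by its source, its target and its derivative, which gives an
injective continuous map of the space of germs to a Hausdorff space. Moreover, near two points `x`
and `y` over the same point of `X` all germs are germs of the finitely many `g ∘ l`, for one change
of charts `l` with `l(x) = y`; an ultrafilter of germs whose sources and targets converge to `x` and
`y` therefore contains the germs of one `g ∘ l` and converges. Finally, a space with a proper map to
a paracompact space is paracompact, and the space of objects is metrizable.
-/

noncomputable section

namespace RedOrb

/-! ### Maps that pointwise agree with one of finitely many maps -/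

/-- Finitely many closed sets cannot cover a neighbourhood of `z` without one of them having
interior points arbitrarily close to `z`. -/
theorem exists_frequently_eventuallyEq {E F ι : Type*} [TopologicalSpace E] [TopologicalSpace F]
    [T2Space F] [Finite ι] {f : E → F} {h : ι → E → F} {z : E}
    (hf : ∀ᶠ y in 𝓝 z, ContinuousAt f y) (hh : ∀ i, ∀ᶠ y in 𝓝 z, ContinuousAt (h i) y)
    (H : ∀ᶠ y in 𝓝 z, ∃ i, f y = h i y) : ∃ i, ∃ᶠ y in 𝓝 z, f =ᶠ[𝓝 y] h i := by
  classical
  have := Fintype.ofFinite ι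
  by_contra hcon
  push Not at hcon
  have hall : ∀ᶠ y in 𝓝 z, ContinuousAt f y ∧ (∀ i, ContinuousAt (h i) y) ∧
      (∃ i, f y = h i y) ∧ ∀ i, ¬ f =ᶠ[𝓝 y] h i := by
    filter_upwards [hf, eventually_all.2 hh, H, eventually_all.2 hcon]
      with y h1 h2 h3 h4
    exact ⟨h1, h2, h3, h4⟩
  obtain ⟨W, hW, hWo, hzW⟩ := mem_nhds_iff.1 hall
  -- removing the sets `{f = h i}` one after the other keeps a non-empty open set
  have key : ∀ S : Finset ι, ∃ V ⊆ W, IsOpen V ∧ V.Nonempty ∧ ∀ i ∈ S, ∀ y ∈ V, f y ≠ h i y := by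
    intro S
    induction S using Finset.induction_on with
    | empty => exact ⟨W, Subset.rfl, hWo, ⟨z, hzW⟩, by simp⟩
    | insert i S hi ih =>
      obtain ⟨V, hVW, hVo, ⟨v, hv⟩, hV⟩ := ih
      have hne : ∃ y ∈ V, f y ≠ h i y := by
        by_contra hc
        push Not at hc
        exact (hW (hVW hv)).2.2.2 i (mem_of_superset (hVo.mem_nhds hv) hc)
      obtain ⟨y, hy, hyne⟩ := hne
      have hW' := hW (hVW hy)
      have hN := (hVo.mem_nhds hy)
      have hN' : ∀ᶠ w in 𝓝 y, f w ≠ h i w :=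
        (hW'.1.prodMk (hW'.2.1 i)).tendsto.eventually
          (isClosed_diagonal.isOpen_compl.mem_nhds (x := (f y, h i y)) hyne)
      obtain ⟨V', hV', hVo', hyV'⟩ := mem_nhds_iff.1 (inter_mem hN hN')
      refine ⟨V', fun w hw => hVW (hV' hw).1, hVo', ⟨y, hyV'⟩, fun k hk w hw => ?_⟩
      rcases Finset.mem_insert.1 hk with rfl | hk
      · exact (hV' hw).2
      · exact hV k hk w (hV' hw).1
  obtain ⟨V, hVW, -, ⟨v, hv⟩, hV⟩ := key Finset.univ
  obtain ⟨i, hi⟩ := (hW (hVW hv)).2.2.1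
  exact hV i (Finset.mem_univ i) v hv hi

variable {E F : Type*} [NormedAddCommGroup E] [NormedSpace ℝ E] [NormedAddCommGroup F]
  [NormedSpace ℝ F]

/-- A `C¹` map that agrees at each point with one of finitely many `C¹` maps has the germ of one of
them, provided that the germs of these maps are determined by their values and derivatives. -/
theorem exists_eventuallyEq_of_forall_exists_eq {ι : Type*} [Finite ι] {f : E → F}
    {h : ι → E → F} {z : E} (hf : ContDiffAt ℝ 1 f z) (hh : ∀ i, ContDiffAt ℝ 1 (h i) z)
    (H : ∀ᶠ y in 𝓝 z, ∃ i, f y = h i y)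
    (hjet : ∀ i j, h i z = h j z → fderiv ℝ (h i) z = fderiv ℝ (h j) z → h i =ᶠ[𝓝 z] h j) :
    ∃ i, f =ᶠ[𝓝 z] h i := by
  have hcont : ∀ {g : E → F}, ContDiffAt ℝ 1 g z → ∀ᶠ y in 𝓝 z, ContinuousAt g y := fun hg =>
    (hg.eventually (by simp)).mono fun y hy => hy.continuousAt
  have hderiv : ∀ {g : E → F}, ContDiffAt ℝ 1 g z → ContinuousAt (fderiv ℝ g) z := fun hg =>
    (hg.fderiv_right (m := 0) (by simp)).continuousAt
  obtain ⟨i, hi⟩ := exists_frequently_eventuallyEq (hcont hf) (fun i => hcont (hh i)) H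
  have hi0 : f z = h i z := tendsto_nhds_unique_of_frequently_eq hf.continuousAt
    (hh i).continuousAt (hi.mono fun y hy => hy.eq_of_nhds)
  have hi1 : fderiv ℝ f z = fderiv ℝ (h i) z := tendsto_nhds_unique_of_frequently_eq (hderiv hf)
    (hderiv (hh i)) (hi.mono fun y hy => hy.fderiv_eq)
  refine ⟨i, ?_⟩
  by_contra hne
  -- near `z`, a map with the value and derivative of `f` at some point agrees with `h i`
  have hsep : ∀ j, ∀ᶠ y in 𝓝 z, f y = h j y → fderiv ℝ f y = fderiv ℝ (h j) y →
      h j y = h i y := by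
    intro j
    by_cases hj0 : f z = h j z
    · by_cases hj1 : fderiv ℝ f z = fderiv ℝ (h j) z
      · filter_upwards [hjet j i (hj0.symm.trans hi0) (hj1.symm.trans hi1)] with y hy _ _
        exact hy
      · filter_upwards [((hderiv hf).prodMk (hderiv (hh j))).tendsto.eventually
          (isClosed_diagonal.isOpen_compl.mem_nhds
            (x := (fderiv ℝ f z, fderiv ℝ (h j) z)) hj1)] with y hy _ h1
        exact absurd h1 hy
    · filter_upwards [(hf.continuousAt.prodMk (hh j).continuousAt).tendsto.eventually
          (isClosed_diagonal.isOpen_compl.mem_nhds (x := (f z, h j z)) hj0)] with y hy h0 _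
      exact absurd h0 hy
  have hall := (hcont hf).and ((eventually_all.2 fun j => hcont (hh j)).and
    (H.and (eventually_all.2 hsep)))
  obtain ⟨y, hy, hyall⟩ := ((not_eventually.1 hne).and_eventually hall.eventually_nhds).exists
  obtain ⟨j, hj⟩ := exists_frequently_eventuallyEq (hyall.mono fun _ h => h.1)
    (fun j => hyall.mono fun _ h => h.2.1 j) (hyall.mono fun _ h => h.2.2.1)
  have hne' : ∀ᶠ w in 𝓝 y, f w ≠ h i w :=
    (hyall.self_of_nhds.1.prodMk (hyall.self_of_nhds.2.1 i)).tendsto.eventually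
      (isClosed_diagonal.isOpen_compl.mem_nhds (x := (f y, h i y)) hy)
  obtain ⟨w, hw, hwne, hwall⟩ := (hj.and_eventually (hne'.and hyall)).exists
  exact hwne (hw.eq_of_nhds.trans (hwall.2.2.2 j hw.eq_of_nhds hw.fderiv_eq))

/-- A map of finite order with a fixed point at which its derivative is the identity is the identity
near that point: the mean of its iterates is invariant under the map, and injective near the
point. -/
theorem eventually_eq_of_iterate_eq [CompleteSpace E] {h : E → E} {z : E} {k : ℕ} (hk : 0 < k)
    (hz : h z = z) (hd : HasStrictFDerivAt h (ContinuousLinearMap.id ℝ E) z)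
    (hiter : ∀ᶠ y in 𝓝 z, h^[k] y = y) : ∀ᶠ y in 𝓝 z, h y = y := by
  let φ : E → E := fun y => (k : ℝ)⁻¹ • ∑ i ∈ Finset.range k, h^[i] y
  have hφ : HasStrictFDerivAt φ ((ContinuousLinearEquiv.refl ℝ E : E ≃L[ℝ] E) : E →L[ℝ] E) z := by
    have h1 : HasStrictFDerivAt φ ((k : ℝ)⁻¹ • ∑ i ∈ Finset.range k,
        (ContinuousLinearMap.id ℝ E) ^ i) z :=
      (HasStrictFDerivAt.fun_sum fun i _ => hd.iterate hz i).const_smul _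
    convert! h1 using 1
    have : (k : ℝ) ≠ 0 := by positivity
    have e : ∀ i : ℕ, (ContinuousLinearMap.id ℝ E) ^ i = ContinuousLinearMap.id ℝ E :=
      fun i => one_pow i
    ext v
    simp [e, this, ← Nat.cast_smul_eq_nsmul ℝ, smul_smul]
  have hinv : ∀ᶠ y in 𝓝 z, φ (h y) = φ y := by
    filter_upwards [hiter] with y hy
    simp only [φ, ← Function.iterate_succ_apply]
    have h1 := Finset.sum_range_succ (fun i => h^[i] y) k
    have h2 := Finset.sum_range_succ' (fun i => h^[i] y) k
    simp only [hy, Function.iterate_zero, id] at h1 h2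
    rw [add_right_cancel (h2.symm.trans h1)]
  have hsrc : ∀ᶠ y in 𝓝 z, y ∈ (hφ.toOpenPartialHomeomorph φ).source :=
    (hφ.toOpenPartialHomeomorph φ).open_source.mem_nhds hφ.mem_toOpenPartialHomeomorph_source
  have hsrc' : ∀ᶠ y in 𝓝 z, h y ∈ (hφ.toOpenPartialHomeomorph φ).source := by
    have hc := hd.continuousAt
    rw [ContinuousAt, hz] at hc
    exact hc.eventually hsrc
  filter_upwards [hinv, hsrc, hsrc'] with y h1 h2 h3
  exact (hφ.toOpenPartialHomeomorph φ).injOn h3 h2 h1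

/-! ### Changes of charts with the same germ -/

namespace ChangeOfCharts

variable {X : Type u} [TopologicalSpace X] {n : ℕ} {c d : OrbChart X n}

/-- The action of an element of the group of a chart, as a change of charts. -/
def ofPerm (g : c.G) : ChangeOfCharts c c where
  dom := c.space
  cod := c.space
  dom_le := le_rfl
  cod_le := le_rfl
  isComponent := (refl c).isComponent
  diffeo :=
    { toEquiv := (g : Equiv.Perm c.space)
      contMDiff_toFun := c.smooth_G g g.2
      contMDiff_invFun := c.smooth_G _ (g⁻¹).2 }
  comm _ := ((c.proj_eq_proj_iff _ _).2 ⟨g, g.2, rfl⟩).symm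

theorem ofPerm_apply (g : c.G) (x : c.space) :
    ofPerm g x = (g : Equiv.Perm c.space) x := (ofPerm g).ext_of_mem x.2

theorem ofPerm_mem (g : c.G) {x : Euc n} (hx : x ∈ c.space) : ofPerm g x ∈ c.space :=
  (ofPerm g).mem_cod hx

theorem ofPerm_one {x : Euc n} (hx : x ∈ c.space) : ofPerm (1 : c.G) x = x :=
  ofPerm_apply 1 ⟨x, hx⟩

theorem ofPerm_mul (g h : c.G) {x : Euc n} (hx : x ∈ c.space) :
    ofPerm (g * h) x = ofPerm g (ofPerm h x) := by
  lift x to c.space using hx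
  rw [ofPerm_apply, ofPerm_apply, ofPerm_apply]
  rfl

theorem ofPerm_pow (g : c.G) (k : ℕ) {x : Euc n} (hx : x ∈ c.space) :
    (ofPerm g)^[k] x = ofPerm (g ^ k) x := by
  induction k with
  | zero => exact (ofPerm_one hx).symm
  | succ k ih => rw [Function.iterate_succ_apply', ih, pow_succ', ofPerm_mul _ _ hx]

theorem contDiffAt (l : ChangeOfCharts c d) {x : Euc n} (hx : x ∈ l.dom) : ContDiffAt ℝ 1 l x :=
  (l.contDiffOn.contDiffAt (l.dom.2.mem_nhds hx)).of_le (by simp)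

theorem differentiableAt (l : ChangeOfCharts c d) {x : Euc n} (hx : x ∈ l.dom) :
    DifferentiableAt ℝ l x := (l.contDiffAt hx).differentiableAt (by simp)

/-- The germ at a point of an element of the group of a chart is determined by its value and its
derivative. -/
theorem ofPerm_eventuallyEq {g h : c.G} {x : Euc n} (hx : x ∈ c.space)
    (h0 : ofPerm g x = ofPerm h x) (h1 : fderiv ℝ (ofPerm g) x = fderiv ℝ (ofPerm h) x) :
    ofPerm g =ᶠ[𝓝 x] ofPerm h := by
  have := c.finite_G
  have hnhds : ∀ᶠ y in 𝓝 x, y ∈ c.space := c.space.2.mem_nhds hx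
  let k := h⁻¹ * g
  have hmul : ∀ g' : c.G, ofPerm (h⁻¹ * g') =ᶠ[𝓝 x] ofPerm h⁻¹ ∘ ofPerm g' := fun g' =>
    hnhds.mono fun y hy => ofPerm_mul _ _ hy
  have hderiv : ∀ g' : c.G, fderiv ℝ (ofPerm (h⁻¹ * g')) x =
      (fderiv ℝ (ofPerm h⁻¹) (ofPerm g' x)).comp (fderiv ℝ (ofPerm g') x) := fun g' => by
    rw [(hmul g').fderiv_eq]
    exact fderiv_comp _ (differentiableAt _ (ofPerm_mem g' hx)) (differentiableAt _ hx)
  have hk0 : ofPerm k x = x := by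
    rw [ofPerm_mul _ _ hx, h0, ← ofPerm_mul _ _ hx, inv_mul_cancel, ofPerm_one hx]
  have hk1 : fderiv ℝ (ofPerm k) x = ContinuousLinearMap.id ℝ _ := by
    have e : ofPerm (1 : c.G) =ᶠ[𝓝 x] id := hnhds.mono fun y hy => ofPerm_one hy
    rw [hderiv, h0, h1, ← hderiv, inv_mul_cancel, e.fderiv_eq, fderiv_id]
  have hkd : HasStrictFDerivAt (ofPerm k) (ContinuousLinearMap.id ℝ _) x := by
    rw [← hk1]
    exact ((ofPerm k).contDiffAt hx).hasStrictFDerivAt (by simp)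
  have hfin := eventually_eq_of_iterate_eq (orderOf_pos k) hk0 hkd (hnhds.mono fun y hy => by
    rw [ofPerm_pow _ _ hy, pow_orderOf_eq_one, ofPerm_one hy])
  filter_upwards [hfin, hnhds] with y hy hyc
  rw [← mul_inv_cancel_left h g, ofPerm_mul _ _ hyc, hy]

/-- The derivative of a change of charts can be cancelled on the right, as the derivative of the
inverse is a right inverse of it. -/
theorem fderiv_comp_cancel (l : ChangeOfCharts c d) {x : Euc n} (hx : x ∈ l.dom)
    {A B : Euc n →L[ℝ] Euc n} (h : A.comp (fderiv ℝ l x) = B.comp (fderiv ℝ l x)) : A = B := by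
  have hy : l x ∈ l.cod := l.mem_cod hx
  have hback : l.toPH.symm (l x) = x := l.toPH.left_inv hx
  have hinv : DifferentiableAt ℝ l.toPH.symm (l x) :=
    (l.contDiffOn_symm.contDiffAt (l.cod.2.mem_nhds hy)).differentiableAt (by simp)
  have hid : l ∘ l.toPH.symm =ᶠ[𝓝 (l x)] id :=
    mem_of_superset (l.cod.2.mem_nhds hy) fun y hy => l.toPH.right_inv hy
  have hd : (fderiv ℝ l x).comp (fderiv ℝ l.toPH.symm (l x)) = ContinuousLinearMap.id ℝ _ := by
    have hl : DifferentiableAt ℝ l (l.toPH.symm (l x)) := by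
      rw [hback]; exact l.differentiableAt hx
    rw [← fderiv_id (x := l x), ← hid.fderiv_eq, fderiv_comp _ hl hinv, hback]
  have h2 := congrArg (fun T => T.comp (fderiv ℝ l.toPH.symm (l x))) h
  simpa only [ContinuousLinearMap.comp_assoc, hd, ContinuousLinearMap.comp_id] using h2

/-- Near a common point of their domains, two changes of charts differ by an element of the group
of the target chart. -/
theorem exists_eventuallyEq_ofPerm_comp (l l' : ChangeOfCharts c d) {x : Euc n} (hx : x ∈ l.dom)
    (hx' : x ∈ l'.dom) : ∃ g : d.G, l' =ᶠ[𝓝 x] ofPerm g ∘ l := by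
  have := d.finite_G
  have hlx : l x ∈ d.space := l.cod_le (l.mem_cod hx)
  refine exists_eventuallyEq_of_forall_exists_eq (h := fun g : d.G => ofPerm g ∘ l)
    (l'.contDiffAt hx') (fun g => ((ofPerm g).contDiffAt hlx).comp x (l.contDiffAt hx)) ?_ ?_
  · filter_upwards [l.eventually_mem hx, l'.eventually_mem hx'] with y hy hy'
    obtain ⟨g, hg, e⟩ := (d.proj_eq_proj_iff _ _).1 ((l.proj_apply ⟨y, l.dom_le hy⟩ hy).trans
      (l'.proj_apply ⟨y, l.dom_le hy⟩ hy').symm)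
    exact ⟨⟨g, hg⟩, (congrArg Subtype.val e.symm).trans (ofPerm_apply ⟨g, hg⟩ _).symm⟩
  · intro g g' h0 h1
    rw [fderiv_comp _ (differentiableAt _ hlx) (l.differentiableAt hx),
      fderiv_comp _ (differentiableAt _ hlx) (l.differentiableAt hx)] at h1
    exact (l.continuousAt hx).tendsto.eventually
      (ofPerm_eventuallyEq hlx h0 (l.fderiv_comp_cancel hx h1))

/-- The germ of a change of charts at a point is determined by its value and its derivative. -/
theorem eventuallyEq_of_fderiv_eq {l l' : ChangeOfCharts c d} {x : Euc n} (hx : x ∈ l.dom)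
    (hx' : x ∈ l'.dom) (h0 : l x = l' x) (h1 : fderiv ℝ l x = fderiv ℝ l' x) :
    l =ᶠ[𝓝 x] l' := by
  obtain ⟨g, hg⟩ := exists_eventuallyEq_ofPerm_comp l l' hx hx'
  have hlx : l x ∈ d.space := l.cod_le (l.mem_cod hx)
  have hone : ofPerm (1 : d.G) =ᶠ[𝓝 (l x)] id :=
    mem_of_superset (d.space.2.mem_nhds hlx) fun y hy => ofPerm_one hy
  have hg1 : ofPerm g =ᶠ[𝓝 (l x)] ofPerm (1 : d.G) := by
    refine ofPerm_eventuallyEq hlx ?_ (l.fderiv_comp_cancel hx ?_)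
    · exact hg.eq_of_nhds.symm.trans (h0.symm.trans hone.eq_of_nhds.symm)
    · rw [hone.fderiv_eq, fderiv_id, ContinuousLinearMap.id_comp]
      exact (fderiv_comp _ ((ofPerm g).differentiableAt hlx) (l.differentiableAt hx)).symm.trans
        (hg.fderiv_eq.symm.trans h1.symm)
  refine EventuallyEq.trans ?_ hg.symm
  filter_upwards [(l.continuousAt hx).tendsto.eventually (hg1.trans hone)] with y hy
  exact hy.symm

end ChangeOfCharts

namespace RedAtl

variable {X : RedAtl.{u}}

/-! ### The algebra of germs -/

theorem isInv_inv (a : X.Arr) : IsInv a (inv a) := (exists_isInv a).choose_spec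

@[simp] theorem src_inv (a : X.Arr) : src (inv a) = tgt a := by
  obtain ⟨i, j, l, l', x, h, h', rfl, e, -⟩ := isInv_inv a
  rw [e]; rfl

@[simp] theorem tgt_inv (a : X.Arr) : tgt (inv a) = src a := by
  obtain ⟨i, j, l, l', x, h, h', rfl, e, H⟩ := isInv_inv a
  rw [e, tgt_germ, src_germ]
  congr 1
  exact Subtype.ext H.self_of_nhds

theorem inv_mul_self (a : X.Arr) : mul (inv a) a (tgt_inv a) = one (tgt a) := by
  obtain ⟨i, j, l, l', x, h, h', rfl, e, H⟩ := isInv_inv a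
  simp only [e, tgt_germ]
  refine mul_germ _ _ _ H.self_of_nhds.symm _ ?_
  have hc : Tendsto l.toPH.symm (𝓝 (l x)) (𝓝 (x : Euc X.dim)) := by
    have := l.toPH.continuousAt_symm (x := l x) (l.mem_cod h)
    rwa [ContinuousAt, show l.toPH.symm (l x) = x from l.toPH.left_inv h] at this
  filter_upwards [hc.eventually H, l.cod.2.mem_nhds (l.mem_cod h)] with z hz hzc
  have hz' : l (l.toPH.symm z) = z := l.toPH.right_inv hzc
  rw [hz'] at hz
  rw [Function.comp_apply, hz, hz']
  exact ChangeOfCharts.refl_apply _ (l.cod_le hzc)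

theorem eq_inv_of_mul_eq_one {a b : X.Arr} (e : tgt a = src b)
    (h : mul a b e = one (src a)) : b = inv a := by
  have H := mul_assoc' (inv a) a b (tgt_inv a) e
  simp only [inv_mul_self, h] at H
  rwa [one_mul', mul_one'] at H

theorem inv_inv (a : X.Arr) : inv (inv a) = a :=
  (eq_inv_of_mul_eq_one (tgt_inv a) (by rw [inv_mul_self, src_inv])).symm

theorem mul_inv_self (a : X.Arr) : mul a (inv a) (src_inv a).symm = one (src a) := by
  have H := inv_mul_self (inv a)
  simp only [inv_inv, tgt_inv] at H
  exact H

theorem inv_germ {i j : X.Idx} {l : X.Ch i j} {l' : X.Ch j i} {x : X.sp i} {y : X.sp j}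
    (h : (x : Euc X.dim) ∈ l.dom) (h' : (y : Euc X.dim) ∈ l'.dom) (hy : (y : Euc X.dim) = l x)
    (e : ∀ᶠ y in 𝓝 (x : Euc X.dim), l' (l y) = y) : inv (germ l x h) = germ l' y h' := by
  have hy' : l.apply x h = y := Subtype.ext hy.symm
  refine (eq_inv_of_mul_eq_one (by rw [tgt_germ, src_germ, hy']) ?_).symm
  refine mul_germ _ _ _ hy _ ?_
  filter_upwards [e, ChangeOfCharts.refl_eventuallyEq _ x.2] with z hz hz'
  exact hz'.trans hz.symm

/-! ### The smooth structures on objects and germs -/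

/-- The chart `germ_x l ↦ x` of the space of germs. -/
def germPH {i j : X.Idx} (l : X.Ch i j) : OpenPartialHomeomorph X.Arr (Euc X.dim) :=
  X.arrCore.openPartialHomeomorph (germChart l) ⟨_, _, l, rfl⟩

theorem germPH_symm_apply {i j : X.Idx} (l : X.Ch i j) (x : X.sp i)
    (h : (x : Euc X.dim) ∈ l.dom) : (germPH l).symm x = germ l x h := germChart_symm_apply l h

theorem mem_atlas_arr_iff {e : OpenPartialHomeomorph X.Arr (Euc X.dim)} :
    e ∈ atlas (Euc X.dim) X.Arr ↔ ∃ (i j : X.Idx) (l : X.Ch i j), e = germPH l := by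
  change e ∈ (⋃ (e : PartialEquiv X.Arr (Euc X.dim)) (he : e ∈ X.arrCore.atlas),
    {X.arrCore.openPartialHomeomorph e he}) ↔ _
  simp only [mem_iUnion, mem_singleton_iff]
  constructor
  · rintro ⟨_, ⟨i, j, l, rfl⟩, h⟩
    exact ⟨i, j, l, h⟩
  · rintro ⟨i, j, l, rfl⟩
    exact ⟨_, ⟨i, j, l, rfl⟩, rfl⟩

theorem isOpen_germs {i j : X.Idx} (l : X.Ch i j) : IsOpen (germs l) := (germPH l).open_source

theorem germs_mem_nhds {i j : X.Idx} (l : X.Ch i j) (x : X.sp i) (h : (x : Euc X.dim) ∈ l.dom) :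
    germs l ∈ 𝓝 (germ l x h) := (isOpen_germs l).mem_nhds ⟨x, h, rfl⟩

instance isManifold_arr : IsManifold 𝓘(ℝ, Euc X.dim) ∞ X.Arr := by
  refine isManifold_of_contDiffOn _ _ _ fun e e' he he' => ?_
  obtain ⟨i, j, l, rfl⟩ := mem_atlas_arr_iff.1 he
  obtain ⟨i', j', l', rfl⟩ := mem_atlas_arr_iff.1 he'
  refine contDiffOn_id.congr fun y hy => ?_
  exact germChart_trans_apply l (germChart l') (fun _ => rfl) hy.1

theorem objChart_symm_apply {i : X.Idx} (x : X.sp i) : (X.objChart i).symm x = ⟨i, x⟩ :=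
  dif_pos x.2

instance isManifold_obj : IsManifold 𝓘(ℝ, Euc X.dim) ∞ X.Obj := by
  refine isManifold_of_contDiffOn _ _ _ fun e e' he he' => ?_
  obtain ⟨i, rfl⟩ := he
  obtain ⟨i', rfl⟩ := he'
  refine contDiffOn_id.congr fun y hy => ?_
  have hy' : y ∈ X.sp i := hy.1.1
  change X.objChart i' ((X.objChart i).symm (⟨y, hy'⟩ : X.sp i)) = y
  rw [objChart_symm_apply]
  rfl

theorem germPH_mem_maximalAtlas {i j : X.Idx} (l : X.Ch i j) :
    germPH l ∈ IsManifold.maximalAtlas 𝓘(ℝ, Euc X.dim) ∞ X.Arr :=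
  IsManifold.subset_maximalAtlas (mem_atlas_arr_iff.2 ⟨i, j, l, rfl⟩)

theorem objChart_mem_maximalAtlas (i : X.Idx) :
    X.objChart i ∈ IsManifold.maximalAtlas 𝓘(ℝ, Euc X.dim) ∞ X.Obj :=
  IsManifold.subset_maximalAtlas ⟨i, rfl⟩

/-- A chart of the maximal atlas of a manifold without boundary, as a diffeomorphism between open
sets. -/
def chartDiffeo {E M : Type*} [NormedAddCommGroup E] [NormedSpace ℝ E]
    [TopologicalSpace M] [ChartedSpace E M] [IsManifold 𝓘(ℝ, E) ∞ M] (e : OpenPartialHomeomorph M E)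
    (he : e ∈ IsManifold.maximalAtlas 𝓘(ℝ, E) ∞ M) : PartialDiffeomorph 𝓘(ℝ, E) 𝓘(ℝ, E) M E ∞ where
  toPartialEquiv := e.toPartialEquiv
  open_source := e.open_source
  open_target := e.open_target
  contMDiffOn_toFun := contMDiffOn_of_mem_maximalAtlas he
  contMDiffOn_invFun := contMDiffOn_symm_of_mem_maximalAtlas he

/-- A change of charts, as a diffeomorphism between open subsets of `ℝⁿ`. -/
def chDiffeo {i j : X.Idx} (l : X.Ch i j) :
    PartialDiffeomorph 𝓘(ℝ, Euc X.dim) 𝓘(ℝ, Euc X.dim) (Euc X.dim) (Euc X.dim) ∞ where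
  toPartialEquiv := l.toPH.toPartialEquiv
  open_source := l.toPH.open_source
  open_target := l.toPH.open_target
  contMDiffOn_toFun := l.contDiffOn.contMDiffOn
  contMDiffOn_invFun := l.contDiffOn_symm.contMDiffOn

theorem isLocalDiffeomorph_src :
    IsLocalDiffeomorph 𝓘(ℝ, Euc X.dim) 𝓘(ℝ, Euc X.dim) ∞ (src : X.Arr → X.Obj) := by
  intro a
  obtain ⟨i, j, l, x, h, rfl⟩ := exists_germ a
  refine ⟨(chartDiffeo _ (germPH_mem_maximalAtlas l)).trans
    (chartDiffeo _ (objChart_mem_maximalAtlas i)).symm, ⟨⟨x, h, rfl⟩, x.2⟩, ?_⟩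
  rintro _ ⟨⟨y, hy, rfl⟩, -⟩
  exact (objChart_symm_apply y).symm

theorem isLocalDiffeomorph_tgt :
    IsLocalDiffeomorph 𝓘(ℝ, Euc X.dim) 𝓘(ℝ, Euc X.dim) ∞ (tgt : X.Arr → X.Obj) := by
  intro a
  obtain ⟨i, j, l, x, h, rfl⟩ := exists_germ a
  refine ⟨((chartDiffeo _ (germPH_mem_maximalAtlas l)).trans (chDiffeo l)).trans
    (chartDiffeo _ (objChart_mem_maximalAtlas j)).symm,
    ⟨⟨⟨x, h, rfl⟩, h⟩, l.cod_le (l.mem_cod h)⟩, ?_⟩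
  rintro _ ⟨⟨⟨y, hy, rfl⟩, -⟩, -⟩
  exact (objChart_symm_apply (l.apply y hy)).symm

theorem continuous_src : Continuous (src : X.Arr → X.Obj) :=
  isLocalDiffeomorph_src.contMDiff.continuous

theorem continuous_tgt : Continuous (tgt : X.Arr → X.Obj) :=
  isLocalDiffeomorph_tgt.contMDiff.continuous

section Smooth

variable {E H M : Type*} [NormedAddCommGroup E] [NormedSpace ℝ E] [TopologicalSpace H]
  {I : ModelWithCorners ℝ E H} [TopologicalSpace M] [ChartedSpace H M]

/-- A map whose values near `m` are germs of a fixed change of charts is smooth if the base points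
of these germs vary smoothly. -/
theorem contMDiffAt_of_eventually_germ {α : M → X.Arr} {m : M} {i j : X.Idx} {l : X.Ch i j}
    {φ : M → Euc X.dim} (hφ : ContMDiffAt I 𝓘(ℝ, Euc X.dim) ∞ φ m)
    (h : ∀ᶠ m' in 𝓝 m, ∃ (x : X.sp i) (hx : (x : Euc X.dim) ∈ l.dom),
      φ m' = x ∧ α m' = germ l x hx) : ContMDiffAt I 𝓘(ℝ, Euc X.dim) ∞ α m := by
  have hm : φ m ∈ (germPH l).target := by
    obtain ⟨x, hx, e, -⟩ := h.self_of_nhds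
    rw [e]; exact hx
  refine ((contMDiffAt_symm_of_mem_maximalAtlas (germPH_mem_maximalAtlas l) hm).comp m
    hφ).congr_of_eventuallyEq ?_
  filter_upwards [h] with m' hm'
  obtain ⟨x, hx, e, e'⟩ := hm'
  rw [e', Function.comp_apply, e, germPH_symm_apply l x hx]

theorem contMDiffAt_sigmaMk_comp {i : X.Idx} {φ : M → X.sp i} {m : M}
    (hφ : ContMDiffAt I 𝓘(ℝ, Euc X.dim) ∞ (fun m => (φ m : Euc X.dim)) m) :
    ContMDiffAt I 𝓘(ℝ, Euc X.dim) ∞ (fun m => (⟨i, φ m⟩ : X.Obj)) m := by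
  refine ((contMDiffAt_symm_of_mem_maximalAtlas (objChart_mem_maximalAtlas i) (φ m).2).comp m
    hφ).congr_of_eventuallyEq (Eventually.of_forall fun m' => ?_)
  exact (objChart_symm_apply (φ m')).symm

/-- A map on the disjoint union of the `X̃ᵢ` is smooth if its restrictions to the `X̃ᵢ` are. -/
theorem contMDiffAt_of_comp_sigmaMk {F : X.Obj → M} {i : X.Idx} {x : X.sp i}
    (hF : ContMDiffAt 𝓘(ℝ, Euc X.dim) I ∞ (fun y : X.sp i => F ⟨i, y⟩) x) :
    ContMDiffAt 𝓘(ℝ, Euc X.dim) I ∞ F ⟨i, x⟩ := by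
  have h1 : ContMDiffAt 𝓘(ℝ, Euc X.dim) I ∞ (fun y : Euc X.dim => F ((X.objChart i).symm y)) x := by
    refine contMDiffAt_subtype_iff.1 (hF.congr_of_eventuallyEq (Eventually.of_forall fun y => ?_))
    exact congrArg F (objChart_symm_apply y)
  have hmem : (⟨i, x⟩ : X.Obj) ∈ (X.objChart i).source := ⟨x, rfl⟩
  refine (ContMDiffAt.comp (⟨i, x⟩ : X.Obj) h1 (contMDiffAt_of_mem_maximalAtlas
    (objChart_mem_maximalAtlas i) hmem)).congr_of_eventuallyEq ?_
  filter_upwards [(X.objChart i).open_source.mem_nhds hmem] with o ho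
  exact congrArg F ((X.objChart i).left_inv ho).symm

end Smooth

theorem contMDiff_val :
    ContMDiff 𝓘(ℝ, Euc X.dim) 𝓘(ℝ, Euc X.dim) ∞ fun o : X.Obj => (o.2 : Euc X.dim) :=
  fun ⟨_, x⟩ => contMDiffAt_of_comp_sigmaMk (contMDiff_subtype_val x)

theorem contMDiff_src_val :
    ContMDiff 𝓘(ℝ, Euc X.dim) 𝓘(ℝ, Euc X.dim) ∞ fun a : X.Arr => ((src a).2 : Euc X.dim) :=
  contMDiff_val.comp isLocalDiffeomorph_src.contMDiff

theorem contMDiff_tgt_val :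
    ContMDiff 𝓘(ℝ, Euc X.dim) 𝓘(ℝ, Euc X.dim) ∞ fun a : X.Arr => ((tgt a).2 : Euc X.dim) :=
  contMDiff_val.comp isLocalDiffeomorph_tgt.contMDiff

theorem contMDiff_one : ContMDiff 𝓘(ℝ, Euc X.dim) 𝓘(ℝ, Euc X.dim) ∞ (one : X.Obj → X.Arr) := by
  rintro ⟨i, x⟩
  refine contMDiffAt_of_comp_sigmaMk ?_
  exact contMDiffAt_of_eventually_germ (l := ChangeOfCharts.refl (X.chart i))
    (contMDiff_subtype_val x) (Eventually.of_forall fun y => ⟨y, y.2, rfl, rfl⟩)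

theorem contMDiff_inv : ContMDiff 𝓘(ℝ, Euc X.dim) 𝓘(ℝ, Euc X.dim) ∞ (inv : X.Arr → X.Arr) := by
  intro a
  obtain ⟨i, j, l, x, h, rfl⟩ := exists_germ a
  obtain ⟨l', h', -, hl⟩ := l.exists_inv h
  refine contMDiffAt_of_eventually_germ (l := l') (contMDiff_tgt_val _) ?_
  have hN : ∀ᶠ b in 𝓝 (germ l x h), ((tgt b).2 : Euc X.dim) ∈ l'.dom :=
    (contMDiff_tgt_val.continuous.continuousAt (x := germ l x h)).tendsto.eventually
      (l'.eventually_mem h')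
  filter_upwards [hN, germs_mem_nhds l x h] with b hb hbl
  obtain ⟨y, hy, rfl⟩ := hbl
  refine ⟨l.apply y hy, hb, rfl, inv_germ hy hb rfl ?_⟩
  filter_upwards [l.eventually_mem hy, (l.continuousAt hy).tendsto.eventually
    (l'.eventually_mem hb)] with z hz hz'
  exact hl z hz hz'

/-- The multiplication of germs is smooth: near a composable pair it is the restriction of a smooth
map that only depends on the base point of the first germ. -/
theorem exists_contMDiffOn_eq_mul (a b : X.Arr) (hab : tgt a = src b) :
    ∃ (U : Set (X.Arr × X.Arr)) (F : X.Arr × X.Arr → X.Arr), IsOpen U ∧ (a, b) ∈ U ∧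
      ContMDiffOn (𝓘(ℝ, Euc X.dim).prod 𝓘(ℝ, Euc X.dim)) 𝓘(ℝ, Euc X.dim) ∞ F U ∧
      ∀ (a' b' : X.Arr) (h : tgt a' = src b'), (a', b') ∈ U → F (a', b') = mul a' b' h := by
  obtain ⟨i, j, k, l, l', x, h, h', rfl, rfl⟩ := exists_pair a b hab
  obtain ⟨n, hn, -, en⟩ := l.exists_comp l' h h' univ_mem
  refine ⟨(germs l ∩ {a | ((src a).2 : Euc X.dim) ∈ n.dom}) ×ˢ germs l',
    fun p => (germPH n).symm (src p.1).2, ?_, ⟨⟨⟨x, h, rfl⟩, hn⟩, ⟨_, h', rfl⟩⟩, ?_, ?_⟩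
  · exact ((isOpen_germs l).inter (n.dom.2.preimage contMDiff_src_val.continuous)).prod
      (isOpen_germs l')
  · rintro ⟨a, b⟩ ⟨⟨-, ha⟩, -⟩
    exact ((contMDiffAt_symm_of_mem_maximalAtlas (germPH_mem_maximalAtlas n) ha).comp (a, b)
      ((contMDiff_src_val a).comp (a, b)
        (contMDiffAt_fst (I := 𝓘(ℝ, Euc X.dim)) (J := 𝓘(ℝ, Euc X.dim))))).contMDiffWithinAt
  · rintro _ _ hc ⟨⟨⟨y, hy, rfl⟩, hyn⟩, ⟨z, hz, rfl⟩⟩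
    have hc' : l.apply y hy = z := by
      rw [tgt_germ, src_germ] at hc
      exact eq_of_heq (Sigma.mk.inj hc).2
    refine (germPH_symm_apply n y hyn).trans (mul_germ hy hz hyn ?_ hc ?_).symm
    · rw [← hc']
    · exact mem_of_superset (n.eventually_mem hyn) fun w hw => (en w hw).2.2

end RedAtl

/-! ### Separation, paracompactness and properness -/

/-- A space with a proper map to a paracompact space is paracompact: finitely many members of an
open cover cover the preimage of a neighbourhood of a given point. -/
theorem paracompactSpace_of_isProperMap {A : Type u} {B : Type u} [TopologicalSpace A]
    [TopologicalSpace B] [ParacompactSpace B] {f : A → B} (hf : IsProperMap f) :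
    ParacompactSpace A := by
  refine ⟨fun α s ho hc => ?_⟩
  have hfib : ∀ b, ∃ T : Finset α, f ⁻¹' {b} ⊆ ⋃ a ∈ T, s a := fun b =>
    (hf.isCompact_preimage isCompact_singleton).elim_finite_subcover s ho (hc ▸ subset_univ _)
  choose T hT using hfib
  have hV : ∀ b, ∃ V : Set B, IsOpen V ∧ b ∈ V ∧ f ⁻¹' V ⊆ ⋃ a ∈ T b, s a := by
    intro b
    have hU : IsOpen (⋃ a ∈ T b, s a) := isOpen_biUnion fun a _ => ho a
    refine ⟨(f '' (⋃ a ∈ T b, s a)ᶜ)ᶜ, (hf.isClosedMap _ hU.isClosed_compl).isOpen_compl, ?_, ?_⟩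
    · rintro ⟨a, ha, rfl⟩
      exact ha (hT _ rfl)
    · intro a ha
      by_contra hn
      exact ha ⟨a, hn, rfl⟩
  choose V hVo hbV hVT using hV
  obtain ⟨W, hWo, hWc, hWlf, hWV⟩ := precise_refinement V hVo
    (eq_univ_of_forall fun b => mem_iUnion.2 ⟨b, hbV b⟩)
  refine ⟨Σ b, T b, fun p => f ⁻¹' W p.1 ∩ s p.2, fun p => ((hWo _).preimage hf.continuous).inter
    (ho _), eq_univ_of_forall fun x => ?_, fun x => ?_, fun p => ⟨p.2, inter_subset_right⟩⟩
  · obtain ⟨b, hb⟩ := mem_iUnion.1 (hWc ▸ mem_univ (f x))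
    obtain ⟨a, ha, hxa⟩ := mem_iUnion₂.1 (hVT b (hWV b hb))
    exact mem_iUnion.2 ⟨⟨b, a, ha⟩, hb, hxa⟩
  · obtain ⟨N, hN, hfin⟩ := hWlf (f x)
    refine ⟨f ⁻¹' N, hf.continuous.continuousAt.preimage_mem_nhds hN, ?_⟩
    refine (hfin.preimage' (f := Sigma.fst) fun b _ => ?_).subset ?_
    · refine (finite_range fun a : T b => (⟨b, a⟩ : Σ b, T b)).subset ?_
      rintro ⟨_, a⟩ rfl
      exact ⟨a, rfl⟩
    · rintro p ⟨y, hy, hyN⟩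
      exact ⟨f y, hy.1, hyN⟩

namespace RedAtl

variable {X : RedAtl.{u}}

instance t2Space_obj : T2Space X.Obj := inferInstance

instance paracompactSpace_obj_prod : ParacompactSpace (X.Obj × X.Obj) := by
  let : MetricSpace X.Obj := Metric.Sigma.metricSpace
  infer_instance

instance paracompactSpace_obj : ParacompactSpace X.Obj := by
  let : MetricSpace X.Obj := Metric.Sigma.metricSpace
  infer_instance

/-- The derivative of a germ at its source. -/
def deriv (a : X.Arr) : Euc X.dim →L[ℝ] Euc X.dim :=
  Quotient.lift (fun a : X.LocalArr => fderiv ℝ a.l a.x)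
    (by rintro _ _ ⟨l, l', x, h, h', e⟩; exact e.fderiv_eq) a

theorem continuous_deriv : Continuous (deriv : X.Arr → _) := by
  refine continuous_iff_continuousAt.2 fun a => ?_
  obtain ⟨i, j, l, x, h, rfl⟩ := exists_germ a
  have h1 : ContinuousAt (fderiv ℝ l) (x : Euc X.dim) :=
    ((l.contDiffAt h).fderiv_right (m := 0) (by simp)).continuousAt
  have h2 : ContinuousAt (fun b : X.Arr => fderiv ℝ l ((src b).2 : Euc X.dim)) (germ l x h) :=
    ContinuousAt.comp (f := fun b : X.Arr => ((src b).2 : Euc X.dim)) h1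
      contMDiff_src_val.continuous.continuousAt
  refine h2.congr ?_
  filter_upwards [germs_mem_nhds l x h] with b hb
  obtain ⟨y, hy, rfl⟩ := hb
  rfl

/-- A germ is determined by its source, its target and its derivative. -/
theorem injective_src_tgt_deriv :
    Function.Injective fun a : X.Arr => (src a, tgt a, deriv a) := by
  intro a b hab
  obtain ⟨i, j, l, x, h, rfl⟩ := exists_germ a
  obtain ⟨i', j', l', x', h', rfl⟩ := exists_germ b
  obtain ⟨e1, e23⟩ := Prod.mk.inj hab
  obtain ⟨e2, e3⟩ := Prod.mk.inj e23
  rw [src_germ, src_germ] at e1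
  cases e1
  rw [tgt_germ, tgt_germ] at e2
  obtain rfl : j = j' := congrArg Sigma.fst e2
  exact germ_eq_iff.2 (ChangeOfCharts.eventuallyEq_of_fderiv_eq h h'
    (congrArg Subtype.val (eq_of_heq (Sigma.mk.inj e2).2)) e3)

instance t2Space_arr : T2Space X.Arr :=
  .of_injective_continuous injective_src_tgt_deriv
    (continuous_src.prodMk (continuous_tgt.prodMk continuous_deriv))

theorem exists_ch_apply_eq {i j : X.Idx} (x : X.sp i) (y : X.sp j)
    (h : (X.chart i).proj x = (X.chart j).proj y) :
    ∃ (l : X.Ch i j) (hx : (x : Euc X.dim) ∈ l.dom), l.apply x hx = y := by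
  obtain ⟨l, hl⟩ := X.compatible i j x y h
  obtain ⟨g, hg, e⟩ := ((X.chart j).proj_eq_proj_iff (l.apply x hl) y).1
    ((l.proj_apply x hl).trans h)
  obtain ⟨n, hn, -, en⟩ := l.exists_comp (ChangeOfCharts.ofPerm ⟨g, hg⟩) hl
    (l.apply x hl).2 univ_mem
  refine ⟨n, hn, Subtype.ext ?_⟩
  rw [← e]
  exact (en x hn).2.2.trans (ChangeOfCharts.ofPerm_apply ⟨g, hg⟩ (l.apply x hl))

/-- The map from the disjoint union of the `X̃ᵢ` to `X`. -/
def objProj (o : X.Obj) : X.carrier := (X.chart o.1).proj o.2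

theorem continuous_objProj : Continuous (objProj : X.Obj → X.carrier) :=
  continuous_sigma fun i => (X.chart i).continuous_proj

theorem objProj_tgt (a : X.Arr) : objProj (tgt a) = objProj (src a) := by
  obtain ⟨i, j, l, x, h, rfl⟩ := exists_germ a
  exact l.proj_apply x h

/-- The map `(s, t)` is proper: near a pair of points with the same image in `X`, the germs are those
of finitely many changes of charts, by `ChangeOfCharts.exists_eventuallyEq_ofPerm_comp`. -/
theorem isProperMap_src_tgt : IsProperMap fun a : X.Arr => (src a, tgt a) := by
  have := X.t2Space
  refine isProperMap_iff_ultrafilter_of_t2.2 ⟨continuous_src.prodMk continuous_tgt, ?_⟩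
  rintro 𝒰 ⟨⟨i, x⟩, ⟨j, y⟩⟩ hlim
  have hs : Tendsto src (𝒰 : Filter X.Arr) (𝓝 (⟨i, x⟩ : X.Obj)) :=
    (continuous_fst.tendsto _).comp hlim
  have ht : Tendsto tgt (𝒰 : Filter X.Arr) (𝓝 (⟨j, y⟩ : X.Obj)) :=
    (continuous_snd.tendsto _).comp hlim
  have hxy : (X.chart i).proj x = (X.chart j).proj y :=
    tendsto_nhds_unique ((continuous_objProj.tendsto _).comp hs)
      (((continuous_objProj.tendsto _).comp ht).congr objProj_tgt)
  obtain ⟨l, hl, hly⟩ := exists_ch_apply_eq x y hxy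
  have hsv : Tendsto (fun a : X.Arr => ((src a).2 : Euc X.dim)) 𝒰 (𝓝 (x : Euc X.dim)) :=
    (contMDiff_val.continuous.tendsto _).comp hs
  -- a change of charts near `x` for each element of the group of the target chart
  have hn : ∀ g : (X.chart j).G, ∃ n : X.Ch i j, (x : Euc X.dim) ∈ n.dom ∧
      ∀ z ∈ n.dom, z ∈ l.dom ∧ n z = ChangeOfCharts.ofPerm g (l z) := fun g => by
    obtain ⟨n, hn, -, en⟩ := l.exists_comp (ChangeOfCharts.ofPerm g) hl
      (l.apply x hl).2 univ_mem
    exact ⟨n, hn, fun z hz => ⟨(en z hz).1, (en z hz).2.2⟩⟩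
  choose n hxn hn using hn
  have hfin := (X.chart j).finite_G
  have hdom : ∀ᶠ a in (𝒰 : Filter X.Arr), ∀ g, ((src a).2 : Euc X.dim) ∈ (n g).dom :=
    eventually_all.2 fun g => hsv.eventually ((n g).eventually_mem (hxn g))
  have hidx : ∀ᶠ a in (𝒰 : Filter X.Arr), (src a).1 = i ∧ (tgt a).1 = j := by
    filter_upwards [hs.eventually (isOpen_range_sigmaMk.mem_nhds ⟨x, rfl⟩),
      ht.eventually (isOpen_range_sigmaMk.mem_nhds ⟨y, rfl⟩)] with a ha ha'
    obtain ⟨_, e⟩ := ha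
    obtain ⟨_, e'⟩ := ha'
    rw [← e, ← e']
    exact ⟨rfl, rfl⟩
  have hmem : ∀ᶠ a in (𝒰 : Filter X.Arr), ∃ g, a ∈ germs (n g) := by
    filter_upwards [hdom, hidx] with a ha ha'
    obtain ⟨i', j', m, z, hz, rfl⟩ := exists_germ a
    obtain ⟨rfl, rfl⟩ := ha'
    have hzl : (z : Euc X.dim) ∈ l.dom := (hn 1 z (ha 1)).1
    obtain ⟨g, hg⟩ := ChangeOfCharts.exists_eventuallyEq_ofPerm_comp l m hzl hz
    refine ⟨g, z, ha g, germ_eq_iff.2 (hg.trans ?_)⟩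
    exact mem_of_superset ((n g).eventually_mem (ha g)) fun w hw => (hn g w hw).2.symm
  obtain ⟨g, hg⟩ := Ultrafilter.eventually_exists_iff.1 hmem
  refine ⟨germ (n g) x (hxn g), ?_⟩
  -- the germs of `n g` converge because their base points do
  have hc : Tendsto (fun a : X.Arr => (germPH (n g)).symm ((src a).2 : Euc X.dim)) 𝒰
      (𝓝 (germ (n g) x (hxn g))) := by
    rw [← germPH_symm_apply (n g) x (hxn g)]
    exact ((germPH (n g)).continuousAt_symm (hxn g)).tendsto.comp hsv
  refine Tendsto.congr' (f₂ := id) ?_ hc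
  filter_upwards [hg] with a ha
  exact (germPH (n g)).left_inv ha

instance paracompactSpace_arr : ParacompactSpace X.Arr :=
  paracompactSpace_of_isProperMap isProperMap_src_tgt

end RedAtl

/-! ### The strict 2-functor -/

namespace RedAtl

theorem isEtaleGroupoid_germGroupoid (X : RedAtl.{u}) : X.germGroupoid.IsEtaleGroupoid where
  isManifold_obj := isManifold_obj (X := X)
  t2_obj := t2Space_obj (X := X)
  paracompact_obj := paracompactSpace_obj (X := X)
  isManifold_arr := isManifold_arr (X := X)
  t2_arr := t2Space_arr (X := X)
  paracompact_arr := paracompactSpace_arr (X := X)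
  etale_s := isLocalDiffeomorph_src (X := X)
  etale_t := isLocalDiffeomorph_tgt (X := X)
  smooth_e := contMDiff_one (X := X)
  smooth_inv := contMDiff_inv (X := X)
  smooth_mul := exists_contMDiffOn_eq_mul (X := X)
  s_e := src_one (X := X)
  t_e := tgt_one (X := X)
  s_mul := src_mul (X := X)
  t_mul := tgt_mul (X := X)
  mul_assoc := mul_assoc' (X := X)
  e_mul a := one_mul' (X := X) a _ (tgt_one _)
  mul_e a := mul_one' (X := X) a _ rfl
  inv_inv := inv_inv (X := X)
  s_inv := src_inv (X := X)
  t_inv := tgt_inv (X := X)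
  mul_inv := mul_inv_self (X := X)
  inv_mul := inv_mul_self (X := X)

theorem isEffective_germGroupoid (X : RedAtl.{u}) : X.germGroupoid.IsEffective := by
  rintro o (a : X.Arr) (b : X.Arr) f ha ha' hb hb' ka kb
  obtain ⟨i, j, l, x, h, rfl⟩ := exists_germ a
  obtain ⟨i', j', l', x', h', rfl⟩ := exists_germ b
  have e : (⟨i, x⟩ : X.Obj) = ⟨i', x'⟩ := ha.trans hb.symm
  cases e
  obtain rfl : j = j' := congrArg Sigma.fst (ha'.trans hb'.symm :
    (⟨j, l.apply x h⟩ : X.Obj) = ⟨j', l'.apply x h'⟩)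
  -- the target of the germ at a nearby point is the value of `f` there
  have key : ∀ (m : X.Ch i j) (hm : (x : Euc X.dim) ∈ m.dom),
      (tgt =ᶠ[𝓝 (germ m x hm)] f ∘ src) →
      ∀ᶠ y in 𝓝 (x : Euc X.dim), ∀ hy : y ∈ m.dom,
        (⟨j, m.apply ⟨y, m.dom_le hy⟩ hy⟩ : X.Obj) = f ⟨i, ⟨y, m.dom_le hy⟩⟩ := by
    intro m hm k
    have hc := (germPH m).continuousAt_symm (x := (x : Euc X.dim)) hm
    rw [ContinuousAt, germPH_symm_apply m x hm] at hc
    filter_upwards [hc.eventually k] with y hy hym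
    have hs := germPH_symm_apply m ⟨y, m.dom_le hym⟩ hym
    simp only at hs
    rw [hs] at hy
    exact hy
  refine germ_eq_iff.2 ?_
  filter_upwards [key l h ka, key l' h' kb, l.eventually_mem h, l'.eventually_mem h']
    with y h1 h2 h3 h4
  exact congrArg Subtype.val (eq_of_heq (Sigma.mk.inj ((h1 h3).trans (h2 h4).symm)).2)

end RedAtl

open RedAtl GroupoidData

variable {X Y : RedAtl.{u}}

theorem PreMor.contMDiff_objMap (p : PreMor X Y) :
    ContMDiff 𝓘(ℝ, Euc X.dim) 𝓘(ℝ, Euc Y.dim) ∞ p.objMap := fun ⟨i, x⟩ =>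
  contMDiffAt_of_comp_sigmaMk (contMDiffAt_sigmaMk_comp (φ := p.lift i)
    ((contMDiff_subtype_val.comp (p.smooth_lift i)) x))

theorem Mor.contMDiff_arrMap (f : Mor X Y) :
    ContMDiff 𝓘(ℝ, Euc X.dim) 𝓘(ℝ, Euc Y.dim) ∞ f.arrMap := by
  intro a
  obtain ⟨r, hr⟩ := Quotient.exists_rep f.cls
  obtain ⟨i, j, l, x, h, rfl⟩ := r.exists_mem a
  refine contMDiffAt_of_eventually_germ (l := r.ν l) ((contMDiff_val.comp
    (f.contMDiff_objMap.comp isLocalDiffeomorph_src.contMDiff)) _) ?_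
  filter_upwards [germs_mem_nhds l.1 x h] with b hb
  obtain ⟨y, hy, rfl⟩ := hb
  exact ⟨f.lift i y, r.lift_mem_dom l y hy, rfl, f.arrMap_germ r hr l y hy⟩

theorem TwoRep.contMDiff_val {f g : Mor X Y} (δ : TwoRep f g) :
    ContMDiff 𝓘(ℝ, Euc X.dim) 𝓘(ℝ, Euc Y.dim) ∞ δ.val := by
  rintro ⟨i, x⟩
  obtain ⟨a, ha, hx⟩ := δ.cover i x
  refine contMDiffAt_of_comp_sigmaMk (contMDiffAt_of_eventually_germ (l := a.2)
    ((contMDiff_subtype_val.comp (f.smooth_lift i)) x) ?_)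
  filter_upwards [a.1.2.mem_nhds hx] with y hy
  exact ⟨f.lift i y, δ.mem_dom ha y hy, rfl, δ.val_eq ha y hy⟩

theorem TwoMor.contMDiff_val {f g : Mor X Y} (δ : TwoMor f g) :
    ContMDiff 𝓘(ℝ, Euc X.dim) 𝓘(ℝ, Euc Y.dim) ∞ δ.val := by
  induction δ using Quotient.inductionOn with
  | h d => exact d.contMDiff_val

theorem Mor.arrMap_inv (f : Mor X Y) (a : X.Arr) :
    f.arrMap (inv a) = inv (f.arrMap a) := by
  refine eq_inv_of_mul_eq_one (by rw [f.tgt_arrMap, f.src_arrMap, src_inv]) ?_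
  rw [← f.arrMap_mul a (inv a) (src_inv a).symm, mul_inv_self, f.arrMap_one, f.src_arrMap]

theorem Mor.isHom (f : Mor X Y) :
    GroupoidData.IsHom X.germGroupoid Y.germGroupoid f.objMap f.arrMap where
  smooth_obj := f.contMDiff_objMap
  smooth_arr := f.contMDiff_arrMap
  s_map := f.src_arrMap
  t_map := f.tgt_arrMap
  map_e := f.arrMap_one
  map_mul := f.arrMap_mul
  map_inv := f.arrMap_inv

/-- The morphism of germ groupoids induced by a morphism of atlases. -/
abbrev Mor.germHom (f : Mor X Y) : GroupoidData.Hom X.germGroupoid Y.germGroupoid :=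
  ⟨f.objMap, f.arrMap, f.isHom⟩

theorem TwoMor.isNatTrans {f g : Mor X Y} (δ : TwoMor f g) :
    GroupoidData.IsNatTrans f.germHom g.germHom δ.val where
  smooth := δ.contMDiff_val
  s_app := δ.isNat.src_app
  t_app := δ.isNat.tgt_app
  naturality := δ.isNat.natural

/-- The natural transformation induced by a 2-morphism of atlases. -/
abbrev TwoMor.germTrans {f g : Mor X Y} (δ : TwoMor f g) :
    GroupoidData.GTrans f.germHom g.germHom := ⟨δ.val, δ.isNatTrans⟩

/-- The proper, effective, étale groupoid of germs of changes of charts. -/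
abbrev RedAtl.toPEEGpd (X : RedAtl.{u}) : PEEGpd.{u} :=
  ⟨X.germGroupoid, X.isEtaleGroupoid_germGroupoid, isProperMap_src_tgt (X := X),
    X.isEffective_germGroupoid⟩

/-- The action of the 2-functor on objects, morphisms and 2-morphisms. -/
def germPrelaxFunctor : PrelaxFunctor RedAtl.{u} PEEGpd.{u} where
  obj X := X.toPEEGpd
  map {X Y} f := (Mor.germHom f : GroupoidData.Hom X.germGroupoid Y.germGroupoid)
  map₂ {_ _ f g} δ := (TwoMor.germTrans δ : GroupoidData.GTrans (Mor.germHom f) (Mor.germHom g))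
  map₂_id f := GTrans.ext (funext fun o => TwoMor.val_id f o)
  map₂_comp δ σ := GTrans.ext (funext fun o => TwoMor.val_vcomp δ σ o)

theorem germPrelaxFunctor_map_id (X : RedAtl.{u}) :
    germPrelaxFunctor.map (𝟙 X) = 𝟙 (germPrelaxFunctor.obj X) :=
  GroupoidData.Hom.ext rfl (funext fun a => Mor.arrMap_id a)

theorem germPrelaxFunctor_map_comp {X Y Z : RedAtl.{u}} (f : X ⟶ Y) (g : Y ⟶ Z) :
    germPrelaxFunctor.map (f ≫ g) = germPrelaxFunctor.map f ≫ germPrelaxFunctor.map g :=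
  GroupoidData.Hom.ext rfl (funext fun a => Mor.arrMap_comp f g a)

/-- Conjugation with the 2-morphisms of an equality of morphisms does not change the components. -/
theorem PEEGpd.app_conj {G H : PEEGpd.{u}} {φ φ' ψ ψ' : G ⟶ H} (e : φ = φ') (e' : ψ' = ψ)
    (α : φ' ⟶ ψ') : GTrans.app (eqToHom e ≫ α ≫ eqToHom e') = GTrans.app α := by
  subst e e'
  rw [eqToHom_refl, eqToHom_refl, Category.id_comp, Category.comp_id]

/-- The strict 2-functor from reduced orbifold atlases to proper, effective, étale groupoids. -/
def germFunctor : StrictPseudofunctor RedAtl.{u} PEEGpd.{u} :=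
  StrictPseudofunctor.mk''
    { germPrelaxFunctor with
      map_id := germPrelaxFunctor_map_id
      map_comp := germPrelaxFunctor_map_comp
      map₂_whisker_left := fun {X Y Z} f {g g'} η => by
        refine GTrans.ext (Eq.trans ?_ (PEEGpd.app_conj (germPrelaxFunctor_map_comp f g)
          (germPrelaxFunctor_map_comp f g').symm _).symm)
        funext o
        exact (TwoMor.val_id_hcomp f η o).trans
          (PEEGpd.id_whisker (germPrelaxFunctor.map f) (germPrelaxFunctor.map₂ η) o).symm
      map₂_whisker_right := fun {X Y Z} {f f'} η g => by
        refine GTrans.ext (Eq.trans ?_ (PEEGpd.app_conj (germPrelaxFunctor_map_comp f g)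
          (germPrelaxFunctor_map_comp f' g).symm _).symm)
        funext o
        exact (TwoMor.val_hcomp_id η g o).trans
          (PEEGpd.whisker_id (germPrelaxFunctor.map₂ η) (germPrelaxFunctor.map g) o).symm }

end RedOrb

end

theorem mainTheorem4 :
    ∃ (h₀ : ∀ X : RedAtl.{u}, X.germGroupoid.IsEtaleGroupoid ∧ X.germGroupoid.IsProper ∧
        X.germGroupoid.IsEffective)
      (h₁ : ∀ {X Y : RedAtl.{u}} (f : Mor X Y),
        GroupoidData.IsHom X.germGroupoid Y.germGroupoid f.objMap f.arrMap)
      (h₂ : ∀ {X Y : RedAtl.{u}} {f g : Mor X Y} (δ : TwoMor f g),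
        GroupoidData.IsNatTrans (G := X.germGroupoid) (H := Y.germGroupoid)
          ⟨f.objMap, f.arrMap, h₁ f⟩ ⟨g.objMap, g.arrMap, h₁ g⟩ δ.val),
      ∃ F : StrictPseudofunctor RedAtl.{u} PEEGpd.{u},
        F.toPrelaxFunctor.toPrelaxFunctorStruct =
          { obj := fun X => ⟨X.germGroupoid, (h₀ X).1, (h₀ X).2.1, (h₀ X).2.2⟩
            map := fun {X Y} f => (⟨Mor.toPreMor f |>.objMap, Mor.arrMap f, h₁ f⟩ :
              GroupoidData.Hom X.germGroupoid Y.germGroupoid)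
            map₂ := fun {X Y f g} δ => (⟨TwoMor.val δ, h₂ δ⟩ :
              GroupoidData.GTrans (G := X.germGroupoid) (H := Y.germGroupoid)
                ⟨Mor.toPreMor f |>.objMap, Mor.arrMap f, h₁ f⟩
                ⟨Mor.toPreMor g |>.objMap, Mor.arrMap g, h₁ g⟩) } ∧
        ∀ {X Y Z : RedAtl.{u}} {f₁ f₂ : X ⟶ Y} {g₁ g₂ : Y ⟶ Z} (δ : f₁ ⟶ f₂) (ξ : g₁ ⟶ g₂),
          (F.map₂ (TwoMor.hcomp δ ξ : f₁ ≫ g₁ ⟶ f₂ ≫ g₂)).app =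
            (GroupoidData.GTrans.hcomp (F.obj Z).isEtale (F.map₂ δ) (F.map₂ ξ)).app := by
  refine ⟨fun X => ⟨X.isEtaleGroupoid_germGroupoid, RedAtl.isProperMap_src_tgt (X := X),
    X.isEffective_germGroupoid⟩, fun f => f.isHom, fun δ => δ.isNatTrans, germFunctor, rfl, ?_⟩
  intro X Y Z f₁ f₂ g₁ g₂ δ ξ
  exact funext fun o => TwoMor.val_hcomp δ ξ o
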